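/- Fix an elementary gate set consisting of the Hadamard gate, the $T$ gate, CNOT, and finitely many (possibly no) further one-qubit unitaries. An efficient quantum algorithm is a polynomial-time uniform family of circuits over this gate set, i.e. one classical machine writes the circuit for given classical input in time $\mathrm{poly}(n)$; the circuit may use $\mathrm{poly}(n)$ ancilla qubits initialised to $|0\rangle$, and qubits that are not output are discarded at the end. Let $m,\kappa:\mathbb N\to\mathbb N$. The ensemble $\eta_{n,m}$ is the distribution of $\operatorname{tr}_m(|\psi\rangle\langle\psi|)$ for an $(n+m)$-qubit Haar random pure state $|\psi\rangle$, where $m$ qubits are traced out. A keyed family of $n$-qubit density matrices $\{\rho_{n,k}\}_{k\in\{0,1\}^{\kappa(n)}}$, $n\in\mathbb N$, is a *pseudorandom density matrix (PRDM)* with security parameter $\kappa$ and mixedness parameter $m$ if $\kappa(n)$ is bounded by a polynomial in $n$ and 1. (efficiently preparable) there is an efficient quantum algorithm that, given $1^n$, $1^{\kappa(n)}$, $m(n)$ and $k\in\{0,1\}^{\kappa(n)}$, outputs $\rho_{n,k}$; 2. (computational indistinguishability) for every polynomial $t$ and every efficient quantum algorithm $\mathcal A$ with one output bit (which is also given $1^n$,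 $1^{\kappa(n)}$, $m(n)$ and $1^{t(n)}$), $$\Big|\Pr_{k\leftarrow\{0,1\}^{\kappa(n)}}[\mathcal A(\rho_{n,k}^{\otimes t(n)})=1]-\Pr_{\rho\leftarrow\eta_{n,m(n)}}[\mathcal A(\rho^{\otimes t(n)})=1]\Big|$$ is negligible, i.e. for every $c\in\mathbb N$ it is smaller than $n^{-c}$ for all sufficiently large $n$. A family $\Gamma=(\Gamma_n)_n$ of quantum channels $\Gamma_n$ on $n$ qubits is *unital* if $\Gamma_n(I)=I$ for all $n$, and *efficiently implementable* if there is an efficient quantum algorithm that, given $1^n$ and an $n$-qubit state, implements $\Gamma_n$. A PRDM is *noise robust* to $\Gamma$ if $\{\Gamma_n(\rho_{n,k})\}_k$ is again a PRDM with the same $\kappa$ and $m$. **Theorem.** Let $\{\rho_{n,k}\}$ be a PRDM with security parameter $\kappa$ and mixedness parameter $m$. Then $\{\rho_{n,k}\}$ is noise robust to every efficiently implementable family of unital channels if and only if $m=\omega(\log n)$, i.e. $\log n=o(m(n))$ as $n\to\infty$. -/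

import Mathlib

open MeasureTheory

noncomputable section

/-! ## Qubit registers

The computational basis of a register of `N` qubits is `Fin N → Bool`, and its operators are the
complex matrices indexed by that basis. -/

/-- Operators on `N` qubits. -/
abbrev QOp (N : ℕ) : Type := Matrix (Fin N → Bool) (Fin N → Bool) ℂ

/-- The pure state `|0…0⟩⟨0…0|` on `N` qubits. -/
def zeroState (N : ℕ) : QOp N :=
  Matrix.of fun x y => if (∀ i, x i = false) ∧ (∀ i, y i = false) then 1 else 0

/-- `ρ ⊗ |0…0⟩⟨0…0|`: a state on `n` qubits together with `a` fresh ancilla qubits, which come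
after the first `n` qubits. -/
def addAncillas (n a : ℕ) (ρ : QOp n) : QOp (n + a) :=
  Matrix.of fun x y => ρ (fun i => x (Fin.castAdd a i)) (fun i => y (Fin.castAdd a i)) *
    zeroState a (fun j => x (Fin.natAdd n j)) (fun j => y (Fin.natAdd n j))

/-- Partial trace over the last `a` of `n + a` qubits. -/
def traceOutLast (n a : ℕ) (M : QOp (n + a)) : QOp n :=
  Matrix.of fun x y => ∑ z : Fin a → Bool, M (Fin.append x z) (Fin.append y z)

/-- `ρ^{⊗ t}` for an `n`-qubit operator `ρ`: copy number `j` sits on the qubits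
`n * j, …, n * j + n - 1`. -/
def copies (n t : ℕ) (ρ : QOp n) : QOp (t * n) :=
  Matrix.of fun x y => ∏ j : Fin t,
    ρ (fun i => x (finProdFinEquiv (j, i))) (fun i => y (finProdFinEquiv (j, i)))

/-! ## Gates and circuits -/

/-- Elementary gates: Hadamard, `T`, controlled-NOT, and further one-qubit gates named by `ι`.
The gates act on qubits named by `Q`. -/
inductive Gate (ι Q : Type) : Type
  | hadamard (q : Q)
  | tgate (q : Q)
  | cnot (control target : Q)
  | extra (i : ι) (q : Q)

/-- Rename the qubits of a gate. -/
def Gate.map {ι Q Q' : Type} (f : Q → Q') : Gate ι Q → Gate ι Q'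
  | .hadamard q => .hadamard (f q)
  | .tgate q => .tgate (f q)
  | .cnot c t => .cnot (f c) (f t)
  | .extra i q => .extra i (f q)

/-- The gate acts on (distinct) qubits with numbers below `N`. -/
def Gate.Valid {ι : Type} (N : ℕ) : Gate ι ℕ → Prop
  | .hadamard q => q < N
  | .tgate q => q < N
  | .cnot c t => c < N ∧ t < N ∧ c ≠ t
  | .extra _ q => q < N

/-- The Hadamard matrix. -/
def hadamardMatrix : Matrix Bool Bool ℂ :=
  Matrix.of fun a b => (if a = true ∧ b = true then -1 else 1) / (Real.sqrt 2 : ℂ)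

/-- The matrix of the `T` gate, `diag(1, e^{iπ/4})`. -/
def tMatrix : Matrix Bool Bool ℂ :=
  Matrix.diagonal fun b => if b = true then Complex.exp (Complex.I * (Real.pi / 4 : ℝ)) else 1

/-- The one-qubit operator `u` applied to qubit `q` of `N` (the identity if there is no such
qubit). -/
def onQubit (N q : ℕ) (u : Matrix Bool Bool ℂ) : QOp N :=
  if h : q < N then
    Matrix.of fun x y =>
      if ∀ j : Fin N, j ≠ ⟨q, h⟩ → x j = y j then u (x ⟨q, h⟩) (y ⟨q, h⟩) else 0
  else 1

/-- The controlled-NOT gate on `N` qubits (the identity if control and target are not two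
distinct qubits of the register). -/
def cnotMatrix (N c t : ℕ) : QOp N :=
  if h : c < N ∧ t < N ∧ c ≠ t then
    Matrix.of fun x y =>
      if x = Function.update y ⟨t, h.2.1⟩ (xor (y ⟨t, h.2.1⟩) (y ⟨c, h.1⟩)) then 1 else 0
  else 1

/-- The unitary of a gate on `N` qubits, where `𝒢` gives the matrices of the further one-qubit
gates. -/
def Gate.toMatrix {ι : Type} (𝒢 : ι → Matrix.unitaryGroup Bool ℂ) (N : ℕ) : Gate ι ℕ → QOp N
  | .hadamard q => onQubit N q hadamardMatrix
  | .tgate q => onQubit N q tMatrix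
  | .cnot c t => cnotMatrix N c t
  | .extra i q => onQubit N q (𝒢 i : Matrix Bool Bool ℂ)

/-- The unitary of a circuit on `N` qubits; the head of the list is the gate applied first. -/
def circuitMatrix {ι : Type} (𝒢 : ι → Matrix.unitaryGroup Bool ℂ) (N : ℕ) :
    List (Gate ι ℕ) → QOp N
  | [] => 1
  | g :: C => circuitMatrix 𝒢 N C * g.toMatrix 𝒢 N

/-- The state of the `n + a` qubits after running the circuit `C` on the `n`-qubit input `ρ` and
`a` ancilla qubits in state `0`. -/
def runCircuit {ι : Type} (𝒢 : ι → Matrix.unitaryGroup Bool ℂ) (n a : ℕ)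
    (C : List (Gate ι ℕ)) (ρ : QOp n) : QOp (n + a) :=
  circuitMatrix 𝒢 (n + a) C * addAncillas n a ρ * (circuitMatrix 𝒢 (n + a) C).conjTranspose

/-- The map on `n`-qubit operators implemented by a circuit with `a` ancilla qubits, which are
discarded at the end. -/
def circuitChannel {ι : Type} (𝒢 : ι → Matrix.unitaryGroup Bool ℂ) (n a : ℕ)
    (C : List (Gate ι ℕ)) (ρ : QOp n) : QOp n :=
  traceOutLast n a (runCircuit 𝒢 n a C ρ)

/-- The probability that the circuit `C` outputs `1` on input `ρ`, that is, that a measurement of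
qubit number `0` after the run of the circuit gives `1`. -/
def acceptProb {ι : Type} (𝒢 : ι → Matrix.unitaryGroup Bool ℂ) (n a : ℕ)
    (C : List (Gate ι ℕ)) (ρ : QOp n) : ℝ :=
  ∑ x : Fin (n + a) → Bool,
    open Classical in
    if ∃ i : Fin (n + a), (i : ℕ) = 0 ∧ x i = true then (runCircuit 𝒢 n a C ρ x x).re else 0

/-! ## Polynomial-time uniform circuit families

The classical machine that writes the circuits is a multi-stack machine (equivalently, up to
polynomial overhead, a multi-tape Turing machine) with structured control. A program mentions
finitely many stacks of bits, and can append gates to a write-only output. -/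

/-- Programs of the machine; stacks are named by natural numbers. -/
inductive Prog (ι : Type) : Type
  | skip
  | push (r : ℕ) (b : Bool)
  | pop (r : ℕ)
  /-- Write a gate; the number of each of its qubits is the current height of the named stack. -/
  | emit (g : Gate ι ℕ)
  | seq (P Q : Prog ι)
  /-- Run `P` if the top of stack `r` is `1`, and `Q` otherwise. -/
  | branch (r : ℕ) (P Q : Prog ι)
  /-- Repeat `P` as long as stack `r` is not empty. -/
  | loop (r : ℕ) (P : Prog ι)

/-- The contents of all stacks, with the top of a stack first. -/
abbrev Store : Type := ℕ → List Bool

/-- `Runs P s s' C T`: started with stacks `s`, the program `P` halts after `T` steps with stacks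
`s'`, having written the gates `C`. -/
inductive Runs {ι : Type} : Prog ι → Store → Store → List (Gate ι ℕ) → ℕ → Prop
  | skip (s : Store) : Runs .skip s s [] 1
  | push (s : Store) (r : ℕ) (b : Bool) :
      Runs (.push r b) s (Function.update s r (b :: s r)) [] 1
  | pop (s : Store) (r : ℕ) : Runs (.pop r) s (Function.update s r (s r).tail) [] 1
  | emit (s : Store) (g : Gate ι ℕ) : Runs (.emit g) s s [g.map fun r => (s r).length] 1
  | seq {P Q : Prog ι} {s₀ s₁ s₂ : Store} {C D : List (Gate ι ℕ)} {T U : ℕ}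
      (hP : Runs P s₀ s₁ C T) (hQ : Runs Q s₁ s₂ D U) : Runs (.seq P Q) s₀ s₂ (C ++ D) (T + U)
  | branch_true {r : ℕ} {P Q : Prog ι} {s s' : Store} {C : List (Gate ι ℕ)} {T : ℕ}
      (hr : (s r).head? = some true) (h : Runs P s s' C T) : Runs (.branch r P Q) s s' C (T + 1)
  | branch_false {r : ℕ} {P Q : Prog ι} {s s' : Store} {C : List (Gate ι ℕ)} {T : ℕ}
      (hr : (s r).head? ≠ some true) (h : Runs Q s s' C T) : Runs (.branch r P Q) s s' C (T + 1)
  | loop_done {r : ℕ} {P : Prog ι} {s : Store} (hr : s r = []) : Runs (.loop r P) s s [] 1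
  | loop_step {r : ℕ} {P : Prog ι} {s₀ s₁ s₂ : Store} {C D : List (Gate ι ℕ)} {T U : ℕ}
      (hr : s₀ r ≠ []) (hP : Runs P s₀ s₁ C T) (hQ : Runs (.loop r P) s₁ s₂ D U) :
      Runs (.loop r P) s₀ s₂ (C ++ D) (T + U + 1)

/-- The stacks `0, 1, 2, …` hold the given inputs, and all other stacks are empty. -/
def inputStore (l : List (List Bool)) : Store := fun r => l.getD r []

/-- The unary string `1ⁿ`. -/
def unary (n : ℕ) : List Bool := List.replicate n true

/-- `C` is a polynomial-time uniform family of quantum circuits: a single program, on the classical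
input `input x`, writes the circuit `C x` within polynomially many (in `size x`) steps, and this
circuit is one on `width x` qubits. -/
def UniformCircuits {ι X : Type} (size : X → ℕ) (input : X → List (List Bool)) (width : X → ℕ)
    (C : X → List (Gate ι ℕ)) : Prop :=
  ∃ (P : Prog ι) (p : Polynomial ℕ), ∀ x : X,
    (∃ (s : Store) (T : ℕ), Runs P (inputStore (input x)) s (C x) T ∧ T ≤ p.eval (size x)) ∧
    ∀ g ∈ C x, g.Valid (width x)

/-! ## Quantum channels -/

/-- A quantum channel on `n` qubits, in Kraus form. -/
def IsQuantumChannel (n : ℕ) (Γ : QOp n → QOp n) : Prop :=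
  ∃ (r : ℕ) (K : Fin r → QOp n), (∑ j, (K j).conjTranspose * K j = 1) ∧
    ∀ ρ, Γ ρ = ∑ j, K j * ρ * (K j).conjTranspose

/-- The channel fixes the identity. -/
def IsUnital (n : ℕ) (Γ : QOp n → QOp n) : Prop := Γ 1 = 1

/-- The channels `Γ n` on `n` qubits are implemented by a quantum polynomial-time algorithm that
is given `1ⁿ` and the `n`-qubit state, with polynomially many ancilla qubits. -/
def EfficientlyImplementable {ι : Type} (𝒢 : ι → Matrix.unitaryGroup Bool ℂ)
    (Γ : (n : ℕ) → QOp n → QOp n) : Prop :=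
  ∃ (a : Polynomial ℕ) (C : ℕ → List (Gate ι ℕ)),
    UniformCircuits (fun n => n) (fun n => [unary n]) (fun n => n + a.eval n) C ∧
    ∀ n ρ, Γ n ρ = circuitChannel 𝒢 n (a.eval n) (C n) ρ

/-! ## The generalized Hilbert–Schmidt ensemble -/

/-- The Hilbert space of `n + m` qubits, split into the first `n` and the last `m`. -/
abbrev PureSpace (n m : ℕ) : Type := EuclideanSpace ℂ ((Fin n → Bool) × (Fin m → Bool))

/-- The Haar measure on pure states: the uniform probability measure on the unit sphere. -/
def haarState (n m : ℕ) : Measure (Metric.sphere (0 : PureSpace n m) 1) :=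
  ((volume : Measure (PureSpace n m)).toSphere Set.univ)⁻¹ •
    (volume : Measure (PureSpace n m)).toSphere

/-- `tr_m(|ψ⟩⟨ψ|)`, the state of the first `n` qubits. -/
def reducedState (n m : ℕ) (ψ : PureSpace n m) : QOp n :=
  Matrix.of fun x y => ∑ z : Fin m → Bool, ψ (x, z) * star (ψ (y, z))

/-- Operators carry the Borel σ-algebra. -/
instance (N : ℕ) : MeasurableSpace (QOp N) := borel _

instance (N : ℕ) : BorelSpace (QOp N) := ⟨rfl⟩

/-- The `(n, m)` generalized Hilbert–Schmidt ensemble, as a measure on `n`-qubit operators: the law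
of the state of the first `n` qubits of an `(n + m)`-qubit Haar random state. -/
def ghse (n m : ℕ) : Measure (QOp n) :=
  (haarState n m).map fun ψ : Metric.sphere (0 : PureSpace n m) 1 => reducedState n m ψ

/-! ## Pseudorandom density matrices -/

/-- Negligible functions. -/
def Negligible (f : ℕ → ℝ) : Prop :=
  ∀ c : ℕ, ∃ n₀ : ℕ, ∀ n > n₀, f n < ((n : ℝ) ^ c)⁻¹

/-- A keyed family of `n`-qubit operators with keys in `{0,1}^{κ(n)}`. -/
abbrev KeyedFamily (κ : ℕ → ℕ) : Type := (n : ℕ) → (Fin (κ n) → Bool) → QOp n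

/-- The public parameters `1ⁿ`, `1^{κ(n)}` and `m(n)` (in binary). -/
def publicParams (κ m : ℕ → ℕ) (n : ℕ) : List (List Bool) :=
  [unary n, unary (κ n), Nat.bits (m n)]

/-- The family is prepared by a quantum polynomial-time algorithm that is given the public
parameters and the key. -/
def EfficientlyPreparable {ι : Type} (𝒢 : ι → Matrix.unitaryGroup Bool ℂ) (κ m : ℕ → ℕ)
    (ρ : KeyedFamily κ) : Prop :=
  ∃ (a : Polynomial ℕ) (C : (Σ n : ℕ, Fin (κ n) → Bool) → List (Gate ι ℕ)),
    UniformCircuits (fun x => x.1) (fun x => publicParams κ m x.1 ++ [List.ofFn x.2])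
      (fun x => x.1 + a.eval x.1) C ∧
    ∀ n k, ρ n k = circuitChannel 𝒢 n (a.eval n) (C ⟨n, k⟩) (zeroState n)

/-- The distinguishing advantage of the circuit `C` with `a` ancilla qubits, given `t` copies,
between `ρ_k` with a uniformly random key `k` and the `(n, m)` generalized Hilbert–Schmidt
ensemble. -/
def advantage {ι : Type} (𝒢 : ι → Matrix.unitaryGroup Bool ℂ) {κ : ℕ} (n m t a : ℕ)
    (C : List (Gate ι ℕ)) (ρ : (Fin κ → Bool) → QOp n) : ℝ :=
  |(∑ k : Fin κ → Bool, acceptProb 𝒢 (t * n) a C (copies n t (ρ k))) / 2 ^ κ -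
    ∫ σ, acceptProb 𝒢 (t * n) a C (copies n t σ) ∂(ghse n m)|

/-- For every polynomial `t`, every quantum polynomial-time adversary, given the public parameters,
`1^{t(n)}` and `t(n)` copies of the state, has negligible advantage. -/
def ComputationallyIndistinguishable {ι : Type} (𝒢 : ι → Matrix.unitaryGroup Bool ℂ)
    (κ m : ℕ → ℕ) (ρ : KeyedFamily κ) : Prop :=
  ∀ (t a : Polynomial ℕ) (C : ℕ → List (Gate ι ℕ)),
    UniformCircuits (fun n => n) (fun n => publicParams κ m n ++ [unary (t.eval n)])
      (fun n => t.eval n * n + a.eval n) C →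
    Negligible fun n => advantage 𝒢 n (m n) (t.eval n) (a.eval n) (C n) (ρ n)

/-- Pseudorandom density matrices with security parameter `κ` and mixedness parameter `m`. -/
structure IsPRDM {ι : Type} (𝒢 : ι → Matrix.unitaryGroup Bool ℂ) (κ m : ℕ → ℕ)
    (ρ : KeyedFamily κ) : Prop where
  poly_key : ∃ p : Polynomial ℕ, ∀ n, κ n ≤ p.eval n
  preparable : EfficientlyPreparable 𝒢 κ m ρ
  indistinguishable : ComputationallyIndistinguishable 𝒢 κ m ρ

/-- The PRDM `ρ` is noise robust to `Γ` if it remains a PRDM after application of `Γ`. -/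
def NoiseRobust {ι : Type} (𝒢 : ι → Matrix.unitaryGroup Bool ℂ) (κ m : ℕ → ℕ)
    (ρ : KeyedFamily κ) (Γ : (n : ℕ) → QOp n → QOp n) : Prop :=
  IsPRDM 𝒢 κ m ρ → IsPRDM 𝒢 κ m fun n k => Γ n (ρ n k)

end

noncomputable section

/-!
Suppose `m = ω(log n)`, and write a Haar vector on `n + m` qubits as components `ψ_w ∈ ℂ^(2^n)`,
`w ∈ {0,1}^m`. Then `ρ^⊗t` is the sum over `z : Fin t → {0,1}^m` of the rank one operators of the
vectors `ψ_{z 0} ⊗ ⋯ ⊗ ψ_{z (t-1)}`. For injective `z`, sign flips and permutations of the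
coordinates of each component separately show that the mean of this term is a multiple of the
identity; by a second moment bound the other `z` carry mean weight at most `2 t² / 2^m`. So `t`
copies of a state from `η_{n,m}` are negligibly far from `t` copies of the maximally mixed state,
which a unital `Γ` fixes. Since applying `Γ` to every copy and then running a distinguisher is
itself an efficient distinguisher, `Γ(ρ_k)` cannot be told from `Γ(η)`, and both `Γ(η)` and `η` are
close to maximally mixed.

Conversely, complete dephasing is unital and efficient: copy each qubit to an ancilla by a CNOT and
discard the ancilla. It lowers the mean purity of `η_{n,m}` by `(2^n - 1) / (2^(n+m) + 1)`, which
the swap test on two copies detects with advantage at least `1 / (8 * 2^m)`. Robustness to dephasing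
therefore makes `1 / 2^m` negligible, which is `log n = o(m)`.
-/

/-! ## Operators on part of a register -/

section LiftOp
open Matrix Function

/-- Operators on a register of qubits named by `Q`; for `Q = Fin N` these are `QOp N`. -/
abbrev RegOp (Q : Type*) : Type _ := Matrix (Q → Bool) (Q → Bool) ℂ

open Classical in
/-- The operator on the register `W` that acts as `M` on the qubits in the image of `f` and as the
identity on all others. -/
def liftOp {Q W : Type*} (f : Q → W) (M : RegOp Q) : RegOp W :=
  Matrix.of fun x y => if ∀ w, w ∉ Set.range f → x w = y w then M (x ∘ f) (y ∘ f) else 0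

section Extend
variable {Q W α : Type*} {f : Q → W}

theorem extend_comp_self_of_eqOn_compl (hf : Injective f) {x y : W → α}
    (h : ∀ w, w ∉ Set.range f → x w = y w) : extend f (y ∘ f) x = y := by
  funext w
  by_cases hw : ∃ q, f q = w
  · obtain ⟨q, rfl⟩ := hw
    exact hf.extend_apply _ _ q
  · rw [extend_apply' _ _ _ hw, h w hw]

theorem extend_update_comp [DecidableEq Q] [DecidableEq W] (hf : Injective f) (x : W → α) (q : Q)
    (a : α) : extend f (update (x ∘ f) q a) x = update x (f q) a := by
  rw [← update_comp_eq_of_injective x hf q a]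
  exact extend_comp_self_of_eqOn_compl hf fun w hw => by
    rw [update_of_ne (fun h => hw ⟨q, h.symm⟩)]

theorem extend_extend (hf : Injective f) (x : W → α) (z z' : Q → α) :
    extend f z' (extend f z x) = extend f z' x := by
  funext w
  by_cases hw : ∃ q, f q = w
  · obtain ⟨q, rfl⟩ := hw
    rw [hf.extend_apply, hf.extend_apply]
  · simp only [extend_apply' _ _ _ hw]

end Extend

variable {Q W : Type*} [Fintype Q] [Fintype W] {f : Q → W}

theorem liftOp_mulVec [DecidableEq Q] [DecidableEq W] (hf : Injective f) (M : RegOp Q)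
    (v : (W → Bool) → ℂ) (x : W → Bool) :
    (liftOp f M *ᵥ v) x = (M *ᵥ fun z => v (extend f z x)) (x ∘ f) := by
  refine (Fintype.sum_of_injective (fun z => extend f z x) (extend_injective hf x) _ _
    (fun y hy => ?_) fun z => ?_).symm
  · suffices ¬ ∀ w, w ∉ Set.range f → x w = y w by
      simp only [liftOp, Matrix.of_apply, if_neg this, zero_mul]
    exact fun h => hy ⟨y ∘ f, extend_comp_self_of_eqOn_compl hf h⟩
  · have agree : ∀ w, w ∉ Set.range f → x w = extend f z x w :=
      fun w hw => (extend_apply' z x w hw).symm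
    simp only [liftOp, Matrix.of_apply, if_pos agree, extend_comp hf]

theorem liftOp_mul [DecidableEq Q] [DecidableEq W] (hf : Injective f) (M N : RegOp Q) :
    liftOp f (M * N) = liftOp f M * liftOp f N :=
  mulVec_injective <| funext fun v => funext fun x => by
    simp only [← mulVec_mulVec, liftOp_mulVec hf, extend_extend hf, extend_comp hf]

theorem liftOp_one (hf : Injective f) : liftOp f (1 : RegOp Q) = 1 := by
  classical
  refine mulVec_injective <| funext fun v => funext fun x => ?_
  rw [liftOp_mulVec hf, one_mulVec, one_mulVec, extend_comp_self_of_eqOn_compl hf fun _ _ => rfl]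

end LiftOp

/-! ## Gates and circuits acting on vectors -/

section Action
open Matrix Function

variable {N : ℕ}

theorem onQubit_mulVec (q : Fin N) (u : Matrix Bool Bool ℂ) (v : (Fin N → Bool) → ℂ)
    (x : Fin N → Bool) :
    (onQubit N q u *ᵥ v) x = ∑ b, u (x q) b * v (update x q b) := by
  rw [onQubit, dif_pos q.2]
  refine (Fintype.sum_of_injective (fun b => update x q b) (update_injective x q) _ _
    (fun y hy => ?_) fun b => ?_).symm
  · suffices ¬ ∀ j, j ≠ q → x j = y j by simp only [Matrix.of_apply, if_neg this, zero_mul]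
    refine fun h => hy ⟨y q, funext fun j => ?_⟩
    obtain rfl | hj := eq_or_ne j q
    · exact update_self ..
    · exact (update_of_ne hj ..).trans (h j hj)
  · have agree : ∀ j, j ≠ q → x j = update x q b j := fun j hj => (update_of_ne hj b x).symm
    simp only [Matrix.of_apply, if_pos agree, update_self]

theorem onQubit_mul (q : Fin N) (u w : Matrix Bool Bool ℂ) :
    onQubit N q (u * w) = onQubit N q u * onQubit N q w :=
  mulVec_injective <| funext fun v => funext fun x => by
    simp only [← mulVec_mulVec, onQubit_mulVec, update_self, update_idem, Matrix.mul_apply,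
      Finset.mul_sum, Finset.sum_mul, mul_assoc]
    exact Finset.sum_comm

theorem onQubit_one (q : Fin N) : onQubit N q 1 = 1 :=
  mulVec_injective <| funext fun v => funext fun x => by
    simp only [onQubit_mulVec, Matrix.one_apply, ite_mul, one_mul, zero_mul, Finset.sum_ite_eq,
      Finset.mem_univ, if_true, update_eq_self, one_mulVec]

theorem onQubit_star (q : Fin N) (u : Matrix Bool Bool ℂ) :
    onQubit N q (star u) = star (onQubit N q u) := by
  ext x y
  simp only [onQubit, dif_pos q.2, Matrix.of_apply, Matrix.star_apply, eq_comm, apply_ite star,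
    star_zero]

/-- The action of a controlled NOT on the basis states of a register. -/
def cnotPerm {W : Type*} [DecidableEq W] {c t : W} (h : c ≠ t) : Equiv.Perm (W → Bool) :=
  Involutive.toPerm (fun x => update x t (x t ^^ x c)) fun x => by
    simp only [update_self, update_of_ne h, update_idem, Bool.xor_assoc, Bool.xor_self,
      Bool.xor_false, update_eq_self]

theorem cnotPerm_symm {W : Type*} [DecidableEq W] {c t : W} (h : c ≠ t) :
    (cnotPerm h).symm = cnotPerm h := Involutive.toPerm_symm _

theorem cnotMatrix_eq_permMatrix {c t : Fin N} (h : c ≠ t) :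
    cnotMatrix N c t = (cnotPerm h).permMatrix ℂ := by
  ext x y
  have iff : x = cnotPerm h y ↔ cnotPerm h x = y := by
    rw [← Equiv.symm_apply_eq, cnotPerm_symm]
  rw [cnotMatrix, dif_pos ⟨c.2, t.2, Fin.val_ne_of_ne h⟩, Equiv.Perm.permMatrix,
    PEquiv.toMatrix_apply, Equiv.toPEquiv_apply]
  simp only [Option.mem_some_iff]
  exact if_congr iff rfl rfl

theorem cnotMatrix_mulVec {c t : Fin N} (h : c ≠ t) (v : (Fin N → Bool) → ℂ)
    (x : Fin N → Bool) :
    (cnotMatrix N c t *ᵥ v) x = v (update x t (x t ^^ x c)) := by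
  rw [cnotMatrix_eq_permMatrix h, permMatrix_mulVec]
  rfl

variable {ι : Type} (𝒢 : ι → Matrix.unitaryGroup Bool ℂ)

theorem circuitMatrix_nil_mulVec (v : (Fin N → Bool) → ℂ) : circuitMatrix 𝒢 N [] *ᵥ v = v :=
  one_mulVec v

theorem circuitMatrix_cons_mulVec (g : Gate ι ℕ) (C : List (Gate ι ℕ)) (v : (Fin N → Bool) → ℂ) :
    circuitMatrix 𝒢 N (g :: C) *ᵥ v = circuitMatrix 𝒢 N C *ᵥ (g.toMatrix 𝒢 N *ᵥ v) :=
  (mulVec_mulVec v _ _).symm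

theorem circuitMatrix_append (N : ℕ) (C D : List (Gate ι ℕ)) :
    circuitMatrix 𝒢 N (C ++ D) = circuitMatrix 𝒢 N D * circuitMatrix 𝒢 N C := by
  induction C with
  | nil => simp [circuitMatrix]
  | cons g C ih => simp only [List.cons_append, circuitMatrix, ih, mul_assoc]

theorem circuitMatrix_append_mulVec (C D : List (Gate ι ℕ)) (v : (Fin N → Bool) → ℂ) :
    circuitMatrix 𝒢 N (C ++ D) *ᵥ v = circuitMatrix 𝒢 N D *ᵥ (circuitMatrix 𝒢 N C *ᵥ v) := by
  rw [circuitMatrix_append, mulVec_mulVec]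

end Action

/-! ## Unitarity -/

section Unitarity
variable {ι : Type} (𝒢 : ι → Matrix.unitaryGroup Bool ℂ)

theorem hadamardMatrix_mem_unitaryGroup : hadamardMatrix ∈ Matrix.unitaryGroup Bool ℂ := by
  have sq : (Real.sqrt 2 : ℂ) * Real.sqrt 2 = 2 := by
    rw [← Complex.ofReal_mul, Real.mul_self_sqrt zero_le_two, Complex.ofReal_ofNat]
  have half : (Real.sqrt 2 : ℂ)⁻¹ * (Real.sqrt 2 : ℂ)⁻¹ = 1 / 2 := by
    rw [← mul_inv, sq, one_div]
  rw [Matrix.mem_unitaryGroup_iff']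
  ext a b
  simp only [Matrix.mul_apply, Matrix.star_apply, hadamardMatrix, Matrix.of_apply,
    Fintype.sum_bool, Matrix.one_apply]
  cases a <;> cases b <;> simp [div_eq_mul_inv, half] <;> norm_num

theorem tMatrix_mem_unitaryGroup : tMatrix ∈ Matrix.unitaryGroup Bool ℂ := by
  rw [Matrix.mem_unitaryGroup_iff', tMatrix, Matrix.star_eq_conjTranspose,
    Matrix.diagonal_conjTranspose, Matrix.diagonal_mul_diagonal, Matrix.diagonal_eq_one]
  funext b
  cases b
  · simp
  · simp [← Complex.exp_conj, ← Complex.exp_add, map_ofNat]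

theorem onQubit_mem_unitaryGroup (N q : ℕ) {u : Matrix Bool Bool ℂ}
    (hu : u ∈ Matrix.unitaryGroup Bool ℂ) : onQubit N q u ∈ Matrix.unitaryGroup _ ℂ := by
  by_cases hq : q < N
  · have mul := onQubit_mul ⟨q, hq⟩ (star u) u
    rw [Matrix.mem_unitaryGroup_iff'.1 hu, onQubit_one, onQubit_star] at mul
    exact Matrix.mem_unitaryGroup_iff'.2 mul.symm
  · rw [onQubit, dif_neg hq]
    exact one_mem _

theorem cnotMatrix_mem_unitaryGroup (N c t : ℕ) :
    cnotMatrix N c t ∈ Matrix.unitaryGroup (Fin N → Bool) ℂ := by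
  by_cases h : c < N ∧ t < N ∧ c ≠ t
  · obtain ⟨hc, ht, hct⟩ := h
    have hct' : (⟨c, hc⟩ : Fin N) ≠ ⟨t, ht⟩ := fun e => hct (Fin.mk.inj e)
    rw [Matrix.mem_unitaryGroup_iff', cnotMatrix_eq_permMatrix hct', Matrix.star_eq_conjTranspose,
      Matrix.conjTranspose_permMatrix, ← Matrix.permMatrix_mul, mul_inv_cancel,
      Matrix.permMatrix_one]
  · rw [cnotMatrix, dif_neg h]
    exact one_mem _

theorem Gate.toMatrix_mem_unitaryGroup (N : ℕ) (g : Gate ι ℕ) :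
    g.toMatrix 𝒢 N ∈ Matrix.unitaryGroup (Fin N → Bool) ℂ := by
  cases g with
  | hadamard q => exact onQubit_mem_unitaryGroup N q hadamardMatrix_mem_unitaryGroup
  | tgate q => exact onQubit_mem_unitaryGroup N q tMatrix_mem_unitaryGroup
  | cnot c t => exact cnotMatrix_mem_unitaryGroup N c t
  | extra i q => exact onQubit_mem_unitaryGroup N q (𝒢 i).2

theorem circuitMatrix_mem_unitaryGroup (N : ℕ) (C : List (Gate ι ℕ)) :
    circuitMatrix 𝒢 N C ∈ Matrix.unitaryGroup (Fin N → Bool) ℂ := by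
  induction C with
  | nil => exact one_mem _
  | cons g C ih => exact mul_mem ih (g.toMatrix_mem_unitaryGroup 𝒢 N)

end Unitarity

/-! ## Renaming of qubits -/

section Renaming
open Matrix Function

/-- The renaming `φ` of qubit numbers sends the first `N` qubits injectively to qubits below `N'`,
by the map `f`. -/
structure Renames (φ : ℕ → ℕ) {N N' : ℕ} (f : Fin N → Fin N') : Prop where
  injective : f.Injective
  val_eq : ∀ i, (f i : ℕ) = φ i

variable {φ : ℕ → ℕ} {N N' : ℕ} {f : Fin N → Fin N'}

theorem Renames.lt (h : Renames φ f) {q : ℕ} (hq : q < N) : φ q < N' :=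
  h.val_eq ⟨q, hq⟩ ▸ (f ⟨q, hq⟩).2

theorem Renames.ne (h : Renames φ f) {c t : ℕ} (hc : c < N) (ht : t < N) (hct : c ≠ t) :
    φ c ≠ φ t := by
  rw [← h.val_eq ⟨c, hc⟩, ← h.val_eq ⟨t, ht⟩]
  exact Fin.val_ne_of_ne (h.injective.ne (Fin.ne_of_val_ne hct))

theorem renames_castLE (h : N ≤ N') : Renames id (Fin.castLE h) :=
  ⟨Fin.castLE_injective h, fun _ => rfl⟩

theorem Renames.onQubit (h : Renames φ f) {q : ℕ} (hq : q < N) (u : Matrix Bool Bool ℂ) :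
    onQubit N' (φ q) u = liftOp f (onQubit N q u) := by
  rw [← h.val_eq ⟨q, hq⟩]
  refine mulVec_injective <| funext fun v => funext fun x => ?_
  rw [liftOp_mulVec h.injective, onQubit_mulVec, onQubit_mulVec ⟨q, hq⟩]
  simp only [extend_update_comp h.injective]
  rfl

theorem Renames.cnotMatrix (h : Renames φ f) {c t : ℕ} (hc : c < N) (ht : t < N) (hct : c ≠ t) :
    cnotMatrix N' (φ c) (φ t) = liftOp f (cnotMatrix N c t) := by
  have hct' : (⟨c, hc⟩ : Fin N) ≠ ⟨t, ht⟩ := Fin.ne_of_val_ne hct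
  rw [← h.val_eq ⟨c, hc⟩, ← h.val_eq ⟨t, ht⟩]
  refine mulVec_injective <| funext fun v => funext fun x => ?_
  rw [liftOp_mulVec h.injective, cnotMatrix_mulVec (h.injective.ne hct'), cnotMatrix_mulVec hct',
    extend_update_comp h.injective]
  rfl

section
variable {ι : Type} (𝒢 : ι → Matrix.unitaryGroup Bool ℂ)

theorem Renames.toMatrix (h : Renames φ f) {g : Gate ι ℕ} (hg : g.Valid N) :
    (g.map φ).toMatrix 𝒢 N' = liftOp f (g.toMatrix 𝒢 N) := by
  cases g with
  | hadamard q => exact h.onQubit hg _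
  | tgate q => exact h.onQubit hg _
  | cnot c t => exact h.cnotMatrix hg.1 hg.2.1 hg.2.2
  | extra i q => exact h.onQubit hg _

theorem Renames.circuitMatrix (h : Renames φ f) {C : List (Gate ι ℕ)} (hC : ∀ g ∈ C, g.Valid N) :
    circuitMatrix 𝒢 N' (C.map (Gate.map φ)) = liftOp f (circuitMatrix 𝒢 N C) := by
  induction C with
  | nil => exact (liftOp_one h.injective).symm
  | cons g C ih =>
    obtain ⟨hg, hC⟩ := List.forall_mem_cons.1 hC
    rw [List.map_cons, _root_.circuitMatrix, _root_.circuitMatrix, ih hC, h.toMatrix 𝒢 hg,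
      liftOp_mul h.injective]

end

variable {ι : Type}

theorem Gate.map_id (g : Gate ι ℕ) : g.map id = g := by cases g <;> rfl

theorem Gate.map_map {Q Q' Q'' : Type} (φ : Q → Q') (ψ : Q' → Q'') (g : Gate ι Q) :
    (g.map φ).map ψ = g.map (ψ ∘ φ) := by cases g <;> rfl

theorem Gate.Valid.map (h : Renames φ f) {g : Gate ι ℕ} (hg : g.Valid N) :
    (g.map φ).Valid N' := by
  cases g with
  | hadamard q => exact h.lt hg
  | tgate q => exact h.lt hg
  | cnot c t => exact ⟨h.lt hg.1, h.lt hg.2.1, h.ne hg.1 hg.2.1 hg.2.2⟩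
  | extra i q => exact h.lt hg

theorem Gate.Valid.mono (h : N ≤ N') {g : Gate ι ℕ} (hg : g.Valid N) : g.Valid N' :=
  g.map_id ▸ hg.map (renames_castLE h)

theorem circuitMatrix_castLE (𝒢 : ι → Matrix.unitaryGroup Bool ℂ) (h : N ≤ N')
    {C : List (Gate ι ℕ)} (hC : ∀ g ∈ C, g.Valid N) :
    circuitMatrix 𝒢 N' C = liftOp (Fin.castLE h) (circuitMatrix 𝒢 N C) := by
  rw [← (renames_castLE h).circuitMatrix 𝒢 hC, funext Gate.map_id, List.map_id']

end Renaming

/-! ## Kraus operators of a circuit -/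

section Kraus
open Matrix

theorem sum_fin_append {R α : Type*} [AddCommMonoid R] [Fintype α] {n a : ℕ}
    (F : (Fin (n + a) → α) → R) :
    ∑ x, F x = ∑ x : Fin n → α, ∑ z : Fin a → α, F (Fin.append x z) := by
  rw [← Fintype.sum_prod_type']
  exact (Fintype.sum_equiv (Fin.appendEquiv n a) _ _ fun _ => rfl).symm

theorem exists_eq_fin_append {α : Type*} {n a : ℕ} (x : Fin (n + a) → α) :
    ∃ (y : Fin n → α) (z : Fin a → α), x = Fin.append y z :=
  ⟨_, _, (Fin.append_castAdd_natAdd (f := x)).symm⟩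

theorem fin_append_inj {α : Type*} {n a : ℕ} {x x' : Fin n → α} {z z' : Fin a → α} :
    Fin.append x z = Fin.append x' z' ↔ x = x' ∧ z = z' :=
  (Fin.appendEquiv n a).injective.eq_iff (a := (x, z)) (b := (x', z')) |>.trans Prod.mk_inj

/-- The vector `v ⊗ |0…0⟩`, with `a` fresh ancilla qubits after the qubits of `v`. -/
def withAncillas {n : ℕ} (a : ℕ) (v : (Fin n → Bool) → ℂ) : (Fin (n + a) → Bool) → ℂ := fun x =>
  if ∀ j : Fin a, x (Fin.natAdd n j) = false then v fun i => x (Fin.castAdd a i) else 0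

theorem withAncillas_append {n a : ℕ} (v : (Fin n → Bool) → ℂ) (x : Fin n → Bool)
    (z : Fin a → Bool) :
    withAncillas a v (Fin.append x z) = if ∀ j, z j = false then v x else 0 := by
  simp only [withAncillas, Fin.append_left, Fin.append_right]

variable {ι : Type} (𝒢 : ι → Matrix.unitaryGroup Bool ℂ)

/-- The Kraus operator `⟨z| U |0…0⟩` of a circuit with unitary `U` that belongs to the final
value `z` of the ancillas. -/
def krausOp (n a : ℕ) (C : List (Gate ι ℕ)) (z : Fin a → Bool) : QOp n :=
  Matrix.of fun x y => circuitMatrix 𝒢 (n + a) C (Fin.append x z) (Fin.append y fun _ => false)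

theorem krausOp_mulVec {n a : ℕ} (C : List (Gate ι ℕ)) (z : Fin a → Bool)
    (v : (Fin n → Bool) → ℂ) (x : Fin n → Bool) :
    (krausOp 𝒢 n a C z *ᵥ v) x =
      (circuitMatrix 𝒢 (n + a) C *ᵥ withAncillas a v) (Fin.append x z) := by
  simp only [mulVec, dotProduct, sum_fin_append, withAncillas_append, ← funext_iff,
    mul_ite, mul_zero, Finset.sum_ite_eq', Finset.mem_univ, if_true]
  rfl

theorem addAncillas_append {n a : ℕ} (ρ : QOp n) (x y : Fin n → Bool) (z w : Fin a → Bool) :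
    addAncillas n a ρ (Fin.append x z) (Fin.append y w) =
      if w = (fun _ => false) then (if z = (fun _ => false) then ρ x y else 0) else 0 := by
  simp only [addAncillas, zeroState, Matrix.of_apply, Fin.append_left, Fin.append_right,
    funext_iff]
  split_ifs <;> simp_all

theorem runCircuit_append {n a : ℕ} (C : List (Gate ι ℕ)) (ρ : QOp n) (x y : Fin n → Bool)
    (z w : Fin a → Bool) :
    runCircuit 𝒢 n a C ρ (Fin.append x z) (Fin.append y w) =
      (krausOp 𝒢 n a C z * ρ * (krausOp 𝒢 n a C w)ᴴ) x y := by
  simp only [runCircuit, Matrix.mul_apply, sum_fin_append, addAncillas_append, mul_ite,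
    mul_zero, Matrix.conjTranspose_apply, krausOp, Matrix.of_apply, Finset.sum_ite_irrel,
    Finset.sum_const_zero, Finset.sum_ite_eq', Finset.mem_univ, if_true, ite_mul, zero_mul]

theorem circuitChannel_eq_sum {n a : ℕ} (C : List (Gate ι ℕ)) (ρ : QOp n) :
    circuitChannel 𝒢 n a C ρ = ∑ z, krausOp 𝒢 n a C z * ρ * (krausOp 𝒢 n a C z)ᴴ := by
  ext x y
  simp only [circuitChannel, traceOutLast, Matrix.of_apply, runCircuit_append, Matrix.sum_apply]

theorem sum_krausOp_conjTranspose_mul_self (n a : ℕ) (C : List (Gate ι ℕ)) :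
    ∑ z, (krausOp 𝒢 n a C z)ᴴ * krausOp 𝒢 n a C z = 1 := by
  ext x y
  have unitary := congrFun₂ (Matrix.mem_unitaryGroup_iff'.1
    (circuitMatrix_mem_unitaryGroup 𝒢 (n + a) C)) (Fin.append x fun _ => false)
    (Fin.append y fun _ => false)
  rw [Matrix.mul_apply, sum_fin_append, Finset.sum_comm] at unitary
  simp only [Matrix.sum_apply, Matrix.mul_apply, Matrix.conjTranspose_apply, krausOp,
    Matrix.of_apply]
  refine unitary.trans ?_
  simp only [Matrix.one_apply, fin_append_inj, and_true]

theorem circuitChannel_smul (n a : ℕ) (C : List (Gate ι ℕ)) (c : ℂ) (ρ : QOp n) :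
    circuitChannel 𝒢 n a C (c • ρ) = c • circuitChannel 𝒢 n a C ρ := by
  simp only [circuitChannel_eq_sum, Matrix.mul_smul, Matrix.smul_mul, Finset.smul_sum]

theorem isQuantumChannel_circuitChannel (n a : ℕ) (C : List (Gate ι ℕ)) :
    IsQuantumChannel n (circuitChannel 𝒢 n a C) := by
  let e := Fintype.equivFin (Fin a → Bool)
  refine ⟨_, fun j => krausOp 𝒢 n a C (e.symm j), ?_, fun ρ => ?_⟩
  · rw [← sum_krausOp_conjTranspose_mul_self 𝒢 n a C]
    exact Fintype.sum_equiv e.symm _ _ fun _ => rfl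
  · rw [circuitChannel_eq_sum]
    exact (Fintype.sum_equiv e.symm _ _ fun _ => rfl).symm

end Kraus

/-! ## The effect measured by a circuit -/

section Effect
open Matrix

variable {ι : Type} (𝒢 : ι → Matrix.unitaryGroup Bool ℂ)

/-- In the basis state `(x, z)` qubit number `0` is `1`. -/
def outputBit {n a : ℕ} (x : Fin n → Bool) (z : Fin a → Bool) : Prop :=
  ∃ i : Fin (n + a), (i : ℕ) = 0 ∧ Fin.append x z i = true

open Classical in
theorem acceptProb_eq_sum {n a : ℕ} (C : List (Gate ι ℕ)) (ρ : QOp n) :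
    acceptProb 𝒢 n a C ρ = ∑ x, ∑ z : Fin a → Bool, if outputBit x z then
      ((krausOp 𝒢 n a C z * ρ * (krausOp 𝒢 n a C z)ᴴ) x x).re else 0 := by
  simp only [acceptProb, sum_fin_append, runCircuit_append]
  exact Finset.sum_congr rfl fun x _ => Finset.sum_congr rfl fun z _ => if_congr Iff.rfl rfl rfl

open Classical in
/-- The effect of output `1` of a circuit: the positive operator `E` with
`acceptProb ρ = tr (E ρ)`. -/
def acceptEffect (n a : ℕ) (C : List (Gate ι ℕ)) : QOp n :=
  ∑ z, (krausOp 𝒢 n a C z)ᴴ * Matrix.diagonal (fun x => if outputBit x z then 1 else 0) *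
    krausOp 𝒢 n a C z

open scoped ComplexOrder in
theorem acceptEffect_posSemidef (n a : ℕ) (C : List (Gate ι ℕ)) :
    (acceptEffect 𝒢 n a C).PosSemidef := by
  classical
  refine Matrix.posSemidef_sum _ fun z _ => Matrix.PosSemidef.conjTranspose_mul_mul_same
    (Matrix.PosSemidef.diagonal fun x => ?_) _
  dsimp only [Pi.zero_apply]
  split_ifs
  exacts [zero_le_one, le_rfl]

open scoped ComplexOrder in
theorem one_sub_acceptEffect_posSemidef (n a : ℕ) (C : List (Gate ι ℕ)) :
    (1 - acceptEffect 𝒢 n a C).PosSemidef := by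
  classical
  rw [← sum_krausOp_conjTranspose_mul_self 𝒢 n a C, acceptEffect, ← Finset.sum_sub_distrib]
  refine Matrix.posSemidef_sum _ fun z _ => ?_
  nth_rewrite 1 [← Matrix.mul_one (krausOp 𝒢 n a C z)ᴴ]
  rw [← Matrix.sub_mul, ← Matrix.mul_sub, ← Matrix.diagonal_one, Matrix.diagonal_sub]
  refine Matrix.PosSemidef.conjTranspose_mul_mul_same (Matrix.PosSemidef.diagonal fun x => ?_) _
  dsimp only [Pi.zero_apply]
  split_ifs
  exacts [(sub_self (1 : ℂ)).ge, (sub_zero (1 : ℂ)).symm ▸ zero_le_one]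

theorem acceptProb_eq_trace {n a : ℕ} (C : List (Gate ι ℕ)) (ρ : QOp n) :
    acceptProb 𝒢 n a C ρ = (acceptEffect 𝒢 n a C * ρ).trace.re := by
  classical
  rw [acceptProb_eq_sum, acceptEffect, Finset.sum_mul, Matrix.trace_sum, Complex.re_sum,
    Finset.sum_comm]
  refine Finset.sum_congr rfl fun z _ => ?_
  have cyclic : ∀ K D : QOp n, (Kᴴ * D * K * ρ).trace = (D * (K * ρ * Kᴴ)).trace := fun K D => by
    rw [mul_assoc, mul_assoc, Matrix.trace_mul_comm]
    simp only [mul_assoc]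
  rw [cyclic, Matrix.trace, Complex.re_sum]
  refine Finset.sum_congr rfl fun x _ => ?_
  rw [Matrix.diag, Matrix.diagonal_mul, ite_mul, one_mul, zero_mul, apply_ite Complex.re,
    Complex.zero_re]

end Effect

/-! ## Sequential composition -/

section Composition
open Matrix Function

/-- Move the ancillas of a circuit on `d` qubits behind `a` further ancillas. -/
def shiftAncillas (d a h : ℕ) : ℕ := if h < d then h else h + a

/-- The renaming `shiftAncillas` as a map of registers. -/
def shiftAncillasFin (d a b : ℕ) : Fin (d + b) → Fin (d + (a + b)) :=
  Fin.append (Fin.castAdd (a + b)) fun j => Fin.natAdd d (Fin.natAdd a j)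

theorem shiftAncillasFin_val (d a b : ℕ) (i : Fin (d + b)) :
    (shiftAncillasFin d a b i : ℕ) = shiftAncillas d a i := by
  refine Fin.addCases (fun i => ?_) (fun j => ?_) i
  · rw [shiftAncillasFin, Fin.append_left, shiftAncillas, if_pos (Fin.castAdd_lt b i)]
    rfl
  · rw [shiftAncillasFin, Fin.append_right, shiftAncillas,
      if_neg (Nat.not_lt.2 (Fin.le_coe_natAdd d j))]
    simp only [Fin.val_natAdd]
    omega

theorem renames_shiftAncillas (d a b : ℕ) :
    Renames (shiftAncillas d a) (shiftAncillasFin d a b) := by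
  refine ⟨fun i j h => Fin.ext ?_, shiftAncillasFin_val d a b⟩
  have eq := congrArg Fin.val h
  rw [shiftAncillasFin_val, shiftAncillasFin_val, shiftAncillas, shiftAncillas] at eq
  split_ifs at eq <;> omega

variable {α : Type*} {d a b : ℕ}

theorem append_append_comp_castLE (h : d + a ≤ d + (a + b)) (x : Fin d → α)
    (w : Fin a → α) (z : Fin b → α) :
    Fin.append x (Fin.append w z) ∘ Fin.castLE h = Fin.append x w := by
  funext i
  refine Fin.addCases (fun i => ?_) (fun j => ?_) i
  · have : Fin.castLE h (Fin.castAdd a i) = Fin.castAdd (a + b) i := rfl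
    simp only [Function.comp_apply, this, Fin.append_left]
  · have : Fin.castLE h (Fin.natAdd d j) = Fin.natAdd d (Fin.castAdd b j) := rfl
    simp only [Function.comp_apply, this, Fin.append_right, Fin.append_left]

theorem extend_castLE_append (h : d + a ≤ d + (a + b)) (x x' : Fin d → α) (w w' : Fin a → α)
    (z : Fin b → α) :
    extend (Fin.castLE h) (Fin.append x' w') (Fin.append x (Fin.append w z)) =
      Fin.append x' (Fin.append w' z) := by
  rw [← append_append_comp_castLE h x' w' z]
  refine extend_comp_self_of_eqOn_compl (Fin.castLE_injective h) fun i => ?_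
  refine Fin.addCases (fun i hi => ?_) (fun i => Fin.addCases (fun i hi => ?_) (fun i _ => ?_) i) i
  · exact absurd ⟨Fin.castAdd a i, rfl⟩ hi
  · exact absurd ⟨Fin.natAdd d i, rfl⟩ hi
  · simp only [Fin.append_right]

theorem append_append_comp_shiftAncillasFin (x : Fin d → α) (w : Fin a → α) (z : Fin b → α) :
    Fin.append x (Fin.append w z) ∘ shiftAncillasFin d a b = Fin.append x z := by
  funext i
  refine Fin.addCases (fun i => ?_) (fun j => ?_) i
  · simp only [Function.comp_apply, shiftAncillasFin, Fin.append_left]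
  · simp only [Function.comp_apply, shiftAncillasFin, Fin.append_right]

theorem extend_shiftAncillasFin_append (x x' : Fin d → α) (w : Fin a → α) (z z' : Fin b → α) :
    extend (shiftAncillasFin d a b) (Fin.append x' z') (Fin.append x (Fin.append w z)) =
      Fin.append x' (Fin.append w z') := by
  rw [← append_append_comp_shiftAncillasFin x' w z']
  refine extend_comp_self_of_eqOn_compl (renames_shiftAncillas d a b).injective fun i => ?_
  refine Fin.addCases (fun i hi => ?_) (fun i => Fin.addCases (fun i _ => ?_) (fun i hi => ?_) i) i
  · exact absurd ⟨Fin.castAdd b i, Fin.append_left ..⟩ hi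
  · simp only [Fin.append_left, Fin.append_right]
  · exact absurd ⟨Fin.natAdd d i, Fin.append_right ..⟩ hi

variable {ι : Type} (𝒢 : ι → Matrix.unitaryGroup Bool ℂ) {C D : List (Gate ι ℕ)}

theorem krausOp_comp (hC : ∀ g ∈ C, g.Valid (d + b)) (hD : ∀ g ∈ D, g.Valid (d + a))
    (w : Fin a → Bool) (z : Fin b → Bool) :
    krausOp 𝒢 d (a + b) (C.map (Gate.map (shiftAncillas d a)) ++ D) (Fin.append w z) =
      krausOp 𝒢 d a D w * krausOp 𝒢 d b C z := by
  refine mulVec_injective <| funext fun v => funext fun x => ?_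
  have hle : d + a ≤ d + (a + b) := by omega
  rw [← mulVec_mulVec, krausOp_mulVec, krausOp_mulVec, circuitMatrix_append_mulVec,
    circuitMatrix_castLE 𝒢 hle hD, liftOp_mulVec (Fin.castLE_injective hle),
    append_append_comp_castLE, (renames_shiftAncillas d a b).circuitMatrix 𝒢 hC]
  congr 2
  funext y
  obtain ⟨x', w', rfl⟩ := exists_eq_fin_append y
  rw [extend_castLE_append, withAncillas_append,
    liftOp_mulVec (renames_shiftAncillas d a b).injective, append_append_comp_shiftAncillasFin,
    krausOp_mulVec]
  have fresh : (fun y => withAncillas (a + b) v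
      (extend (shiftAncillasFin d a b) y (Fin.append x' (Fin.append w' z)))) =
      if ∀ j, w' j = false then withAncillas b v else 0 := by
    funext y
    obtain ⟨x'', z'', rfl⟩ := exists_eq_fin_append y
    simp only [extend_shiftAncillasFin_append, withAncillas_append, Fin.forall_fin_add,
      Fin.append_left, Fin.append_right, ite_and, ite_apply, Pi.zero_apply]
  rw [fresh]
  split_ifs
  · rfl
  · rw [mulVec_zero, Pi.zero_apply]

theorem circuitChannel_comp (hC : ∀ g ∈ C, g.Valid (d + b)) (hD : ∀ g ∈ D, g.Valid (d + a))
    (ρ : QOp d) :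
    circuitChannel 𝒢 d (a + b) (C.map (Gate.map (shiftAncillas d a)) ++ D) ρ =
      circuitChannel 𝒢 d a D (circuitChannel 𝒢 d b C ρ) := by
  simp only [circuitChannel_eq_sum, sum_fin_append, krausOp_comp 𝒢 hC hD, Finset.mul_sum,
    Finset.sum_mul, Matrix.conjTranspose_mul, mul_assoc]

theorem outputBit_append (x : Fin d → Bool) (w : Fin a → Bool) (z : Fin b → Bool)
    (h : 0 < d + a) : outputBit x (Fin.append w z) ↔ outputBit x w := by
  have hle : d + a ≤ d + (a + b) := by omega
  rw [outputBit, outputBit, ← append_append_comp_castLE hle x w z]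
  refine ⟨fun ⟨i, hi, hx⟩ => ⟨⟨0, h⟩, rfl, ?_⟩, fun ⟨i, hi, hx⟩ => ⟨Fin.castLE hle i, hi, hx⟩⟩
  rwa [show i = Fin.castLE hle ⟨0, h⟩ from Fin.ext hi] at hx

theorem acceptProb_comp (hC : ∀ g ∈ C, g.Valid (d + b)) (hD : ∀ g ∈ D, g.Valid (d + a))
    (ρ : QOp d) (h : 0 < d + a) :
    acceptProb 𝒢 d (a + b) (C.map (Gate.map (shiftAncillas d a)) ++ D) ρ =
      acceptProb 𝒢 d a D (circuitChannel 𝒢 d b C ρ) := by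
  classical
  simp only [acceptProb_eq_sum, circuitChannel_eq_sum, sum_fin_append,
    krausOp_comp 𝒢 hC hD, Finset.mul_sum, Finset.sum_mul, Matrix.conjTranspose_mul, mul_assoc,
    Matrix.sum_apply, Complex.re_sum, outputBit_append _ _ _ h]
  refine Finset.sum_congr rfl fun x _ => Finset.sum_congr rfl fun w _ => ?_
  split_ifs
  · rfl
  · exact Finset.sum_const_zero

end Composition

/-! ## Tensor products -/

section TensorOp
open Matrix

variable {J Q W : Type*} (e : J × Q ≃ W)

theorem eq_iff_forall_restrict_eq {α : Type*} {x y : W → α} :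
    x = y ↔ ∀ j, (fun q => x (e (j, q))) = fun q => y (e (j, q)) := by
  refine ⟨fun h _ => h ▸ rfl, fun h => funext fun w => ?_⟩
  obtain ⟨⟨j, q⟩, rfl⟩ := e.surjective w
  exact congrFun (h j) q

variable [Fintype J]

theorem sum_prod_restrict [Fintype Q] [DecidableEq Q] [Fintype W] [DecidableEq W]
    {R α : Type*} [CommSemiring R] [Fintype α] (F : J → (Q → α) → R) :
    ∑ x : W → α, ∏ j, F j (fun q => x (e (j, q))) = ∏ j, ∑ x, F j x := by
  classical
  rw [Finset.prod_univ_sum, Fintype.piFinset_univ]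
  exact Fintype.sum_equiv ((e.symm.arrowCongr (Equiv.refl α)).trans (Equiv.curry J Q α)) _ _
    fun _ => rfl

/-- `⨂ⱼ A j` on a register `W` that consists of registers `Q` indexed by `J`. -/
def tensorOp (A : J → RegOp Q) : RegOp W :=
  Matrix.of fun x y => ∏ j, A j (fun q => x (e (j, q))) (fun q => y (e (j, q)))

theorem tensorOp_conjTranspose (A : J → RegOp Q) :
    (tensorOp e A)ᴴ = tensorOp e fun j => (A j)ᴴ := by
  ext x y
  simp only [tensorOp, Matrix.conjTranspose_apply, Matrix.of_apply, star_prod]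

variable [Fintype Q]

theorem tensorOp_one [Fintype W] : tensorOp e (fun _ => 1) = 1 := by
  ext x y
  simp only [tensorOp, Matrix.of_apply, Matrix.one_apply, Finset.prod_ite_zero,
    Finset.prod_const_one, Finset.mem_univ, true_imp_iff, ← eq_iff_forall_restrict_eq e]

theorem liftOp_eq_tensorOp [DecidableEq J] (j : J) (M : RegOp Q) :
    liftOp (fun q => e (j, q)) M = tensorOp e (Function.update 1 j M) := by
  ext x y
  have agree : (∀ w, w ∉ Set.range (fun q => e (j, q)) → x w = y w) ↔
      ∀ l ∈ Finset.univ.erase j, (fun q => x (e (l, q))) = fun q => y (e (l, q)) := by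
    refine ⟨fun h l hl => funext fun q => h _ ?_, fun h w hw => ?_⟩
    · rintro ⟨q', hq'⟩
      exact Finset.ne_of_mem_erase hl (congrArg Prod.fst (e.injective hq')).symm
    · obtain ⟨⟨l, q⟩, rfl⟩ := e.surjective w
      exact congrFun (h l (Finset.mem_erase.2 ⟨fun hl => hw ⟨q, hl ▸ rfl⟩, Finset.mem_univ l⟩)) q
  have others : ∀ l ∈ Finset.univ.erase j, (Function.update 1 j M : J → RegOp Q) l
      (fun q => x (e (l, q))) (fun q => y (e (l, q))) =
      if (fun q => x (e (l, q))) = (fun q => y (e (l, q))) then 1 else 0 := fun l hl => by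
    rw [Function.update_of_ne (Finset.ne_of_mem_erase hl), Pi.one_apply, Matrix.one_apply]
  simp only [liftOp, tensorOp, Matrix.of_apply]
  rw [← Finset.mul_prod_erase Finset.univ _ (Finset.mem_univ j), Function.update_self,
    Finset.prod_congr rfl others, Finset.prod_ite_zero, Finset.prod_const_one, mul_ite, mul_one,
    mul_zero]
  congr 1
  exact propext agree

variable [DecidableEq Q] [Fintype W] [DecidableEq W]

theorem tensorOp_mul (A B : J → RegOp Q) :
    tensorOp e A * tensorOp e B = tensorOp e fun j => A j * B j := by
  ext x y
  simp only [tensorOp, Matrix.mul_apply, Matrix.of_apply, ← Finset.prod_mul_distrib]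
  exact sum_prod_restrict e fun j z => A j (fun q => x (e (j, q))) z * B j z fun q => y (e (j, q))

theorem sum_tensorOp {Q' W' : Type*} (e' : J × Q' ≃ W') (F : J → (Q → Bool) → RegOp Q') :
    ∑ z : W → Bool, tensorOp e' (fun j => F j fun q => z (e (j, q))) =
      tensorOp e' fun j => ∑ w, F j w := by
  ext x y
  simp only [tensorOp, Matrix.sum_apply, Matrix.of_apply]
  exact sum_prod_restrict e fun j w => F j w (fun q => x (e' (j, q))) fun q => y (e' (j, q))

end TensorOp

theorem copies_eq_tensorOp (n t : ℕ) (ρ : QOp n) :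
    copies n t ρ = tensorOp finProdFinEquiv fun _ => ρ := rfl

/-! ## Parallel runs of a circuit -/

section Parallel

/-- Qubit numbers of run number `j` among `t` runs of a circuit with `n` input qubits and `a`
ancillas. -/
def parallelIndex (n t a j h : ℕ) : ℕ := if h < n then h + n * j else h + (t * n - n + a * j)

/-- The circuit `C` on each of `t` inputs. -/
def parallelCircuit {ι : Type} (n t a : ℕ) (C : List (Gate ι ℕ)) : List (Gate ι ℕ) :=
  (List.range t).flatMap fun j => C.map (Gate.map (parallelIndex n t a j))

/-- The qubits of `t` runs of a circuit. -/
def parallelEquiv (n t a : ℕ) : Fin t × Fin (n + a) ≃ Fin (t * n + t * a) :=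
  (((Equiv.refl _).prodCongr finSumFinEquiv.symm).trans (Equiv.prodSumDistrib _ _ _)).trans
    ((Equiv.sumCongr finProdFinEquiv finProdFinEquiv).trans finSumFinEquiv)

variable {n t a : ℕ}

theorem parallelEquiv_castAdd (j : Fin t) (i : Fin n) :
    parallelEquiv n t a (j, Fin.castAdd a i) = Fin.castAdd (t * a) (finProdFinEquiv (j, i)) := by
  simp [parallelEquiv]

theorem parallelEquiv_natAdd (j : Fin t) (i : Fin a) :
    parallelEquiv n t a (j, Fin.natAdd n i) = Fin.natAdd (t * n) (finProdFinEquiv (j, i)) := by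
  simp [parallelEquiv]

theorem append_comp_parallelEquiv {α : Type*} (x : Fin (t * n) → α) (z : Fin (t * a) → α)
    (j : Fin t) :
    (fun q => Fin.append x z (parallelEquiv n t a (j, q))) =
      Fin.append (fun i => x (finProdFinEquiv (j, i))) fun i => z (finProdFinEquiv (j, i)) := by
  funext q
  refine Fin.addCases (fun i => ?_) (fun i => ?_) q
  · rw [parallelEquiv_castAdd, Fin.append_left, Fin.append_left]
  · rw [parallelEquiv_natAdd, Fin.append_right, Fin.append_right]

theorem renames_parallelIndex (n t a : ℕ) (j : Fin t) :
    Renames (parallelIndex n t a j) fun q => parallelEquiv n t a (j, q) := by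
  refine ⟨fun q q' h => congrArg Prod.snd ((parallelEquiv n t a).injective h), fun i => ?_⟩
  refine Fin.addCases (fun i => ?_) (fun i => ?_) i
  · rw [parallelEquiv_castAdd]
    simp [parallelIndex]
  · have : n ≤ t * n := Nat.le_mul_of_pos_left _ j.pos
    rw [parallelEquiv_natAdd]
    simp only [parallelIndex, Fin.val_natAdd, finProdFinEquiv_apply_val,
      if_neg (Nat.not_lt.2 (Nat.le_add_right n i))]
    omega

variable {ι : Type} (𝒢 : ι → Matrix.unitaryGroup Bool ℂ) {C : List (Gate ι ℕ)}

theorem parallelCircuit_valid (hC : ∀ g ∈ C, g.Valid (n + a)) :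
    ∀ g ∈ parallelCircuit n t a C, g.Valid (t * n + t * a) := by
  intro g hg
  simp only [parallelCircuit, List.mem_flatMap, List.mem_range, List.mem_map] at hg
  obtain ⟨j, hj, g, hg, rfl⟩ := hg
  exact (hC g hg).map (renames_parallelIndex n t a ⟨j, hj⟩)

theorem circuitMatrix_flatMap_parallelIndex (hC : ∀ g ∈ C, g.Valid (n + a)) {L : List (Fin t)}
    (hL : L.Nodup) :
    circuitMatrix 𝒢 (t * n + t * a)
      (L.flatMap fun j : Fin t => C.map (Gate.map (parallelIndex n t a j))) =
      tensorOp (parallelEquiv n t a) fun j => if j ∈ L then circuitMatrix 𝒢 (n + a) C else 1 := by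
  induction L with
  | nil => exact (tensorOp_one _).symm
  | cons j L ih =>
    obtain ⟨hj, hL⟩ := List.nodup_cons.1 hL
    rw [List.flatMap_cons, circuitMatrix_append, ih hL,
      (renames_parallelIndex n t a j).circuitMatrix 𝒢 hC, liftOp_eq_tensorOp, tensorOp_mul]
    congr 1
    funext l
    by_cases h : l = j
    · subst h; simp [hj]
    · simp [h]

theorem circuitMatrix_parallelCircuit (hC : ∀ g ∈ C, g.Valid (n + a)) :
    circuitMatrix 𝒢 (t * n + t * a) (parallelCircuit n t a C) =
      tensorOp (parallelEquiv n t a) fun _ => circuitMatrix 𝒢 (n + a) C := by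
  have all := circuitMatrix_flatMap_parallelIndex 𝒢 hC (List.nodup_finRange t)
  simp only [List.mem_finRange, if_true] at all
  rw [← all, parallelCircuit, ← List.map_coe_finRange_eq_range, List.flatMap_map]

theorem krausOp_parallelCircuit (hC : ∀ g ∈ C, g.Valid (n + a)) (z : Fin (t * a) → Bool) :
    krausOp 𝒢 (t * n) (t * a) (parallelCircuit n t a C) z =
      tensorOp finProdFinEquiv fun j => krausOp 𝒢 n a C fun i => z (finProdFinEquiv (j, i)) := by
  ext x y
  simp only [krausOp, circuitMatrix_parallelCircuit 𝒢 hC, tensorOp, Matrix.of_apply,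
    append_comp_parallelEquiv]

theorem circuitChannel_parallelCircuit (hC : ∀ g ∈ C, g.Valid (n + a)) (ρ : QOp n) :
    circuitChannel 𝒢 (t * n) (t * a) (parallelCircuit n t a C) (copies n t ρ) =
      copies n t (circuitChannel 𝒢 n a C ρ) := by
  simp only [circuitChannel_eq_sum, krausOp_parallelCircuit 𝒢 hC, copies_eq_tensorOp,
    tensorOp_conjTranspose, tensorOp_mul]
  exact sum_tensorOp finProdFinEquiv finProdFinEquiv
    fun _ z => krausOp 𝒢 n a C z * ρ * (krausOp 𝒢 n a C z).conjTranspose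

end Parallel

/-! ## The uniform measure on the unit sphere -/

section UniformSphere
variable {E F : Type*} [NormedAddCommGroup E] [NormedAddCommGroup F]

/-- The homeomorphism of the unit sphere given by a linear isometry. -/
def sphereHomeomorph [NormedSpace ℝ E] (L : E ≃ₗᵢ[ℝ] E) :
    Metric.sphere (0 : E) 1 ≃ₜ Metric.sphere (0 : E) 1 where
  toFun ψ := ⟨L ψ, by simp⟩
  invFun ψ := ⟨L.symm ψ, by simp⟩
  left_inv ψ := by simp
  right_inv ψ := by simp
  continuous_toFun := by fun_prop
  continuous_invFun := by fun_prop

variable [InnerProductSpace ℝ E] [FiniteDimensional ℝ E] [MeasurableSpace E] [BorelSpace E]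

open scoped Pointwise in
theorem measurePreserving_toSphere (L : E ≃ₗᵢ[ℝ] E) :
    MeasurePreserving (sphereHomeomorph L) (volume : Measure E).toSphere
      (volume : Measure E).toSphere := by
  refine ⟨(sphereHomeomorph L).measurable, ?_⟩
  ext s hs
  rw [Measure.map_apply (sphereHomeomorph L).measurable hs, Measure.toSphere_apply' _ hs,
    Measure.toSphere_apply' _ ((sphereHomeomorph L).measurable hs)]
  have cone_preimage : Set.Ioo (0 : ℝ) 1 • (Subtype.val '' (sphereHomeomorph L ⁻¹' s)) =
      L ⁻¹' (Set.Ioo (0 : ℝ) 1 • (Subtype.val '' s)) := by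
    ext v
    simp only [Set.mem_smul, Set.mem_image, Set.mem_preimage]
    constructor
    · rintro ⟨r, hr, _, ⟨ψ, hψ, rfl⟩, rfl⟩
      exact ⟨r, hr, _, ⟨_, hψ, rfl⟩, by simp [sphereHomeomorph]⟩
    · rintro ⟨r, hr, _, ⟨ψ, hψ, rfl⟩, h⟩
      refine ⟨r, hr, _, ⟨(sphereHomeomorph L).symm ψ, by simpa using hψ, rfl⟩, L.injective ?_⟩
      rw [← h]
      simp [sphereHomeomorph]
  rw [cone_preimage]
  exact congrArg _ (L.measurePreserving.measure_preimage_equiv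
    (f := L.toHomeomorph.toMeasurableEquiv) _)

variable (E) in
/-- The uniform probability measure on the unit sphere of a Euclidean space. -/
def uniformSphere : Measure (Metric.sphere (0 : E) 1) :=
  ((volume : Measure E).toSphere Set.univ)⁻¹ • (volume : Measure E).toSphere

instance isProbabilityMeasure_uniformSphere [Nontrivial E] :
    IsProbabilityMeasure (uniformSphere E) := by
  refine ⟨ENNReal.inv_mul_cancel ?_ (measure_ne_top _ _)⟩
  have volume_ball : (volume : Measure E) (Metric.ball 0 1) ≠ 0 :=
    (Metric.measure_ball_pos _ _ one_pos).ne'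
  simpa [Measure.toSphere_apply_univ, (Module.finrank_pos (R := ℝ) (M := E)).ne'] using volume_ball

theorem integral_uniformSphere_comp [NormedSpace ℝ F] (L : E ≃ₗᵢ[ℝ] E) (f : E → F) :
    ∫ ψ, f (L ψ.1) ∂(uniformSphere E) = ∫ ψ, f ψ.1 ∂(uniformSphere E) := by
  have invariant : MeasurePreserving (sphereHomeomorph L).toMeasurableEquiv (uniformSphere E)
      (uniformSphere E) :=
    (measurePreserving_toSphere L).smul_measure _
  exact invariant.integral_comp' fun ψ => f ψ.1

theorem integrable_uniformSphere [Nontrivial E] {f : E → F} (hf : Continuous f) :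
    Integrable (fun ψ => f ψ.1) (uniformSphere E) := by
  have : Continuous fun ψ : Metric.sphere (0 : E) 1 => f ψ.1 := by fun_prop
  exact this.integrable_of_hasCompactSupport (HasCompactSupport.of_compactSpace _)

end UniformSphere

/-! ## Moments of the coordinates of a random unit vector -/

section Moments
variable {J : Type*} [Fintype J]

/-- Multiplication of the coordinates by phases. -/
def phaseIsometry (θ : J → Circle) : EuclideanSpace ℂ J ≃ₗᵢ[ℝ] EuclideanSpace ℂ J :=
  LinearIsometryEquiv.piLpCongrRight 2 fun j => rotation (θ j)

theorem phaseIsometry_apply (θ : J → Circle) (ψ : EuclideanSpace ℂ J) (j : J) :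
    phaseIsometry θ ψ j = θ j * ψ j := by
  simp [phaseIsometry]

/-- Permutation of the coordinates. -/
def permIsometry (σ : Equiv.Perm J) : EuclideanSpace ℂ J ≃ₗᵢ[ℝ] EuclideanSpace ℂ J :=
  LinearIsometryEquiv.piLpCongrLeft 2 ℝ ℂ σ.symm

theorem permIsometry_apply (σ : Equiv.Perm J) (ψ : EuclideanSpace ℂ J) (j : J) :
    permIsometry σ ψ j = ψ (σ j) := by
  simp [permIsometry]

theorem integral_coord_eq (f : ℂ → ℝ) (j k : J) :
    ∫ ψ, f (ψ.1 j) ∂(uniformSphere (EuclideanSpace ℂ J)) =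
      ∫ ψ, f (ψ.1 k) ∂(uniformSphere (EuclideanSpace ℂ J)) := by
  classical
  rw [← integral_uniformSphere_comp (permIsometry (Equiv.swap j k)) fun ψ => f (ψ j)]
  simp only [permIsometry_apply, Equiv.swap_apply_left]

theorem sum_norm_sq_sphere (ψ : Metric.sphere (0 : EuclideanSpace ℂ J) 1) :
    ∑ j, ‖ψ.1 j‖ ^ 2 = 1 := by
  simp [← EuclideanSpace.norm_sq_eq]

theorem integral_norm_sq [Nonempty J] (j : J) :
    ∫ ψ, ‖ψ.1 j‖ ^ 2 ∂(uniformSphere (EuclideanSpace ℂ J)) = 1 / Fintype.card J := by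
  have total : ∑ k, ∫ ψ, ‖ψ.1 k‖ ^ 2 ∂(uniformSphere (EuclideanSpace ℂ J)) = 1 := by
    rw [← integral_finsetSum _ fun k _ => integrable_uniformSphere
      (f := fun ψ : EuclideanSpace ℂ J => ‖ψ k‖ ^ 2) (by fun_prop)]
    simp [sum_norm_sq_sphere]
  simp only [fun k => integral_coord_eq (‖·‖ ^ 2) k j, Finset.sum_const, nsmul_eq_mul,
    Finset.card_univ] at total
  rw [eq_div_iff (by positivity), mul_comm, total]

section MixIsometry
variable [DecidableEq J]

/-- The vector `e_j + 2 e_k`. -/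
def mixVector (j k : J) : EuclideanSpace ℂ J :=
  EuclideanSpace.single j 1 + EuclideanSpace.single k 2

theorem inner_mixVector (j k : J) (ψ : EuclideanSpace ℂ J) :
    inner ℂ (mixVector j k) ψ = ψ j + 2 * ψ k := by
  simp [mixVector, EuclideanSpace.inner_single_left, Complex.conj_ofNat]

/-- The reflection in the line spanned by `e_j + 2 e_k`, which mixes coordinates `j` and `k`. -/
def mixIsometry (j k : J) : EuclideanSpace ℂ J ≃ₗᵢ[ℝ] EuclideanSpace ℂ J where
  toLinearEquiv :=
    (Submodule.span ℂ {mixVector j k}).reflection.toLinearEquiv.restrictScalars ℝ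
  norm_map' := (Submodule.span ℂ {mixVector j k}).reflection.norm_map

theorem mixIsometry_apply {j k : J} (hjk : j ≠ k) (ψ : EuclideanSpace ℂ J) :
    mixIsometry j k ψ j = (4 * ψ k - 3 * ψ j) / 5 := by
  have norm_sq : (RCLike.ofReal ‖mixVector j k‖ : ℂ) ^ 2 = 5 := by
    rw [← inner_self_eq_norm_sq_to_K, inner_mixVector]
    simp [mixVector, hjk, hjk.symm]
    norm_num
  change (Submodule.span ℂ {mixVector j k}).reflection ψ j = _
  rw [Submodule.reflection_singleton_apply, norm_sq, inner_mixVector]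
  simp [mixVector, hjk]
  ring

end MixIsometry

theorem sum_norm_add_I_pow_mul_pow_four (a b : ℂ) :
    ∑ l ∈ Finset.range 4, ‖a + Complex.I ^ l * b‖ ^ 4 =
      4 * ‖a‖ ^ 4 + 4 * ‖b‖ ^ 4 + 16 * (‖a‖ ^ 2 * ‖b‖ ^ 2) := by
  have norm_pow_four (z : ℂ) : ‖z‖ ^ 4 = (z.re * z.re + z.im * z.im) ^ 2 := by
    rw [← Complex.normSq_apply, Complex.normSq_eq_norm_sq]; ring
  have norm_sq (z : ℂ) : ‖z‖ ^ 2 = z.re * z.re + z.im * z.im := by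
    rw [← Complex.normSq_apply, Complex.normSq_eq_norm_sq]
  simp [Finset.sum_range_succ, norm_pow_four, norm_sq, pow_succ]
  ring

theorem integral_norm_mix_pow_four {j k : J} (hjk : j ≠ k) (c : Circle) :
    ∫ ψ, ‖-3 * ψ.1 j + c * (4 * ψ.1 k)‖ ^ 4 ∂(uniformSphere (EuclideanSpace ℂ J)) =
      625 * ∫ ψ, ‖ψ.1 j‖ ^ 4 ∂(uniformSphere (EuclideanSpace ℂ J)) := by
  classical
  rw [← integral_uniformSphere_comp (mixIsometry j k) fun ψ => ‖ψ j‖ ^ 4,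
    ← integral_uniformSphere_comp (phaseIsometry (Function.update 1 k c))
      fun ψ => ‖mixIsometry j k ψ j‖ ^ 4, ← integral_const_mul]
  refine integral_congr_ae (.of_forall fun ψ => ?_)
  have : (4 * (c * ψ.1 k) - 3 * ψ.1 j : ℂ) = -3 * ψ.1 j + c * (4 * ψ.1 k) := by ring
  simp only [mixIsometry_apply hjk, phaseIsometry_apply, Function.update_self,
    Function.update_of_ne hjk, Pi.one_apply, Circle.coe_one, one_mul, norm_div, div_pow, this]
  norm_num
  ring

variable [Nonempty J]

/- Averaging `mixIsometry` over the phases `1, i, -1, -i` of coordinate `k` leaves only the moments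
that do not depend on phases. -/
theorem integral_norm_pow_four_eq_two_mul {j k : J} (hjk : j ≠ k) :
    ∫ ψ, ‖ψ.1 j‖ ^ 4 ∂(uniformSphere (EuclideanSpace ℂ J)) =
      2 * ∫ ψ, ‖ψ.1 j‖ ^ 2 * ‖ψ.1 k‖ ^ 2 ∂(uniformSphere (EuclideanSpace ℂ J)) := by
  set μ := uniformSphere (EuclideanSpace ℂ J)
  have integrable {f : EuclideanSpace ℂ J → ℝ} (hf : Continuous f) :
      Integrable (fun ψ => f ψ.1) μ := integrable_uniformSphere hf
  let i : Circle := ⟨Complex.I, by simp [Submonoid.unitSphere]⟩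
  have coe_i_pow (l : ℕ) : ((i ^ l : Circle) : ℂ) = Complex.I ^ l := Circle.coe_pow i l
  have averaged : ∫ ψ, (324 * ‖ψ.1 j‖ ^ 4 + 1024 * ‖ψ.1 k‖ ^ 4 +
      2304 * (‖ψ.1 j‖ ^ 2 * ‖ψ.1 k‖ ^ 2)) ∂μ = 4 * (625 * ∫ ψ, ‖ψ.1 j‖ ^ 4 ∂μ) := by
    calc _ = ∫ ψ, ∑ l ∈ Finset.range 4, ‖-3 * ψ.1 j + (i ^ l : Circle) * (4 * ψ.1 k)‖ ^ 4 ∂μ := by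
          refine integral_congr_ae (.of_forall fun ψ => ?_)
          simp only [coe_i_pow, sum_norm_add_I_pow_mul_pow_four, norm_mul, norm_neg,
            Complex.norm_ofNat]
          ring
      _ = _ := by
          rw [integral_finsetSum _ fun l _ => integrable (f := fun ψ =>
            ‖-3 * ψ j + (i ^ l : Circle) * (4 * ψ k)‖ ^ 4) (by fun_prop)]
          simp only [μ, integral_norm_mix_pow_four hjk, Finset.sum_const, Finset.card_range,
            nsmul_eq_mul, Nat.cast_ofNat]
  rw [integral_add (integrable (f := fun ψ => 324 * ‖ψ j‖ ^ 4 + 1024 * ‖ψ k‖ ^ 4) (by fun_prop))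
      (integrable (f := fun ψ => 2304 * (‖ψ j‖ ^ 2 * ‖ψ k‖ ^ 2)) (by fun_prop)),
    integral_add (integrable (f := fun ψ => 324 * ‖ψ j‖ ^ 4) (by fun_prop))
      (integrable (f := fun ψ => 1024 * ‖ψ k‖ ^ 4) (by fun_prop)),
    integral_const_mul, integral_const_mul, integral_const_mul,
    integral_coord_eq (‖·‖ ^ 4) k j] at averaged
  linarith

theorem integral_norm_pow_four (j : J) :
    ∫ ψ, ‖ψ.1 j‖ ^ 4 ∂(uniformSphere (EuclideanSpace ℂ J)) =
      2 / (Fintype.card J * (Fintype.card J + 1)) := by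
  classical
  set μ := uniformSphere (EuclideanSpace ℂ J)
  set I := ∫ ψ, ‖ψ.1 j‖ ^ 4 ∂μ with hI
  have total : ∑ k, ∫ ψ, ‖ψ.1 j‖ ^ 2 * ‖ψ.1 k‖ ^ 2 ∂μ = 1 / Fintype.card J := by
    rw [← integral_finsetSum _ fun k _ => integrable_uniformSphere
      (f := fun ψ : EuclideanSpace ℂ J => ‖ψ j‖ ^ 2 * ‖ψ k‖ ^ 2) (by fun_prop)]
    simp only [← Finset.mul_sum, sum_norm_sq_sphere, mul_one, integral_norm_sq]
  have summand (k : J) : ∫ ψ, ‖ψ.1 j‖ ^ 2 * ‖ψ.1 k‖ ^ 2 ∂μ =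
      I / 2 + if k = j then I / 2 else 0 := by
    split_ifs with hk
    · simp only [hk, ← pow_add, add_halves, hI]
    · rw [hI, integral_norm_pow_four_eq_two_mul (Ne.symm hk)]
      ring
  simp only [summand, Finset.sum_add_distrib, Finset.sum_const, Finset.sum_ite_eq',
    Finset.mem_univ, if_true, nsmul_eq_mul, Finset.card_univ] at total
  field_simp at total ⊢
  linarith

theorem integral_norm_sq_mul_norm_sq {j k : J} (hjk : j ≠ k) :
    ∫ ψ, ‖ψ.1 j‖ ^ 2 * ‖ψ.1 k‖ ^ 2 ∂(uniformSphere (EuclideanSpace ℂ J)) =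
      1 / (Fintype.card J * (Fintype.card J + 1)) := by
  have fourth := (integral_norm_pow_four_eq_two_mul hjk).symm.trans (integral_norm_pow_four j)
  rw [← mul_right_inj' (two_ne_zero' ℝ), fourth]
  ring

theorem integral_norm_sq_mul_norm_sq_le (j k : J) :
    ∫ ψ, ‖ψ.1 j‖ ^ 2 * ‖ψ.1 k‖ ^ 2 ∂(uniformSphere (EuclideanSpace ℂ J)) ≤
      2 / (Fintype.card J : ℝ) ^ 2 := by
  have bound {x : ℝ} (hx : x ≤ 2) :
      x / (Fintype.card J * (Fintype.card J + 1)) ≤ 2 / (Fintype.card J : ℝ) ^ 2 :=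
    div_le_div₀ zero_le_two hx (by positivity) (by nlinarith)
  by_cases hjk : j = k
  · simp only [hjk, ← pow_add]
    exact (integral_norm_pow_four k).trans_le (bound le_rfl)
  · rw [integral_norm_sq_mul_norm_sq hjk]
    exact bound one_le_two

end Moments

section HaarState

theorem haarState_eq_uniformSphere (n m : ℕ) : haarState n m = uniformSphere (PureSpace n m) :=
  rfl

instance isProbabilityMeasure_haarState (n m : ℕ) : IsProbabilityMeasure (haarState n m) :=
  isProbabilityMeasure_uniformSphere

theorem integrable_haarState {n m : ℕ} {F : Type*} [NormedAddCommGroup F]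
    {f : PureSpace n m → F} (hf : Continuous f) :
    Integrable (fun ψ => f ψ.1) (haarState n m) :=
  integrable_uniformSphere hf

end HaarState

/-! ## Collision bound -/

section Collision
variable {J W : Type*} [Fintype J]

theorem le_ite_injective_add_sum_collisions [DecidableEq W] {c : ℝ} (hc : 0 ≤ c) (z : J → W) :
    c ≤ (if z.Injective then c else 0) +
      ∑ q ∈ Finset.univ.offDiag, if z q.1 = z q.2 then c else 0 := by
  have nonneg (q : J × J) : 0 ≤ if z q.1 = z q.2 then c else 0 := by split_ifs <;> simp [hc]
  by_cases hz : z.Injective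
  · simpa [hz] using Finset.sum_nonneg fun q _ => nonneg q
  · obtain ⟨i, j, collision, hij⟩ : ∃ i j, z i = z j ∧ i ≠ j := by
      simpa [Function.Injective] using hz
    simpa [hz, collision] using Finset.single_le_sum (fun q _ => nonneg q)
      (show (i, j) ∈ Finset.univ.offDiag by simpa using hij)

variable [DecidableEq J] [Fintype W] {p : W → ℝ}

theorem sum_prod_eq_one (hp : ∑ w, p w = 1) : ∑ z : J → W, ∏ l, p (z l) = 1 := by
  rw [← Fintype.prod_sum fun _ : J => p]
  simp [hp]

variable [DecidableEq W]

theorem sum_prod_of_eqOn (hp : ∑ w, p w = 1) (s : Finset J) (w : W) :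
    (∑ z : J → W, if ∀ l ∈ s, z l = w then ∏ l, p (z l) else 0) = p w ^ s.card := by
  calc _ = ∑ z : J → W, ∏ l, if l ∈ s → z l = w then p (z l) else 0 := by
        simp [Finset.prod_ite_zero]
    _ = ∏ l, ∑ v, if l ∈ s → v = w then p v else 0 :=
        (Fintype.prod_sum fun l v => if l ∈ s → v = w then p v else 0).symm
    _ = ∏ l, if l ∈ s then p w else 1 :=
        Finset.prod_congr rfl fun l _ => by by_cases hl : l ∈ s <;> simp [hl, hp]
    _ = p w ^ s.card := by simp

theorem sum_prod_of_collision (hp : ∑ w, p w = 1) {i j : J} (hij : i ≠ j) :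
    (∑ z : J → W, if z i = z j then ∏ l, p (z l) else 0) = ∑ w, p w ^ 2 := by
  have split_value (z : J → W) : (if z i = z j then ∏ l, p (z l) else 0) =
      ∑ w, if ∀ l ∈ ({i, j} : Finset J), z l = w then ∏ l, p (z l) else 0 := by
    simp [ite_and, eq_comm (a := z j)]
  simp only [split_value]
  rw [Finset.sum_comm]
  simp only [sum_prod_of_eqOn hp, Finset.card_pair hij]

theorem one_sub_collisions_le_sum_injective (h0 : ∀ w, 0 ≤ p w) (h1 : ∑ w, p w = 1) :
    1 - (Fintype.card J : ℝ) ^ 2 * ∑ w, p w ^ 2 ≤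
      ∑ z : J → W with z.Injective, ∏ l, p (z l) := by
  have union_bound := Finset.sum_le_sum fun (z : J → W) (_ : z ∈ Finset.univ) =>
    le_ite_injective_add_sum_collisions
      (Finset.prod_nonneg fun (l : J) (_ : l ∈ Finset.univ) => h0 (z l)) z
  have pairs : ∑ z : J → W, ∑ q ∈ (Finset.univ : Finset J).offDiag,
      (if z q.1 = z q.2 then ∏ l, p (z l) else 0) ≤
        (Fintype.card J : ℝ) ^ 2 * ∑ w, p w ^ 2 := by
    rw [Finset.sum_comm, Finset.sum_congr rfl fun q hq =>
      sum_prod_of_collision h1 (Finset.mem_offDiag.1 hq).2.2, Finset.sum_const, nsmul_eq_mul]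
    refine mul_le_mul_of_nonneg_right ?_ (Finset.sum_nonneg fun w _ => sq_nonneg _)
    rw [Finset.offDiag_card, Finset.card_univ, sq]
    exact_mod_cast Nat.sub_le _ _
  rw [sum_prod_eq_one h1, Finset.sum_add_distrib, ← Finset.sum_filter] at union_bound
  linarith

end Collision

/-! ## The generalized Hilbert–Schmidt ensemble is close to the maximally mixed state -/

section Components
variable {n m t : ℕ}

theorem card_pureSpace_basis (n m : ℕ) :
    (Fintype.card ((Fin n → Bool) × (Fin m → Bool)) : ℝ) = 2 ^ n * 2 ^ m := by
  simp

/-- The register number `j` of a basis state of `t` registers of `n` qubits. -/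
def regState (x : Fin (t * n) → Bool) (j : Fin t) : Fin n → Bool :=
  fun i => x (finProdFinEquiv (j, i))

theorem regState_injective : (regState : (Fin (t * n) → Bool) → _).Injective := fun _ _ h =>
  (eq_iff_forall_restrict_eq finProdFinEquiv).2 fun j => congrFun h j

/-- `⨂ⱼ ψ_{z j}` for the components `ψ_w ∈ ℂ^{2^n}`, `w ∈ {0,1}^m`, of a pure state. -/
def tupleVec (ψ : PureSpace n m) (z : Fin t → Fin m → Bool) (x : Fin (t * n) → Bool) : ℂ :=
  ∏ j, ψ (regState x j, z j)

@[fun_prop]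
theorem continuous_tupleVec (z : Fin t → Fin m → Bool) (x : Fin (t * n) → Bool) :
    Continuous fun ψ : PureSpace n m => tupleVec ψ z x := by
  unfold tupleVec
  fun_prop

theorem copies_reducedState (ψ : PureSpace n m) :
    copies n t (reducedState n m ψ) =
      ∑ z, Matrix.vecMulVec (tupleVec ψ z) (star (tupleVec ψ z)) := by
  ext x y
  simp only [copies, reducedState, Matrix.of_apply, Matrix.sum_apply, Matrix.vecMulVec_apply,
    tupleVec, Pi.star_apply, star_prod, ← Finset.prod_mul_distrib]
  exact Fintype.prod_sum _

/- Flipping the sign of the coordinate `(regState x j, z j)` flips `tupleVec ψ z x` only. -/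
theorem integral_tupleVec_mul_star_of_ne {z : Fin t → Fin m → Bool} (hz : z.Injective)
    {x y : Fin (t * n) → Bool} (hxy : x ≠ y) :
    ∫ ψ, tupleVec ψ.1 z x * star (tupleVec ψ.1 z y) ∂(haarState n m) = 0 := by
  obtain ⟨j, hj⟩ : ∃ j, regState x j ≠ regState y j :=
    Function.ne_iff.1 (regState_injective.ne hxy)
  let flip : PureSpace n m ≃ₗᵢ[ℝ] PureSpace n m :=
    phaseIsometry (Function.update 1 (regState x j, z j) (-1))
  have flip_x (ψ : PureSpace n m) : tupleVec (flip ψ) z x = -tupleVec ψ z x := by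
    simp only [tupleVec, flip, phaseIsometry_apply, Finset.prod_mul_distrib]
    rw [Finset.prod_eq_single j]
    · simp
    · intro l _ hl
      rw [Function.update_of_ne fun e => hl (hz (Prod.ext_iff.1 e).2)]
      simp
    · simp
  have flip_y (ψ : PureSpace n m) : tupleVec (flip ψ) z y = tupleVec ψ z y := by
    simp only [tupleVec, flip, phaseIsometry_apply, Finset.prod_mul_distrib]
    rw [Finset.prod_eq_one, one_mul]
    intro l _
    rw [Function.update_of_ne]
    · simp
    · intro e
      obtain rfl := hz (Prod.ext_iff.1 e).2
      exact hj (Prod.ext_iff.1 e).1.symm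
  have invariant := integral_uniformSphere_comp flip
    fun ψ : PureSpace n m => tupleVec ψ z x * star (tupleVec ψ z y)
  simp only [flip_x, flip_y, neg_mul, integral_neg] at invariant
  exact self_eq_neg.1 invariant.symm

/- Distinct components are distinct blocks of coordinates, and may be permuted independently. -/
theorem integral_norm_sq_tupleVec_eq {z : Fin t → Fin m → Bool} (hz : z.Injective)
    (x y : Fin (t * n) → Bool) :
    ∫ ψ, ‖tupleVec ψ.1 z x‖ ^ 2 ∂(haarState n m) =
      ∫ ψ, ‖tupleVec ψ.1 z y‖ ^ 2 ∂(haarState n m) := by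
  refine (integral_uniformSphere_comp (permIsometry (Equiv.prodCongrLeft
    (Function.extend z (fun j => Equiv.swap (regState x j) (regState y j)) 1)))
    fun ψ : PureSpace n m => ‖tupleVec ψ z x‖ ^ 2).symm.trans ?_
  simp only [tupleVec, permIsometry_apply, Equiv.prodCongrLeft_apply, hz.extend_apply,
    Equiv.swap_apply_left]
  rfl

/-- The squared norm `‖ψ_w‖²` of the component `ψ_w` of a pure state. -/
def componentWeight (ψ : PureSpace n m) (w : Fin m → Bool) : ℝ := ∑ x, ‖ψ (x, w)‖ ^ 2

theorem componentWeight_nonneg (ψ : PureSpace n m) (w : Fin m → Bool) : 0 ≤ componentWeight ψ w :=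
  Finset.sum_nonneg fun _ _ => by positivity

@[fun_prop]
theorem continuous_componentWeight (w : Fin m → Bool) :
    Continuous fun ψ : PureSpace n m => componentWeight ψ w := by
  unfold componentWeight
  fun_prop

theorem sum_componentWeight (ψ : Metric.sphere (0 : PureSpace n m) 1) :
    ∑ w, componentWeight ψ.1 w = 1 := by
  have total := sum_norm_sq_sphere ψ
  rwa [Fintype.sum_prod_type_right] at total

theorem sum_norm_sq_tupleVec (ψ : PureSpace n m) (z : Fin t → Fin m → Bool) :
    ∑ x, ‖tupleVec ψ z x‖ ^ 2 = ∏ j, componentWeight ψ (z j) := by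
  simp only [tupleVec, norm_prod, ← Finset.prod_pow, componentWeight]
  exact sum_prod_restrict finProdFinEquiv fun j x => ‖ψ (x, z j)‖ ^ 2

theorem integral_norm_sq_tupleVec {z : Fin t → Fin m → Bool} (hz : z.Injective)
    (x : Fin (t * n) → Bool) :
    ∫ ψ, ‖tupleVec ψ.1 z x‖ ^ 2 ∂(haarState n m) =
      (∫ ψ, ∏ j, componentWeight ψ.1 (z j) ∂(haarState n m)) / 2 ^ (t * n) := by
  have total : ∑ y, ∫ ψ, ‖tupleVec ψ.1 z y‖ ^ 2 ∂(haarState n m) =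
      ∫ ψ, ∏ j, componentWeight ψ.1 (z j) ∂(haarState n m) := by
    rw [← integral_finsetSum _ fun y _ => integrable_haarState
      (f := fun ψ : PureSpace n m => ‖tupleVec ψ z y‖ ^ 2) (by fun_prop)]
    simp only [sum_norm_sq_tupleVec]
  rw [← total, Finset.sum_congr rfl fun y _ => integral_norm_sq_tupleVec_eq hz y x]
  simp

theorem integral_tupleVec_mul_star {z : Fin t → Fin m → Bool} (hz : z.Injective)
    (x y : Fin (t * n) → Bool) :
    ∫ ψ, tupleVec ψ.1 z x * star (tupleVec ψ.1 z y) ∂(haarState n m) =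
      if x = y then
        (((∫ ψ, ∏ j, componentWeight ψ.1 (z j) ∂(haarState n m)) / 2 ^ (t * n) : ℝ) : ℂ)
      else 0 := by
  split_ifs with hxy
  · subst hxy
    rw [← integral_norm_sq_tupleVec hz x, ← integral_complex_ofReal]
    simp [Complex.mul_conj, Complex.normSq_eq_norm_sq]
  · exact integral_tupleVec_mul_star_of_ne hz hxy

theorem trace_mul_vecMulVec_star (E : QOp (t * n)) (v : (Fin (t * n) → Bool) → ℂ) :
    (E * Matrix.vecMulVec v (star v)).trace = ∑ y, ∑ x, E y x * (v x * star (v y)) := by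
  simp [Matrix.trace, Matrix.mul_apply, Matrix.vecMulVec_apply]

theorem integral_trace_mul_tupleVec (E : QOp (t * n)) {z : Fin t → Fin m → Bool}
    (hz : z.Injective) :
    ∫ ψ, (E * Matrix.vecMulVec (tupleVec ψ.1 z) (star (tupleVec ψ.1 z))).trace.re
      ∂(haarState n m) =
      E.trace.re * ((∫ ψ, ∏ j, componentWeight ψ.1 (z j) ∂(haarState n m)) / 2 ^ (t * n)) := by
  simp only [trace_mul_vecMulVec_star]
  refine (integral_re (𝕜 := ℂ) (integrable_haarState (f := fun ψ =>
    ∑ y, ∑ x, E y x * (tupleVec ψ z x * star (tupleVec ψ z y))) (by fun_prop))).trans ?_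
  rw [integral_finsetSum _ fun y _ => integrable_haarState (f := fun ψ =>
    ∑ x, E y x * (tupleVec ψ z x * star (tupleVec ψ z y))) (by fun_prop)]
  simp only [fun y => integral_finsetSum Finset.univ fun x _ => integrable_haarState (f := fun ψ =>
    E y x * (tupleVec ψ z x * star (tupleVec ψ z y))) (by fun_prop), integral_const_mul,
    integral_tupleVec_mul_star hz, mul_ite, mul_zero, Finset.sum_ite_eq', Finset.mem_univ, if_true,
    ← Finset.sum_mul]
  exact Complex.re_mul_ofReal _ _

theorem integral_componentWeight_sq_le (w : Fin m → Bool) :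
    ∫ ψ : Metric.sphere (0 : PureSpace n m) 1, componentWeight ψ.1 w ^ 2 ∂(haarState n m) ≤
      2 / (2 ^ m) ^ 2 := by
  simp only [componentWeight, sq (∑ _, _), Finset.sum_mul_sum]
  calc _ = ∑ x, ∑ y, ∫ ψ, ‖ψ.1 (x, w)‖ ^ 2 * ‖ψ.1 (y, w)‖ ^ 2 ∂(haarState n m) := by
        rw [integral_finsetSum _ fun x _ => integrable_haarState
          (f := fun ψ => ∑ y, ‖ψ (x, w)‖ ^ 2 * ‖ψ (y, w)‖ ^ 2) (by fun_prop)]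
        exact Finset.sum_congr rfl fun x _ => integral_finsetSum _ fun y _ => integrable_haarState
          (f := fun ψ => ‖ψ (x, w)‖ ^ 2 * ‖ψ (y, w)‖ ^ 2) (by fun_prop)
    _ ≤ ∑ _x : Fin n → Bool, ∑ _y : Fin n → Bool, 2 / ((2 : ℝ) ^ n * 2 ^ m) ^ 2 := by
        rw [← card_pureSpace_basis]
        exact Finset.sum_le_sum fun _ _ => Finset.sum_le_sum fun _ _ =>
          integral_norm_sq_mul_norm_sq_le _ _
    _ = 2 / (2 ^ m) ^ 2 := by
        simp
        field_simp

theorem one_sub_le_sum_prod_componentWeight (ψ : Metric.sphere (0 : PureSpace n m) 1) :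
    1 - (t : ℝ) ^ 2 * ∑ w, componentWeight ψ.1 w ^ 2 ≤
      ∑ z : Fin t → Fin m → Bool with z.Injective, ∏ j, componentWeight ψ.1 (z j) := by
  have bound := one_sub_collisions_le_sum_injective (J := Fin t) (componentWeight_nonneg ψ.1)
    (sum_componentWeight ψ)
  rwa [Fintype.card_fin] at bound

theorem one_sub_le_sum_integral_prod_componentWeight :
    1 - 2 * (t : ℝ) ^ 2 / 2 ^ m ≤ ∑ z : Fin t → Fin m → Bool with z.Injective,
      ∫ ψ : Metric.sphere (0 : PureSpace n m) 1, ∏ j, componentWeight ψ.1 (z j)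
        ∂(haarState n m) := by
  have integrable_prod (z : Fin t → Fin m → Bool) : Integrable
      (fun ψ : Metric.sphere (0 : PureSpace n m) 1 => ∏ j, componentWeight ψ.1 (z j))
      (haarState n m) :=
    integrable_haarState (f := fun ψ => ∏ j, componentWeight ψ (z j)) (by fun_prop)
  have second_moments : ∑ w, ∫ ψ : Metric.sphere (0 : PureSpace n m) 1, componentWeight ψ.1 w ^ 2
      ∂(haarState n m) ≤ 2 / 2 ^ m := by
    refine (Finset.sum_le_sum fun w _ => integral_componentWeight_sq_le w).trans_eq ?_
    simp
    field_simp
  calc 1 - 2 * (t : ℝ) ^ 2 / 2 ^ m = 1 - (t : ℝ) ^ 2 * (2 / 2 ^ m) := by ring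
    _ ≤ 1 - (t : ℝ) ^ 2 * ∑ w, ∫ ψ : Metric.sphere (0 : PureSpace n m) 1,
          componentWeight ψ.1 w ^ 2 ∂(haarState n m) := by gcongr
    _ = ∫ ψ : Metric.sphere (0 : PureSpace n m) 1,
          (1 - (t : ℝ) ^ 2 * ∑ w, componentWeight ψ.1 w ^ 2) ∂(haarState n m) := by
        rw [integral_sub (integrable_const _) (integrable_haarState
          (f := fun ψ => (t : ℝ) ^ 2 * ∑ w, componentWeight ψ w ^ 2) (by fun_prop)),
          integral_const_mul, integral_finsetSum _ fun w _ => integrable_haarState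
            (f := fun ψ => componentWeight ψ w ^ 2) (by fun_prop)]
        simp
    _ ≤ ∫ ψ : Metric.sphere (0 : PureSpace n m) 1,
          ∑ z : Fin t → Fin m → Bool with z.Injective, ∏ j, componentWeight ψ.1 (z j)
            ∂(haarState n m) :=
        integral_mono_ae
          (integrable_haarState
            (f := fun ψ => 1 - (t : ℝ) ^ 2 * ∑ w, componentWeight ψ w ^ 2) (by fun_prop))
          (integrable_finsetSum _ fun z _ => integrable_prod z)
          (ae_of_all _ one_sub_le_sum_prod_componentWeight)
    _ = _ := integral_finsetSum _ fun z _ => integrable_prod z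

end Components

section Closeness
variable {n m t : ℕ}

theorem trace_reducedState (ψ : Metric.sphere (0 : PureSpace n m) 1) :
    (reducedState n m ψ.1).trace = 1 := by
  have h := sum_norm_sq_sphere ψ
  rw [Fintype.sum_prod_type] at h
  simp only [Matrix.trace, Matrix.diag, reducedState, Matrix.of_apply, RCLike.star_def,
    Complex.mul_conj, Complex.normSq_eq_norm_sq]
  exact_mod_cast h

theorem trace_copies (σ : QOp n) : (copies n t σ).trace = σ.trace ^ t := by
  simpa [Matrix.trace, copies] using
    sum_prod_restrict (finProdFinEquiv : Fin t × Fin n ≃ _) fun _ x => σ x x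

theorem copies_smul_one (c : ℂ) : copies n t (c • 1) = c ^ t • 1 := by
  rw [← tensorOp_one (finProdFinEquiv : Fin t × Fin n ≃ _)]
  ext x y
  simp [copies, tensorOp, Finset.prod_mul_distrib]

@[fun_prop]
theorem continuous_reducedState : Continuous (reducedState n m) := by
  refine continuous_matrix fun x y => ?_
  simp only [reducedState, Matrix.of_apply]
  fun_prop

@[fun_prop]
theorem continuous_copies : Continuous (copies n t) := by
  refine continuous_matrix fun x y => ?_
  simp only [copies, Matrix.of_apply]
  exact continuous_finsetProd _ fun j _ => continuous_apply_apply _ _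

theorem measurable_reducedState :
    Measurable fun ψ : Metric.sphere (0 : PureSpace n m) 1 => reducedState n m ψ.1 :=
  (continuous_reducedState.comp continuous_subtype_val).measurable

instance isProbabilityMeasure_ghse (n m : ℕ) : IsProbabilityMeasure (ghse n m) :=
  Measure.isProbabilityMeasure_map measurable_reducedState.aemeasurable

theorem integral_ghse {f : QOp n → ℝ} (hf : Continuous f) :
    ∫ σ, f σ ∂(ghse n m) = ∫ ψ, f (reducedState n m ψ.1) ∂(haarState n m) :=
  integral_map measurable_reducedState.aemeasurable hf.measurable.aestronglyMeasurable

theorem continuous_trace_mul_re {N : ℕ} (E : QOp N) :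
    Continuous fun σ : QOp N => (E * σ).trace.re :=
  Complex.continuous_re.comp (Continuous.matrix_trace (continuous_const.mul continuous_id))

open scoped ComplexOrder in
theorem le_integral_trace_copies {E : QOp (t * n)} (hE : E.PosSemidef) :
    (1 - 2 * (t : ℝ) ^ 2 / 2 ^ m) * (E.trace.re / 2 ^ (t * n)) ≤
      ∫ ψ, (E * copies n t (reducedState n m ψ.1)).trace.re ∂(haarState n m) := by
  have expectation_nonneg (v) : 0 ≤ (E * Matrix.vecMulVec v (star v)).trace.re := by
    rw [Matrix.mul_vecMulVec, Matrix.trace_vecMulVec, dotProduct_comm]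
    exact (Complex.le_def.1 (hE.dotProduct_mulVec_nonneg v)).1
  have trace_nonneg : 0 ≤ E.trace.re := (Complex.le_def.1 hE.trace_nonneg).1
  simp only [copies_reducedState, Finset.mul_sum, Matrix.trace_sum, Complex.re_sum]
  rw [integral_finsetSum _ fun z _ => integrable_haarState (f := fun ψ : PureSpace n m =>
    (E * Matrix.vecMulVec (tupleVec ψ z) (star (tupleVec ψ z))).trace.re) <|
      (continuous_trace_mul_re E).comp <| Continuous.matrix_vecMulVec
        (continuous_pi fun x => by fun_prop)
        (continuous_pi fun x => by simp only [Pi.star_apply]; fun_prop)]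
  calc _ ≤ (∑ z : Fin t → Fin m → Bool with z.Injective,
        ∫ ψ, ∏ j, componentWeight ψ.1 (z j) ∂(haarState n m)) * (E.trace.re / 2 ^ (t * n)) :=
        mul_le_mul_of_nonneg_right one_sub_le_sum_integral_prod_componentWeight (by positivity)
    _ = ∑ z : Fin t → Fin m → Bool with z.Injective,
        ∫ ψ, (E * Matrix.vecMulVec (tupleVec ψ.1 z) (star (tupleVec ψ.1 z))).trace.re
          ∂(haarState n m) := by
        rw [Finset.sum_mul]
        refine Finset.sum_congr rfl fun z hz => ?_
        rw [integral_trace_mul_tupleVec E (Finset.mem_filter.1 hz).2]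
        ring
    _ ≤ _ := Finset.sum_le_sum_of_subset_of_nonneg (Finset.subset_univ _)
        fun z _ _ => integral_nonneg fun ψ => expectation_nonneg _

open scoped ComplexOrder in
/- The lower bound `le_integral_trace_copies` for `E` and for `1 - E` also bounds the integral from
above. -/
theorem abs_integral_trace_copies_sub_le {E : QOp (t * n)} (hE : E.PosSemidef)
    (hE' : (1 - E).PosSemidef) :
    |∫ ψ, (E * copies n t (reducedState n m ψ.1)).trace.re ∂(haarState n m) -
      E.trace.re / 2 ^ (t * n)| ≤ 2 * (t : ℝ) ^ 2 / 2 ^ m := by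
  have lower := le_integral_trace_copies (m := m) hE
  have upper := le_integral_trace_copies (m := m) hE'
  have integral_compl :
      ∫ ψ, ((1 - E) * copies n t (reducedState n m ψ.1)).trace.re ∂(haarState n m) =
        1 - ∫ ψ, (E * copies n t (reducedState n m ψ.1)).trace.re ∂(haarState n m) := by
    simp only [Matrix.sub_mul, Matrix.trace_sub, one_mul, Complex.sub_re, trace_copies,
      trace_reducedState, one_pow, Complex.one_re]
    rw [integral_sub (integrable_const _) (integrable_haarState (f := fun ψ : PureSpace n m =>
      (E * copies n t (reducedState n m ψ)).trace.re) <| (continuous_trace_mul_re E).comp <|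
        continuous_copies.comp continuous_reducedState)]
    simp
  have trace_compl : (1 - E).trace.re / 2 ^ (t * n) = 1 - E.trace.re / 2 ^ (t * n) := by
    have trace_one : (1 : QOp (t * n)).trace = ((2 ^ (t * n) : ℝ) : ℂ) := by simp
    rw [Matrix.trace_sub, Complex.sub_re, trace_one, Complex.ofReal_re, sub_div,
      div_self (by positivity)]
  have normalized_trace_nonneg {F : QOp (t * n)} (hF : F.PosSemidef) :
      0 ≤ F.trace.re / 2 ^ (t * n) :=
    div_nonneg (Complex.le_def.1 hF.trace_nonneg).1 (by positivity)
  have nonneg := normalized_trace_nonneg hE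
  have nonneg' := normalized_trace_nonneg hE'
  have error_nonneg : 0 ≤ 2 * (t : ℝ) ^ 2 / 2 ^ m := by positivity
  rw [integral_compl, trace_compl] at upper
  rw [trace_compl] at nonneg'
  rw [abs_le]
  constructor <;> nlinarith

/-- The maximally mixed state. -/
def maxMixed (n : ℕ) : QOp n := ((2 : ℂ) ^ n)⁻¹ • 1

theorem trace_mul_copies_maxMixed (E : QOp (t * n)) :
    (E * copies n t (maxMixed n)).trace.re = E.trace.re / 2 ^ (t * n) := by
  have inv_eq : ((2 : ℂ) ^ (t * n))⁻¹ = (((2 : ℝ) ^ (t * n))⁻¹ : ℝ) := by push_cast; rfl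
  rw [maxMixed, copies_smul_one, Matrix.mul_smul, mul_one, Matrix.trace_smul, inv_pow, ← pow_mul,
    mul_comm n t, smul_eq_mul, inv_eq, Complex.re_ofReal_mul]
  ring

variable {ι : Type} (𝒢 : ι → Matrix.unitaryGroup Bool ℂ)

theorem continuous_acceptProb_copies (a : ℕ) (C : List (Gate ι ℕ)) :
    Continuous fun σ : QOp n => acceptProb 𝒢 (t * n) a C (copies n t σ) := by
  simp only [acceptProb_eq_trace]
  exact (continuous_trace_mul_re _).comp continuous_copies

theorem abs_integral_acceptProb_sub_le (a : ℕ) (C : List (Gate ι ℕ)) :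
    |∫ σ, acceptProb 𝒢 (t * n) a C (copies n t σ) ∂(ghse n m) -
      acceptProb 𝒢 (t * n) a C (copies n t (maxMixed n))| ≤ 2 * (t : ℝ) ^ 2 / 2 ^ m := by
  rw [integral_ghse (continuous_acceptProb_copies 𝒢 a C)]
  simp only [acceptProb_eq_trace, trace_mul_copies_maxMixed]
  exact abs_integral_trace_copies_sub_le (acceptEffect_posSemidef 𝒢 _ a C)
    (one_sub_acceptEffect_posSemidef 𝒢 _ a C)

end Closeness

/-! ## Programs -/

section Unary

@[simp]
theorem length_unary (n : ℕ) : (unary n).length = n := List.length_replicate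

@[simp]
theorem unary_zero : unary 0 = [] := rfl

@[simp]
theorem cons_unary (n : ℕ) : true :: unary n = unary (n + 1) := rfl

@[simp]
theorem unary_append_unary (m n : ℕ) : unary m ++ unary n = unary (m + n) :=
  List.replicate_append_replicate

@[simp]
theorem tail_unary (n : ℕ) : (unary n).tail = unary (n - 1) := List.tail_replicate

@[simp]
theorem head?_unary_eq_some_true {n : ℕ} : (unary n).head? = some true ↔ 0 < n := by
  cases n <;> simp [unary, List.replicate_succ]

end Unary

namespace Prog
variable {ι : Type} {P Q : Prog ι} {s s' s'' : Store} {C D : List (Gate ι ℕ)} {k l : ℕ}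

/-- `P` takes the stacks `s` to `s'` and writes the circuit `C` in at most `k` steps. -/
def Does (P : Prog ι) (s s' : Store) (C : List (Gate ι ℕ)) (k : ℕ) : Prop :=
  ∃ T ≤ k, Runs P s s' C T

namespace Does

theorem mono (h : P.Does s s' C k) (hk : k ≤ l) : P.Does s s' C l :=
  let ⟨T, hT, hr⟩ := h
  ⟨T, hT.trans hk, hr⟩

theorem congr (h : P.Does s s' C k) (hs : s' = s'') (hC : C = D) (hk : k ≤ l) :
    P.Does s s'' D l :=
  hs ▸ hC ▸ h.mono hk

theorem skip : (.skip : Prog ι).Does s s [] 1 := ⟨1, le_rfl, .skip s⟩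

theorem push {r : ℕ} {b : Bool} (h : s' = Function.update s r (b :: s r)) :
    (.push r b : Prog ι).Does s s' [] 1 :=
  h ▸ ⟨1, le_rfl, .push s r b⟩

theorem pop {r : ℕ} (h : s' = Function.update s r (s r).tail) :
    (.pop r : Prog ι).Does s s' [] 1 :=
  h ▸ ⟨1, le_rfl, .pop s r⟩

theorem emit (g : Gate ι ℕ) : (.emit g : Prog ι).Does s s [g.map fun r => (s r).length] 1 :=
  ⟨1, le_rfl, .emit s g⟩

theorem seq (hP : P.Does s s' C k) (hQ : Q.Does s' s'' D l) :
    (.seq P Q : Prog ι).Does s s'' (C ++ D) (k + l) :=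
  let ⟨_, hT, hP⟩ := hP
  let ⟨_, hU, hQ⟩ := hQ
  ⟨_, add_le_add hT hU, .seq hP hQ⟩

theorem seq_nil (hP : P.Does s s' [] k) (hQ : Q.Does s' s'' D l) :
    (.seq P Q : Prog ι).Does s s'' D (k + l) :=
  hP.seq hQ

theorem branch_true {r : ℕ} (hr : (s r).head? = some true) (h : P.Does s s' C k) :
    (.branch r P Q : Prog ι).Does s s' C (k + 1) :=
  let ⟨_, hT, h⟩ := h
  ⟨_, add_le_add_left hT 1, .branch_true hr h⟩

theorem branch_false {r : ℕ} (hr : (s r).head? ≠ some true) (h : Q.Does s s' C k) :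
    (.branch r P Q : Prog ι).Does s s' C (k + 1) :=
  let ⟨_, hT, h⟩ := h
  ⟨_, add_le_add_left hT 1, .branch_false hr h⟩

theorem loop_done {r : ℕ} (hr : s r = []) : (.loop r P : Prog ι).Does s s [] 1 :=
  ⟨1, le_rfl, .loop_done hr⟩

theorem loop_step {r : ℕ} (hr : s r ≠ []) (hP : P.Does s s' C k)
    (hQ : (.loop r P : Prog ι).Does s' s'' D l) :
    (.loop r P : Prog ι).Does s s'' (C ++ D) (k + l + 1) :=
  let ⟨_, hT, hP⟩ := hP
  let ⟨_, hU, hQ⟩ := hQ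
  ⟨_, add_le_add_left (add_le_add hT hU) 1, .loop_step hr hP hQ⟩

theorem loop {r n : ℕ} (S : ℕ → Store) (O : ℕ → List (Gate ι ℕ))
    (hr : ∀ i, (S i r).length = n - i) (hP : ∀ i < n, P.Does (S i) (S (i + 1)) (O i) k) :
    (.loop r P : Prog ι).Does (S 0) (S n) ((List.range n).flatMap O) (n * (k + 1) + 1) := by
  have last : ∀ j ≤ n, (.loop r P : Prog ι).Does (S (n - j)) (S n)
      ((List.range' (n - j) j).flatMap O) (j * (k + 1) + 1) := by
    intro j
    induction j with
    | zero =>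
      intro _
      simpa using loop_done (List.eq_nil_of_length_eq_zero (by simpa using hr n))
    | succ j ih =>
      intro hj
      obtain ⟨i, rfl⟩ : ∃ i, n = i + 1 + j := ⟨n - (j + 1), by omega⟩
      have start : i + 1 + j - (j + 1) = i := by omega
      have rest := ih (by omega)
      rw [Nat.add_sub_cancel] at rest
      rw [start, List.range'_succ, List.flatMap_cons]
      have nonempty : S i r ≠ [] := List.ne_nil_of_length_pos (by rw [hr]; omega)
      exact (loop_step nonempty (hP i (by omega)) rest).mono (by ring_nf; rfl)
  simpa [List.range_eq_range'] using last n le_rfl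

theorem loop_nil {r n : ℕ} (S : ℕ → Store) (hr : ∀ i, (S i r).length = n - i)
    (hP : ∀ i < n, P.Does (S i) (S (i + 1)) [] k) (h0 : S 0 = s) (hn : S n = s') :
    (.loop r P : Prog ι).Does s s' [] (n * (k + 1) + 1) :=
  h0 ▸ (loop S (fun _ => []) hr hP).congr hn (by simp) le_rfl

end Does

/-! ### Elementary programs -/

/-- Empty a stack. -/
def clear (r : ℕ) : Prog ι := .loop r (.pop r)

theorem does_clear (r : ℕ) (s : Store) :
    (clear r : Prog ι).Does s (Function.update s r []) [] (2 * (s r).length + 1) := by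
  refine (Does.loop_nil (k := 1) (n := (s r).length) (fun i => Function.update s r ((s r).drop i))
    (by simp) ?_ (by simp) (by simp)).mono (by omega)
  intro i _
  exact .pop (by simp)

/-- Move stack `a` to stack `b`, as a unary number. -/
def move (a b : ℕ) : Prog ι := .loop a (.seq (.pop a) (.push b true))

theorem does_move {a b : ℕ} (hab : a ≠ b) (s : Store) :
    (move a b : Prog ι).Does s
      (Function.update (Function.update s a []) b (unary (s a).length ++ s b)) []
      (3 * (s a).length + 1) := by
  refine (Does.loop_nil (k := 2) (n := (s a).length)
    (fun i => Function.update (Function.update s a ((s a).drop i)) b (unary i ++ s b))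
    (by simp [hab]) ?_ (by simp) (by simp)).mono (by omega)
  intro i _
  refine (Does.pop rfl).seq_nil (.push ?_)
  grind [Function.update_apply, cons_unary, List.tail_drop]

/-- Add the unary number on stack `a` to the one on stack `b`, with a temporary stack `c`. -/
def add (a b c : ℕ) : Prog ι :=
  .seq (.loop a (.seq (.pop a) (.seq (.push b true) (.push c true)))) (.move c a)

theorem does_add {a b c h : ℕ} (hab : a ≠ b) (hac : a ≠ c) (hbc : b ≠ c)
    (ha : s a = unary h) (hc : s c = []) :
    (add a b c : Prog ι).Does s (Function.update s b (unary h ++ s b)) [] (7 * h + 2) := by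
  have split : (.loop a (.seq (.pop a) (.seq (.push b true) (.push c true))) : Prog ι).Does s
      (Function.update (Function.update (Function.update s a []) b (unary h ++ s b)) c (unary h))
      [] (h * 4 + 1) := by
    refine Does.loop_nil (fun i => Function.update (Function.update (Function.update s a
      (unary (h - i))) b (unary i ++ s b)) c (unary i)) (by simp [hab, hac]) ?_ ?_ (by simp)
    · intro i _
      refine (Does.pop rfl).seq_nil ((Does.push rfl).seq_nil (.push ?_))
      grind [Function.update_apply, cons_unary, tail_unary]
    · grind [Function.update_apply, unary_zero]
  refine (split.seq_nil (does_move hac.symm _)).congr ?_ rfl (by simp; omega)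
  grind [Function.update_apply, length_unary]

/-! ### Evaluation of polynomials -/

/-- Push `c` ones. -/
def pushes (r : ℕ) : ℕ → Prog ι
  | 0 => .skip
  | c + 1 => .seq (.push r true) (.pushes r c)

theorem does_pushes (r c : ℕ) (s : Store) :
    (pushes r c : Prog ι).Does s (Function.update s r (unary c ++ s r)) [] (c + 1) := by
  induction c generalizing s with
  | zero => exact Does.skip.congr (by simp) rfl le_rfl
  | succ c ih =>
    refine ((Does.push rfl).seq_nil (ih _)).congr ?_ rfl (by omega)
    simp [unary, List.replicate_succ']

/-- Multiply the unary number on stack `r` by the one on stack `0`, with the temporary stacks `9`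
and `11`. -/
def mulInput (r : ℕ) : Prog ι := .seq (.move r 9) (.loop 9 (.seq (.pop 9) (.add 0 r 11)))

theorem does_mulInput {r n h : ℕ} (hr : r ∉ ({0, 9, 11} : Finset ℕ)) (s0 : s 0 = unary n)
    (sr : s r = unary h) (s9 : s 9 = []) (s11 : s 11 = []) :
    (mulInput r : Prog ι).Does s (Function.update s r (unary (h * n))) []
      (3 * h + 1 + (h * (7 * n + 4) + 1)) := by
  simp only [Finset.mem_insert, Finset.mem_singleton, not_or] at hr
  obtain ⟨r0, r9, r11⟩ := hr
  have moved := does_move (ι := ι) r9 s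
  rw [sr, length_unary] at moved
  refine moved.seq_nil (Does.loop_nil
    (fun i => Function.update (Function.update s r (unary (i * n))) 9 (unary (h - i)))
    (by simp) ?_ ?_ ?_)
  · intro i _
    have sum : unary n ++ unary (i * n) = unary ((i + 1) * n) := by simp [add_comm, add_mul]
    refine ((Does.pop rfl).seq_nil (does_add (h := n) (Ne.symm r0) (by norm_num) r11 ?_ ?_)).congr
      ?_ rfl (by omega)
    · grind [Function.update_apply]
    · grind [Function.update_apply]
    · grind [Function.update_apply, tail_unary]
  · grind [Function.update_apply, unary_zero]
  · grind [Function.update_apply, unary_zero]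

theorem exists_does_eval (p : Polynomial ℕ) {r : ℕ} (hr : r ∉ ({0, 9, 11} : Finset ℕ)) :
    ∃ (P : Prog ι) (q : Polynomial ℕ), ∀ (s : Store) (n : ℕ),
      s 0 = unary n → s r = [] → s 9 = [] → s 11 = [] →
        P.Does s (Function.update s r (unary (p.eval n))) [] (q.eval n) := by
  have hr' := hr
  simp only [Finset.mem_insert, Finset.mem_singleton, not_or] at hr'
  obtain ⟨r0, r9, r11⟩ := hr'
  induction p using Polynomial.recOnHorner with
  | M0 => exact ⟨.skip, 1, fun s n _ sr _ _ => Does.skip.congr (by simp [← sr]) rfl (by simp)⟩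
  | MC p a _ _ ih =>
    obtain ⟨P, q, hP⟩ := ih
    refine ⟨.seq P (.pushes r a), q + Polynomial.C (a + 1), fun s n s0 sr s9 s11 => ?_⟩
    refine ((hP s n s0 sr s9 s11).seq_nil (does_pushes r a _)).congr ?_ rfl (by simp)
    simp [add_comm]
  | MX p _ ih =>
    obtain ⟨P, q, hP⟩ := ih
    refine ⟨.seq P (.mulInput r), q + (3 * p + 1 + (p * (7 * Polynomial.X + 4) + 1)),
      fun s n s0 sr s9 s11 => ?_⟩
    refine ((hP s n s0 sr s9 s11).seq_nil (does_mulInput (n := n) (h := p.eval n) hr ?_ ?_ ?_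
      ?_)).congr (by simp) rfl (by simp)
    · simpa [Ne.symm r0] using s0
    · simp
    · simpa [Ne.symm r9] using s9
    · simpa [Ne.symm r11] using s11

/-! ### Simulation of a program on other stacks -/

/-- Run a program on the stacks `f 0, f 1, …`, with `E g` in place of the output instruction
`.emit g`. -/
def transform (f : ℕ → ℕ) (E : Gate ι ℕ → Prog ι) : Prog ι → Prog ι
  | .skip => .skip
  | .push r b => .push (f r) b
  | .pop r => .pop (f r)
  | .emit g => E g
  | .seq P Q => .seq (P.transform f E) (Q.transform f E)
  | .branch r P Q => .branch (f r) (P.transform f E) (Q.transform f E)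
  | .loop r P => .loop (f r) (P.transform f E)

theorem extend_update {f : ℕ → ℕ} (hf : f.Injective) (s t : Store) (r : ℕ) (l : List Bool) :
    Function.extend f (Function.update s r l) t
      = Function.update (Function.extend f s t) (f r) l := by
  funext q
  by_cases hq : ∃ r', f r' = q
  · obtain ⟨r', rfl⟩ := hq
    simp [hf.extend_apply, Function.update_apply, hf.eq_iff]
  · rw [Function.extend_apply' _ _ _ hq, Function.update_of_ne (fun h => hq ⟨r, h.symm⟩),
      Function.extend_apply' _ _ _ hq]

theorem _root_.Runs.does_transform {f : ℕ → ℕ} (hf : f.Injective) {E : Gate ι ℕ → Prog ι}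
    {t : Store} {G : Gate ι ℕ → Prop} {φ : ℕ → ℕ} {K : ℕ} (hK : 1 ≤ K)
    (hE : ∀ (g : Gate ι ℕ) (s : Store), G (g.map fun r => (s r).length) →
      (E g).Does (Function.extend f s t) (Function.extend f s t)
        [(g.map fun r => (s r).length).map φ] K)
    {T : ℕ} (h : Runs P s s' C T) (hC : ∀ g ∈ C, G g) :
    (P.transform f E).Does (Function.extend f s t) (Function.extend f s' t) (C.map (Gate.map φ))
      (T * K) := by
  induction h with
  | skip s => exact Does.skip.mono (by omega)
  | push s r b =>
    exact (Does.push (by rw [extend_update hf, hf.extend_apply])).mono (by omega)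
  | pop s r => exact (Does.pop (by rw [extend_update hf, hf.extend_apply])).mono (by omega)
  | emit s g => exact (hE g s (hC _ (by simp))).mono (by omega)
  | seq _ _ ihP ihQ =>
    simp only [List.mem_append, or_imp, forall_and] at hC
    exact ((ihP hC.1).seq (ihQ hC.2)).congr rfl (by simp) (by rw [add_mul])
  | branch_true hr _ ih =>
    exact (Does.branch_true (by rwa [hf.extend_apply]) (ih hC)).mono (by rw [add_mul]; omega)
  | branch_false hr _ ih =>
    exact (Does.branch_false (by rwa [hf.extend_apply]) (ih hC)).mono (by rw [add_mul]; omega)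
  | loop_done hr => exact (Does.loop_done (by rwa [hf.extend_apply])).mono (by omega)
  | loop_step hr _ _ ihP ihQ =>
    simp only [List.mem_append, or_imp, forall_and] at hC
    refine (Does.loop_step (by rwa [hf.extend_apply]) (ihP hC.1) (ihQ hC.2)).congr rfl (by simp) ?_
    rw [add_mul, add_mul]
    omega

/-- Run a program on the stacks `f 0, f 1, …`. -/
def rename (f : ℕ → ℕ) (P : Prog ι) : Prog ι := P.transform f fun g => .emit (g.map f)

theorem _root_.Runs.does_rename {f : ℕ → ℕ} (hf : f.Injective) {T : ℕ} (h : Runs P s s' C T)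
    (t : Store) :
    (P.rename f).Does (Function.extend f s t) (Function.extend f s' t) C T := by
  refine (h.does_transform hf (G := fun _ => True) (φ := id) le_rfl (fun g s _ => ?_)
    fun _ _ => trivial).congr rfl ?_ (by omega)
  · refine (Does.emit _).congr rfl ?_ le_rfl
    simp [Gate.map_map, hf.extend_apply, Function.comp_def]
  · rw [funext Gate.map_id, List.map_id']

/-! ### Stacks that a program does not mention -/

/-- All stacks mentioned by the program have smaller numbers. -/
def bound : Prog ι → ℕ
  | .skip => 0
  | .push r _ => r + 1
  | .pop r => r + 1
  | .emit _ => 0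
  | .seq P Q => max P.bound Q.bound
  | .branch _ P Q => max P.bound Q.bound
  | .loop _ P => P.bound

theorem _root_.Runs.eq_of_bound_le {T r : ℕ} (h : Runs P s s' C T) (hr : P.bound ≤ r) :
    s' r = s r := by
  induction h with
  | skip | emit | loop_done => rfl
  | push | pop => exact Function.update_of_ne (Nat.ne_of_gt hr) _ _
  | seq _ _ ihP ihQ =>
    rw [bound, max_le_iff] at hr
    rw [ihQ hr.2, ihP hr.1]
  | branch_true _ _ ih => exact ih (le_of_max_le_left hr)
  | branch_false _ _ ih => exact ih (le_of_max_le_right hr)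
  | loop_step _ _ _ ihP ihQ => rw [ihQ hr, ihP hr]

theorem _root_.Runs.length_le {T : ℕ} (h : Runs P s s' C T) (r : ℕ) :
    (s' r).length ≤ (s r).length + T := by
  induction h with
  | push s q b | pop s q => grind [Function.update_apply]
  | _ => omega

/-- Empty the stacks `f 0, …, f (R - 1)`. -/
def clearAll (f : ℕ → ℕ) : ℕ → Prog ι
  | 0 => .skip
  | R + 1 => .seq (.clearAll f R) (.clear (f R))

theorem does_clearAll {f : ℕ → ℕ} (hf : f.Injective) (R : ℕ) {s t : Store} {L : ℕ}
    (hL : ∀ r, (s r).length ≤ L) :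
    (clearAll f R : Prog ι).Does (Function.extend f s t)
      (Function.extend f (fun r => if r < R then [] else s r) t) [] (R * (2 * L + 1) + 1) := by
  induction R with
  | zero => exact Does.skip.congr (by simp) rfl (by omega)
  | succ R ih =>
    refine (ih.seq_nil (does_clear (f R) _)).congr ?_ rfl ?_
    · rw [← extend_update hf]
      congr 1
      grind [Function.update_apply]
    · have := hL R
      rw [hf.extend_apply, if_neg (lt_irrefl R), add_mul]
      omega

end Prog

/-! ## Relabelling the qubits that a program addresses

The stacks `0`–`3` hold the input of a program. The stacks `4`–`11` are registers: `5`, `6` and `10`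
hold the parameters of a relabelling, `7` and `8` the new numbers of the qubits of a gate, and `4`,
`9` and `11` are temporary. -/

namespace Prog
variable {ι : Type} {s : Store}

/-- Push the top of stack `a` to stack `b`. -/
def pushTop (a b : ℕ) : Prog ι := .branch a (.push b true) (.push b false)

theorem does_pushTop {a b : ℕ} {x : Bool} {l : List Bool} (h : s a = x :: l) :
    (pushTop a b : Prog ι).Does s (Function.update s b (x :: s b)) [] 2 := by
  cases x
  · exact .branch_false (by simp [h]) (.push rfl)
  · exact .branch_true (by simp [h]) (.push rfl)

/-- Move the bits on stack `a` to stack `b`, which reverses their order. -/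
def moveBits (a b : ℕ) : Prog ι := .loop a (.seq (.pushTop a b) (.pop a))

theorem does_moveBits {a b : ℕ} (hab : a ≠ b) (s : Store) :
    (moveBits a b : Prog ι).Does s
      (Function.update (Function.update s a []) b ((s a).reverse ++ s b)) []
      (4 * (s a).length + 1) := by
  refine (Does.loop_nil (k := 3) (n := (s a).length)
    (fun i => Function.update (Function.update s a ((s a).drop i)) b
      (((s a).take i).reverse ++ s b)) (by simp [hab]) ?_ (by simp) (by simp)).mono (by omega)
  intro i hi
  refine (does_pushTop (x := (s a)[i]) (l := (s a).drop (i + 1)) ?_).seq_nil (.pop ?_)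
  · simp [hab]
  · have take_succ : (s a).take (i + 1) = (s a).take i ++ [(s a)[i]] := by simp
    grind [Function.update_apply, List.tail_drop]

/-- The new number of qubit `h`: the first `N` qubits are shifted by `A`, and all others by `B`. -/
def relabelIndex (N A B h : ℕ) : ℕ := if h < N then h + A else h + B

theorem relabelIndex_le (N A B h : ℕ) : relabelIndex N A B h ≤ h + (A + B) := by
  unfold relabelIndex
  split_ifs <;> omega

/-- The registers hold the parameters of the relabelling `relabelIndex N A B`. -/
structure RelabelReady (s : Store) (N A B : ℕ) : Prop where
  s4 : s 4 = []
  s5 : s 5 = unary A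
  s6 : s 6 = unary B
  s9 : s 9 = []
  s10 : s 10 = unary N
  s11 : s 11 = []

theorem RelabelReady.congr {s' : Store} {N A B : ℕ} (h : RelabelReady s N A B)
    (hs : ∀ q ∈ ({4, 5, 6, 9, 10, 11} : Finset ℕ), s' q = s q) : RelabelReady s' N A B := by
  simp only [Finset.mem_insert, Finset.mem_singleton, forall_eq_or_imp, forall_eq] at hs
  obtain ⟨e4, e5, e6, e9, e10, e11⟩ := hs
  exact ⟨e4.trans h.s4, e5.trans h.s5, e6.trans h.s6, e9.trans h.s9, e10.trans h.s10,
    e11.trans h.s11⟩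

/-- Move the bits on stack `q` to stack `9`, add their number to stack `U`, and subtract it from
stack `4`. -/
def measure (q U : ℕ) : Prog ι :=
  .loop q (.seq (.pushTop q 9) (.seq (.pop q) (.seq (.push U true) (.pop 4))))

theorem does_measure {q U N : ℕ} (hq : q ∉ ({4, 9} : Finset ℕ)) (hU : U ∉ ({4, 9, q} : Finset ℕ))
    (s4 : s 4 = unary N) (s9 : s 9 = []) (sU : s U = []) :
    (measure q U : Prog ι).Does s
      (Function.update (Function.update (Function.update (Function.update s q []) 9 (s q).reverse)
        U (unary (s q).length)) 4 (unary (N - (s q).length))) [] (6 * (s q).length + 1) := by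
  simp only [Finset.mem_insert, Finset.mem_singleton, not_or] at hq hU
  refine (Does.loop_nil (k := 5) (n := (s q).length)
    (fun i => Function.update (Function.update (Function.update (Function.update s
      q ((s q).drop i)) 9 ((s q).take i).reverse) U (unary i)) 4 (unary (N - i)))
    ?_ ?_ ?_ (by simp)).mono (by omega)
  · grind [Function.update_apply]
  · intro i hi
    have reverse_take : ((s q).take (i + 1)).reverse = (s q)[i] :: ((s q).take i).reverse := by
      rw [List.take_add_one, List.getElem?_eq_getElem hi, List.reverse_append]
      rfl
    refine (does_pushTop (x := (s q)[i]) (l := (s q).drop (i + 1)) ?_).seq_nil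
      ((Does.pop rfl).seq_nil ((Does.push rfl).seq_nil (.pop ?_)))
    · grind [Function.update_apply, List.drop_eq_getElem_cons]
    · funext r
      by_cases r = q <;> by_cases r = U <;> by_cases r = 9 <;>
        grind [Function.update_apply, List.tail_drop, tail_unary, cons_unary]
  · grind [Function.update_apply, unary_zero]

/-- Write the new number of the qubit given by the height of stack `q` to stack `U`. -/
def index (q U : ℕ) : Prog ι :=
  .seq (.add 10 4 11) (.seq (.measure q U) (.seq (.branch 4 (.add 5 U 11) (.add 6 U 11))
    (.seq (.moveBits 9 q) (.clear 4))))

theorem does_branch_add {U N A B h : ℕ} (hU : U ∉ ({5, 6, 11} : Finset ℕ))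
    (s4 : s 4 = unary (N - h)) (s5 : s 5 = unary A) (s6 : s 6 = unary B) (s11 : s 11 = [])
    (sU : s U = unary h) :
    (.branch 4 (.add 5 U 11) (.add 6 U 11) : Prog ι).Does s
      (Function.update s U (unary (relabelIndex N A B h))) [] (7 * (A + B) + 3) := by
  simp only [Finset.mem_insert, Finset.mem_singleton, not_or] at hU
  obtain ⟨U5, U6, U11⟩ := hU
  unfold relabelIndex
  split_ifs with hN
  · refine (Does.branch_true ?_ (does_add (Ne.symm U5) (by norm_num) U11 s5 s11)).congr ?_ rfl
      (by omega)
    · simp [s4, hN]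
    · simp [sU, add_comm]
  · refine (Does.branch_false ?_ (does_add (Ne.symm U6) (by norm_num) U11 s6 s11)).congr ?_ rfl
      (by omega)
    · simpa [s4] using hN
    · simp [sU, add_comm]

theorem does_index {q U N A B : ℕ} (hq : q ∉ Finset.Ico 4 12) (hU : U ∈ ({7, 8} : Finset ℕ))
    (hs : RelabelReady s N A B) (sU : s U = []) :
    (index q U : Prog ι).Does s
      (Function.update s U (unary (relabelIndex N A B (s q).length))) []
      (10 * (s q).length + 9 * N + 7 * (A + B) + 8) := by
  simp only [Finset.mem_Ico, Finset.mem_insert, Finset.mem_singleton] at hq hU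
  obtain ⟨s4, s5, s6, s9, s10, s11⟩ := hs
  refine ((does_add (h := N) (by norm_num) (by norm_num) (by norm_num) s10 s11).seq_nil
    ((does_measure (N := N) (by grind) (by grind) (by simp [s4]) (by simpa using s9)
      (by grind [Function.update_apply])).seq_nil
    ((does_branch_add (N := N) (A := A) (B := B) (h := (s q).length) (by grind)
      ?_ ?_ ?_ ?_ ?_).seq_nil
    ((does_moveBits (by grind) _).seq_nil (does_clear 4 _))))).congr ?_ rfl ?_
  any_goals grind [Function.update_apply]
  · have read_q : Function.update s 4 (unary N ++ s 4) q = s q := by grind [Function.update_apply]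
    rw [read_q]
    funext r
    simp only [Function.update_apply]
    grind [List.reverse_reverse]
  · grind [Function.update_apply, length_unary]

/-- Write the one-qubit gate `g` on the relabelled qubit given by stack `q`. -/
def emitSingle (q : ℕ) (g : Gate ι ℕ) : Prog ι :=
  .seq (.index q 7) (.seq (.emit g) (.clear 7))

/-- Write the gate `g` with renamed stacks and relabelled qubits. -/
def emitIndexed (f : ℕ → ℕ) : Gate ι ℕ → Prog ι
  | .hadamard r => .emitSingle (f r) (.hadamard 7)
  | .tgate r => .emitSingle (f r) (.tgate 7)
  | .extra i r => .emitSingle (f r) (.extra i 7)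
  | .cnot c t => .seq (.index (f c) 7) (.seq (.index (f t) 8) (.seq (.emit (.cnot 7 8))
      (.seq (.clear 7) (.clear 8))))

section Emit
variable {N A B W : ℕ}

theorem does_emitSingle {q : ℕ} (hq : q ∉ Finset.Ico 4 12) (hs : RelabelReady s N A B)
    (s7 : s 7 = []) (hW : (s q).length < W) (g : Gate ι ℕ) :
    (emitSingle q g).Does s s [g.map fun r =>
        (Function.update s 7 (unary (relabelIndex N A B (s q).length)) r).length]
      (24 * W + 18 * N + 18 * (A + B) + 20) := by
  refine ((does_index hq (by simp) hs s7).seq_nil ((Does.emit g).seq (does_clear 7 _))).congr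
    ?_ rfl ?_
  · rw [Function.update_idem, ← s7, Function.update_eq_self]
  · have := relabelIndex_le N A B (s q).length
    rw [Function.update_self, length_unary]
    omega

theorem does_emitIndexed {f : ℕ → ℕ} (hf : ∀ r, f r ∉ Finset.Ico 4 12)
    (hs : RelabelReady s N A B) (s7 : s 7 = []) (s8 : s 8 = []) (g : Gate ι ℕ)
    (hg : (g.map fun r => (s (f r)).length).Valid W) :
    (emitIndexed f g).Does s s [(g.map fun r => (s (f r)).length).map (relabelIndex N A B)]
      (24 * W + 18 * N + 18 * (A + B) + 20) := by
  cases g with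
  | hadamard r | tgate r | extra i r =>
    exact (does_emitSingle (hf r) hs s7 hg _).congr rfl (by simp [Gate.map]) le_rfl
  | cnot c t =>
    obtain ⟨hc, ht, -⟩ : (s (f c)).length < W ∧ (s (f t)).length < W ∧ _ := hg
    have ready (l : List Bool) : RelabelReady (Function.update s 7 l) N A B := hs.congr (by simp)
    have read_t (l : List Bool) : Function.update s 7 l (f t) = s (f t) :=
      Function.update_of_ne (by rintro h7; simpa [h7] using hf t) _ _
    refine ((does_index (hf c) (by simp) hs s7).seq_nil
      ((does_index (hf t) (by simp) (ready _) (by simpa using s8)).seq_nil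
      ((Does.emit (.cnot 7 8)).seq ((does_clear 7 _).seq_nil (does_clear 8 _))))).congr ?_ ?_ ?_
    · grind [Function.update_apply]
    · simp [Gate.map, read_t]
    · have control_le := relabelIndex_le N A B (s (f c)).length
      have target_le := relabelIndex_le N A B (s (f t)).length
      simp only [read_t, Function.update_self, length_unary, ne_eq, Nat.reduceEqDiff,
        not_false_eq_true, Function.update_of_ne]
      omega

theorem _root_.Runs.does_relabel {f : ℕ → ℕ} (hf : f.Injective)
    (hf' : ∀ r, f r ∉ Finset.Ico 4 12) {P : Prog ι} {s' t : Store} {C : List (Gate ι ℕ)} {T : ℕ}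
    (h : Runs P s s' C T) (hC : ∀ g ∈ C, g.Valid W) (ht : RelabelReady t N A B) (t7 : t 7 = [])
    (t8 : t 8 = []) :
    (P.transform f (emitIndexed f)).Does (Function.extend f s t) (Function.extend f s' t)
      (C.map (Gate.map (relabelIndex N A B))) (T * (24 * W + 18 * N + 18 * (A + B) + 20)) := by
  have extend_register (s : Store) (q : ℕ) (hq : q ∈ Finset.Ico 4 12) :
      Function.extend f s t q = t q :=
    Function.extend_apply' _ _ _ fun ⟨r, hr⟩ => hf' r (hr ▸ hq)
  refine h.does_transform hf (by omega) (fun g s hg => ?_) hC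
  have emits := does_emitIndexed (s := Function.extend f s t) (W := W) hf'
    (ht.congr fun q hq => extend_register s q (by simp at hq ⊢; omega))
    ((extend_register s 7 (by simp)).trans t7) ((extend_register s 8 (by simp)).trans t8) g
    (by simpa only [hf.extend_apply] using hg)
  simpa only [hf.extend_apply] using emits

end Emit

end Prog

/-! ## Uniformity of composed circuits -/

/-- `f` grows at most polynomially with `size`. -/
def PolyBounded {X : Type} (size f : X → ℕ) : Prop :=
  ∃ p : Polynomial ℕ, ∀ x, f x ≤ p.eval (size x)

namespace PolyBounded
variable {X : Type} {size f g : X → ℕ}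

theorem eval (p : Polynomial ℕ) : PolyBounded size fun x => p.eval (size x) :=
  ⟨p, fun _ => le_rfl⟩

theorem refl : PolyBounded size size := by simpa using eval (size := size) Polynomial.X

theorem const (c : ℕ) : PolyBounded size fun _ => c := by
  simpa using eval (size := size) (Polynomial.C c)

theorem mono (hg : PolyBounded size g) (h : ∀ x, f x ≤ g x) : PolyBounded size f :=
  let ⟨p, hp⟩ := hg
  ⟨p, fun x => (h x).trans (hp x)⟩

theorem add (hf : PolyBounded size f) (hg : PolyBounded size g) :
    PolyBounded size fun x => f x + g x :=
  let ⟨p, hp⟩ := hf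
  let ⟨q, hq⟩ := hg
  ⟨p + q, fun x => by simpa using add_le_add (hp x) (hq x)⟩

theorem mul (hf : PolyBounded size f) (hg : PolyBounded size g) :
    PolyBounded size fun x => f x * g x :=
  let ⟨p, hp⟩ := hf
  let ⟨q, hq⟩ := hg
  ⟨p * q, fun x => by simpa using Nat.mul_le_mul (hp x) (hq x)⟩

theorem comp {Y : Type} (hf : PolyBounded size f) (e : Y → X) :
    PolyBounded (size ∘ e) (f ∘ e) :=
  let ⟨p, hp⟩ := hf
  ⟨p, fun y => hp (e y)⟩

end PolyBounded

namespace Prog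
variable {ι X : Type} {size : X → ℕ} {P Q : Prog ι} {s s' s'' : X → Store}
  {C D : X → List (Gate ι ℕ)}

/-- For all `x`, the program `P` takes the stacks `s x` to `s' x` and writes the circuit `C x`, in
time polynomial in `size x`. -/
def PolyDoes (size : X → ℕ) (P : Prog ι) (s s' : X → Store) (C : X → List (Gate ι ℕ)) : Prop :=
  ∃ p : Polynomial ℕ, ∀ x, P.Does (s x) (s' x) (C x) (p.eval (size x))

namespace PolyDoes

theorem of_does {k : X → ℕ} (hk : PolyBounded size k) (h : ∀ x, P.Does (s x) (s' x) (C x) (k x)) :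
    PolyDoes size P s s' C :=
  let ⟨p, hp⟩ := hk
  ⟨p, fun x => (h x).mono (hp x)⟩

theorem congr (h : PolyDoes size P s s' C) (hs : ∀ x, s' x = s'' x) (hC : ∀ x, C x = D x) :
    PolyDoes size P s s'' D := by
  rwa [← funext hs, ← funext hC]

theorem seq (hP : PolyDoes size P s s' C) (hQ : PolyDoes size Q s' s'' D) :
    PolyDoes size (.seq P Q) s s'' fun x => C x ++ D x :=
  let ⟨p, hp⟩ := hP
  let ⟨q, hq⟩ := hQ
  ⟨p + q, fun x => ((hp x).seq (hq x)).mono (by simp)⟩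

theorem seq_nil (hP : PolyDoes size P s s' fun _ => []) (hQ : PolyDoes size Q s' s'' D) :
    PolyDoes size (.seq P Q) s s'' D :=
  hP.seq hQ

theorem comp {Y : Type} (h : PolyDoes size P s s' C) (e : Y → X) :
    PolyDoes (size ∘ e) P (s ∘ e) (s' ∘ e) (C ∘ e) :=
  let ⟨p, hp⟩ := h
  ⟨p, fun y => hp (e y)⟩

theorem loop {r : ℕ} {n : X → ℕ} (hn : PolyBounded size n) (S : X → ℕ → Store)
    (O : X → ℕ → List (Gate ι ℕ)) (hr : ∀ x i, (S x i r).length = n x - i)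
    (hP : PolyDoes (fun y : Σ x, Fin (n x) => size y.1) P (fun y => S y.1 y.2)
      (fun y => S y.1 (y.2 + 1)) fun y => O y.1 y.2) :
    PolyDoes size (.loop r P) (fun x => S x 0) (fun x => S x (n x))
      fun x => (List.range (n x)).flatMap (O x) := by
  obtain ⟨p, hp⟩ := hP
  exact of_does ((hn.mul ((PolyBounded.eval p).add (.const 1))).add (.const 1)) fun x =>
    Does.loop (S x) (O x) (hr x) fun i hi => hp ⟨x, i, hi⟩

theorem rename (h : PolyDoes size P s s' C) {f : ℕ → ℕ} (hf : f.Injective) (t : X → Store) :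
    PolyDoes size (P.rename f) (fun x => Function.extend f (s x) (t x))
      (fun x => Function.extend f (s' x) (t x)) C :=
  let ⟨p, h⟩ := h
  ⟨p, fun x => let ⟨_, hT, hrun⟩ := h x; (hrun.does_rename hf (t x)).mono hT⟩

theorem relabel (h : PolyDoes size P s s' C) {f : ℕ → ℕ} (hf : f.Injective)
    (hf' : ∀ r, f r ∉ Finset.Ico 4 12) {N W A B : X → ℕ} {t : X → Store}
    (hC : ∀ x, ∀ g ∈ C x, g.Valid (W x)) (hN : PolyBounded size N) (hW : PolyBounded size W)
    (hA : PolyBounded size A) (hB : PolyBounded size B)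
    (ht : ∀ x, RelabelReady (t x) (N x) (A x) (B x)) (t7 : ∀ x, t x 7 = [])
    (t8 : ∀ x, t x 8 = []) :
    PolyDoes size (P.transform f (emitIndexed f)) (fun x => Function.extend f (s x) (t x))
      (fun x => Function.extend f (s' x) (t x))
      fun x => (C x).map (Gate.map (relabelIndex (N x) (A x) (B x))) := by
  choose p T T_le hrun using h
  have hT : PolyBounded size T := ⟨p, T_le⟩
  exact .of_does (hT.mul (((((PolyBounded.const 24).mul hW).add ((PolyBounded.const 18).mul
    hN)).add ((PolyBounded.const 18).mul (hA.add hB))).add (.const 20)))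
    fun x => (hrun x).does_relabel hf hf' (hC x) (ht x) (t7 x) (t8 x)

end PolyDoes

theorem polyDoes_add {a b c : ℕ} (hab : a ≠ b) (hac : a ≠ c) (hbc : b ≠ c) {h : X → ℕ}
    (hh : PolyBounded size h) (ha : ∀ x, s x a = unary (h x)) (hc : ∀ x, s x c = []) :
    PolyDoes size (add a b c : Prog ι) s
      (fun x => Function.update (s x) b (unary (h x) ++ s x b)) fun _ => [] :=
  .of_does (((PolyBounded.const 7).mul hh).add (.const 2)) fun x =>
    does_add hab hac hbc (ha x) (hc x)

theorem exists_polyDoes_eval (p : Polynomial ℕ) {r : ℕ} (hr : r ∉ ({0, 9, 11} : Finset ℕ)) :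
    ∃ P : Prog ι, ∀ {X : Type} {size : X → ℕ} {s : X → Store},
      (∀ x, s x 0 = unary (size x)) → (∀ x, s x r = []) → (∀ x, s x 9 = []) →
      (∀ x, s x 11 = []) →
      PolyDoes size P s (fun x => Function.update (s x) r (unary (p.eval (size x)))) fun _ => [] :=
  let ⟨P, q, hP⟩ := exists_does_eval p hr
  ⟨P, fun s0 sr s9 s11 => ⟨q, fun x => hP _ _ (s0 x) (sr x) (s9 x) (s11 x)⟩⟩

theorem uniformCircuits_iff {input : X → List (List Bool)} {width : X → ℕ} :
    UniformCircuits size input width C ↔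
      (∃ (P : Prog ι) (s' : X → Store), PolyDoes size P (fun x => inputStore (input x)) s' C) ∧
        ∀ x, ∀ g ∈ C x, g.Valid (width x) := by
  constructor
  · rintro ⟨P, p, h⟩
    choose s' T hrun hT using fun x => (h x).1
    exact ⟨⟨P, s', p, fun x => ⟨T x, hT x, hrun x⟩⟩, fun x => (h x).2⟩
  · rintro ⟨⟨P, s', p, h⟩, valid⟩
    exact ⟨P, p, fun x => ⟨let ⟨T, hT, hrun⟩ := h x; ⟨s' x, T, hrun, hT⟩, valid x⟩⟩

/-! ### Stacks of subprograms -/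

/-- Stacks of a subprogram that shares the input stacks. -/
def outerStack (r : ℕ) : ℕ := if r < 4 then r else 2 * r + 100

/-- Stacks of a subprogram that has its own input. -/
def innerStack (r : ℕ) : ℕ := 2 * r + 101

theorem outerStack_injective : outerStack.Injective := by
  intro r q h
  grind [outerStack]

theorem innerStack_injective : innerStack.Injective := by
  intro r q h
  grind [innerStack]

theorem outerStack_notMem_Ico (r : ℕ) : outerStack r ∉ Finset.Ico 4 12 := by
  grind [outerStack]

theorem innerStack_notMem_Ico (r : ℕ) : innerStack r ∉ Finset.Ico 4 12 := by
  grind [innerStack]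

theorem outerStack_ne_innerStack (r q : ℕ) : outerStack r ≠ innerStack q := by
  grind [outerStack, innerStack]

theorem inputStore_of_length_le {l : List (List Bool)} {r : ℕ} (h : l.length ≤ r) :
    inputStore l r = [] := List.getD_eq_default _ _ h

theorem inputStore_unary (n r : ℕ) : inputStore [unary n] r = if r = 0 then unary n else [] := by
  cases r <;> rfl

theorem extend_eq {f : ℕ → ℕ} (hf : f.Injective) {s t t' : Store} (h : ∀ r, s r = t' (f r))
    (h' : ∀ q ∉ Set.range f, t q = t' q) : Function.extend f s t = t' := by
  funext q
  by_cases hq : q ∈ Set.range f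
  · obtain ⟨r, rfl⟩ := hq
    rw [hf.extend_apply, h]
  · rw [Function.extend_apply' _ _ _ hq, h' q hq]

theorem extend_outerStack {s t : Store} (hs : ∀ q, 4 ≤ q → s q = []) (ht : ∀ q < 4, t q = s q)
    (ht' : ∀ q, 108 ≤ q → Even q → t q = []) : Function.extend outerStack s t = t := by
  refine extend_eq outerStack_injective (fun r => ?_) fun _ _ => rfl
  unfold outerStack
  split_ifs with hr
  · exact (ht r hr).symm
  · rw [hs r (by omega), ht' _ (by omega) (by simp [parity_simps])]

/-- Run the subprogram `P` on a copy of stack `0`, with relabelled qubits. -/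
def callInner (P : Prog ι) : Prog ι :=
  .seq (.add 0 101 11) (.seq (P.transform innerStack (.emitIndexed innerStack))
    (.clearAll innerStack (P.bound + 1)))

theorem _root_.Runs.does_callInner {P : Prog ι} {s' t : Store} {C : List (Gate ι ℕ)}
    {T W n A B : ℕ} (h : Runs P (inputStore [unary n]) s' C T) (hC : ∀ g ∈ C, g.Valid W)
    (t0 : t 0 = unary n) (ht : RelabelReady t n A B) (t7 : t 7 = []) (t8 : t 8 = [])
    (inner : ∀ r, t (innerStack r) = []) :
    (callInner P).Does t t (C.map (Gate.map (relabelIndex n A B)))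
      (7 * n + 2 + (T * (24 * W + 18 * n + 18 * (A + B) + 20) +
        ((P.bound + 1) * (2 * (n + T) + 1) + 1))) := by
  have input : Function.update t 101 (unary n ++ t 101) =
      Function.extend innerStack (inputStore [unary n]) t := by
    refine (extend_eq innerStack_injective (fun r => ?_) fun q hq => ?_).symm
    · have := inner r
      rw [inputStore_unary]
      grind [innerStack, Function.update_apply]
    · exact (Function.update_of_ne (fun h => hq ⟨0, h.symm⟩) _ _).symm
  have heights (r : ℕ) : (s' r).length ≤ n + T := by
    refine (h.length_le r).trans (Nat.add_le_add_right ?_ T)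
    rw [inputStore_unary]
    split_ifs <;> simp
  refine (((does_add (by norm_num) (by norm_num) (by norm_num) t0 ht.s11).congr input rfl
    le_rfl).seq_nil ((h.does_relabel innerStack_injective innerStack_notMem_Ico hC ht t7 t8).seq
    (does_clearAll innerStack_injective (P.bound + 1) heights))).congr ?_ (by simp) le_rfl
  refine extend_eq innerStack_injective (fun r => ?_) fun _ _ => rfl
  rw [inner]
  split_ifs with hr
  · rfl
  · rw [h.eq_of_bound_le (by omega), inputStore_unary, if_neg (by omega)]

theorem PolyDoes.callInner {t : X → Store} {W A B : X → ℕ}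
    (h : PolyDoes size P (fun x => inputStore [unary (size x)]) s' C)
    (hC : ∀ x, ∀ g ∈ C x, g.Valid (W x)) (hW : PolyBounded size W) (hA : PolyBounded size A)
    (hB : PolyBounded size B) (t0 : ∀ x, t x 0 = unary (size x))
    (ht : ∀ x, RelabelReady (t x) (size x) (A x) (B x)) (t7 : ∀ x, t x 7 = [])
    (t8 : ∀ x, t x 8 = []) (inner : ∀ x r, t x (innerStack r) = []) :
    PolyDoes size (callInner P) t t
      fun x => (C x).map (Gate.map (relabelIndex (size x) (A x) (B x))) := by
  choose p T T_le hrun using h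
  have hT : PolyBounded size T := ⟨p, T_le⟩
  refine .of_does ?_ fun x => (hrun x).does_callInner (hC x) (t0 x) (ht x) (t7 x) (t8 x) (inner x)
  have relabelled := hT.mul (((((PolyBounded.const 24).mul hW).add ((PolyBounded.const 18).mul
    .refl)).add ((PolyBounded.const 18).mul (hA.add hB))).add (.const 20))
  have cleared := ((PolyBounded.const (P.bound + 1)).mul (((PolyBounded.const 2).mul
    (PolyBounded.refl.add hT)).add (.const 1))).add (.const 1)
  exact (((PolyBounded.const 7).mul .refl).add (.const 2)).add (relabelled.add cleared)

end Prog

/-! ### Channels before an algorithm -/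

theorem relabelIndex_eq_shift_parallel {n t a b j : ℕ} (hj : j < t) :
    Prog.relabelIndex n (n * j) (t * n + b - n + a * j) =
      shiftAncillas (t * n) b ∘ parallelIndex n t a j := by
  funext h
  have block_le : n * j + n ≤ t * n := by
    rw [← mul_add_one, mul_comm t]
    exact Nat.mul_le_mul_left n hj
  simp only [Function.comp_apply, Prog.relabelIndex, shiftAncillas, parallelIndex]
  split_ifs <;> omega

namespace Prog
variable {ι X : Type} {size : X → ℕ} {s : X → Store} {n t a b j : ℕ}

/-- Subtract the unary number on stack `a` from the one on stack `b`. -/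
def subtract (a b : ℕ) : Prog ι := .loop a (.seq (.pop a) (.pop b))

theorem does_subtract {a b h k : ℕ} {s : Store} (hab : a ≠ b) (ha : s a = unary h)
    (hb : s b = unary k) :
    (subtract a b : Prog ι).Does s
      (Function.update (Function.update s a []) b (unary (k - h))) [] (3 * h + 1) := by
  refine (Does.loop_nil (k := 2) (n := h) (fun i =>
    Function.update (Function.update s a (unary (h - i))) b (unary (k - i)))
    (by simp [hab]) ?_ ?_ (by simp)).mono (by omega)
  · intro i _
    refine (Does.pop rfl).seq_nil (.pop ?_)
    grind [Function.update_apply, tail_unary]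
  · grind [Function.update_apply]

/-- The stacks in the loop that applies a channel program to `t` inputs, before iteration `j`. The
relabelling moves the inputs by the number on stack `5` and the ancillas by the one on stack `6`. -/
def applyState (s : Store) (n t a b j : ℕ) : Store :=
  Function.update (Function.update (Function.update (Function.update (Function.update s
    5 (unary (n * j))) 6 (unary (b + a * j))) 10 (unary n)) 12 (unary a)) 13 (unary (t - j))

theorem applyState_of_notMem (s : Store) {q : ℕ} (hq : q ∉ ({5, 6, 10, 12, 13} : Finset ℕ)) :
    applyState s n t a b j q = s q := by
  simp only [applyState, Function.update_apply]
  grind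

/-- The body of the loop that applies a channel program to every input. -/
def applyBody (P : Prog ι) : Prog ι :=
  .seq (.pop 13) (.seq (.callInner P) (.seq (.add 0 5 11) (.add 12 6 11)))

theorem PolyDoes.applyBody {P : Prog ι} {s' : X → Store} {C : X → List (Gate ι ℕ)}
    {t a b j : X → ℕ} (h : PolyDoes size P (fun x => inputStore [unary (size x)]) s' C)
    (hC : ∀ x, ∀ g ∈ C x, g.Valid (size x + a x)) (ha : PolyBounded size a)
    (hA : PolyBounded size fun x => size x * j x)
    (hB : PolyBounded size fun x => b x + a x * j x)
    (s0 : ∀ x, s x 0 = unary (size x)) (hs : ∀ x q, 4 ≤ q → s x q = []) :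
    PolyDoes size (applyBody P) (fun x => applyState (s x) (size x) (t x) (a x) (b x) (j x))
      (fun x => applyState (s x) (size x) (t x) (a x) (b x) (j x + 1))
      fun x => (C x).map (Gate.map (relabelIndex (size x) (size x * j x) (b x + a x * j x))) := by
  have popped : PolyDoes size (.pop 13 : Prog ι)
      (fun x => applyState (s x) (size x) (t x) (a x) (b x) (j x))
      (fun x => Function.update (applyState (s x) (size x) (t x) (a x) (b x) (j x)) 13
        (unary (t x - j x - 1))) fun _ => [] :=
    .of_does (.const 1) fun x => .pop (by simp [applyState])
  refine popped.seq_nil (((h.callInner hC (.add .refl ha) hA hB ?_ ?_ ?_ ?_ ?_).seq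
    ((polyDoes_add (by norm_num) (by norm_num) (by norm_num) .refl ?_ ?_).seq_nil
    (polyDoes_add (by norm_num) (by norm_num) (by norm_num) ha ?_ ?_))).congr ?_ (by simp))
  · intro x
    simpa [applyState] using s0 x
  · intro x
    constructor <;> simp [applyState, hs]
  · simp [applyState, hs]
  · simp [applyState, hs]
  · intro x r
    have : innerStack r ∉ ({5, 6, 10, 12, 13} : Finset ℕ) := by grind [innerStack]
    rw [Function.update_of_ne (by grind), applyState_of_notMem _ this]
    exact hs x _ (by grind [innerStack])
  · intro x
    simpa [applyState] using s0 x
  · simp [applyState, hs]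
  · simp [applyState]
  · simp [applyState, hs]
  · intro x
    funext q
    simp only [applyState, Function.update_apply]
    grind [unary_append_unary]

theorem PolyDoes.applyLoop {P : Prog ι} {s' : X → Store} {C : X → List (Gate ι ℕ)}
    {t a b : X → ℕ} (h : PolyDoes size P (fun x => inputStore [unary (size x)]) s' C)
    (hC : ∀ x, ∀ g ∈ C x, g.Valid (size x + a x)) (ht : PolyBounded size t)
    (ha : PolyBounded size a) (hb : PolyBounded size b) (s0 : ∀ x, s x 0 = unary (size x))
    (hs : ∀ x q, 4 ≤ q → s x q = []) :
    PolyDoes size (.loop 13 P.applyBody)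
      (fun x => applyState (s x) (size x) (t x) (a x) (b x) 0)
      (fun x => applyState (s x) (size x) (t x) (a x) (b x) (t x))
      fun x => (List.range (t x)).flatMap fun j =>
        (C x).map (Gate.map (relabelIndex (size x) (size x * j) (b x + a x * j))) := by
  let e : (Σ x, Fin (t x)) → X := Sigma.fst
  have index_bounded : PolyBounded (size ∘ e) fun y => (y.2 : ℕ) :=
    (ht.comp e).mono fun y => y.2.2.le
  exact .loop ht (fun x => applyState (s x) (size x) (t x) (a x) (b x)) _
    (by simp [applyState]) ((h.comp e).applyBody (fun y => hC y.1) (ha.comp e)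
    (PolyBounded.refl.mul index_bounded) ((hb.comp e).add ((ha.comp e).mul index_bounded))
    (fun y => s0 y.1) fun y => hs y.1)

theorem exists_polyDoes_applyState (t a b : Polynomial ℕ) :
    ∃ P : Prog ι, ∀ s : ℕ → Store, (∀ n, s n 0 = unary n) → (∀ n, s n 3 = unary (t.eval n)) →
      (∀ n q, 4 ≤ q → s n q = []) →
      PolyDoes (fun n => n) P s (fun n => applyState (s n) n (t.eval n) (a.eval n)
        (t.eval n * n + b.eval n - n) 0) fun _ => [] := by
  obtain ⟨Pa, pushA⟩ := exists_polyDoes_eval (ι := ι) a (r := 12) (by decide)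
  obtain ⟨Pb, pushB⟩ := exists_polyDoes_eval (ι := ι) (t * .X + b) (r := 6) (by decide)
  refine ⟨.seq (.add 0 10 11) (.seq Pa (.seq Pb (.seq (.add 0 13 11) (.seq (.subtract 13 6)
    (.add 3 13 11))))), fun s s0 s3 hs => ?_⟩
  refine (polyDoes_add (by decide) (by decide) (by decide) .refl s0 ?_).seq_nil
    ((pushA ?_ ?_ ?_ ?_).seq_nil ((pushB ?_ ?_ ?_ ?_).seq_nil
    ((polyDoes_add (h := fun n => n) (by decide) (by decide) (by decide) .refl ?_ ?_).seq_nil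
    (PolyDoes.seq_nil (.of_does (((PolyBounded.const 3).mul .refl).add (.const 1))
      fun n => does_subtract (h := n) (k := t.eval n * n + b.eval n) (by decide) ?_ ?_)
    ((polyDoes_add (h := fun n => t.eval n) (by decide) (by decide) (by decide) (.eval t)
      ?_ ?_).congr (fun n => funext fun q => ?final) fun _ => rfl)))))
  case final =>
    simp only [applyState, Function.update_apply]
    grind [unary_zero]
  all_goals simp [hs, s0, s3]

/-- The stacks on which a preparation circuit is written with its ancillas moved by `a`, and then a
channel circuit. -/
def prepareState (s : Store) (n a : ℕ) : Store :=
  Function.update (Function.update (Function.update s 10 (unary n)) 6 (unary a)) 101 (unary n)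

theorem relabelReady_prepareState {s : Store} (hs : ∀ q, 4 ≤ q → s q = []) :
    RelabelReady (prepareState s n a) n 0 a := by
  constructor <;> simp [prepareState, hs]

theorem prepareState_innerStack {s : Store} (hs : ∀ q, 4 ≤ q → s q = []) (r : ℕ) :
    prepareState s n a (innerStack r) = inputStore [unary n] r := by
  have := hs (innerStack r) (by grind [innerStack])
  rw [inputStore_unary]
  simp only [prepareState, Function.update_apply]
  grind [innerStack]

theorem exists_polyDoes_prepareState (a : Polynomial ℕ) :
    ∃ P : Prog ι, ∀ {X : Type} {size : X → ℕ} (s : X → Store), (∀ x, s x 0 = unary (size x)) →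
      (∀ x q, 4 ≤ q → s x q = []) →
      PolyDoes size P s (fun x => prepareState (s x) (size x) (a.eval (size x))) fun _ => [] := by
  obtain ⟨Pa, pushA⟩ := exists_polyDoes_eval (ι := ι) a (r := 6) (by decide)
  refine ⟨.seq (.add 0 10 11) (.seq Pa (.add 0 101 11)), fun {X size} s s0 hs => ?_⟩
  refine (polyDoes_add (by decide) (by decide) (by decide) .refl s0 ?_).seq_nil
    ((pushA ?_ ?_ ?_ ?_).seq_nil ((polyDoes_add (h := size) (by decide) (by decide) (by decide)
    .refl ?_ ?_).congr (fun x => funext fun q => ?final) fun _ => rfl))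
  case final => simp [prepareState, hs]
  all_goals simp [hs, s0]

end Prog

section Compose
variable {ι : Type} {κ m : ℕ → ℕ} {a b : Polynomial ℕ}

/-- The circuit that applies the channel circuit `CG` to all `t` inputs, and then `CA`. -/
def channelThen (n t a b : ℕ) (CG CA : List (Gate ι ℕ)) : List (Gate ι ℕ) :=
  (parallelCircuit n t a CG).map (Gate.map (shiftAncillas (t * n) b)) ++ CA

theorem channelThen_valid {n t a b : ℕ} {CG CA : List (Gate ι ℕ)}
    (hG : ∀ g ∈ CG, g.Valid (n + a)) (hA : ∀ g ∈ CA, g.Valid (t * n + b)) :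
    ∀ g ∈ channelThen n t a b CG CA, g.Valid (t * n + (b + t * a)) := by
  simp only [channelThen, List.mem_append, List.mem_map]
  rintro _ (⟨g, hg, rfl⟩ | hg)
  · exact (parallelCircuit_valid hG g hg).map (renames_shiftAncillas _ _ _)
  · exact (hA _ hg).mono (by omega)

theorem channelThen_eq_flatMap (n t a b : ℕ) (CG CA : List (Gate ι ℕ)) :
    channelThen n t a b CG CA = ((List.range t).flatMap fun j => CG.map (Gate.map
      (Prog.relabelIndex n (n * j) (t * n + b - n + a * j)))) ++ CA := by
  rw [channelThen, parallelCircuit, List.map_flatMap]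
  congr 1
  refine List.flatMap_congr fun j hj => ?_
  rw [List.map_map, relabelIndex_eq_shift_parallel (List.mem_range.1 hj)]
  exact List.map_congr_left fun g _ => Gate.map_map _ _ g

theorem uniformCircuits_channelThen {t : Polynomial ℕ} {CG CA : ℕ → List (Gate ι ℕ)}
    (hG : UniformCircuits (fun n => n) (fun n => [unary n]) (fun n => n + a.eval n) CG)
    (hA : UniformCircuits (fun n => n) (fun n => publicParams κ m n ++ [unary (t.eval n)])
      (fun n => t.eval n * n + b.eval n) CA) :
    UniformCircuits (fun n => n) (fun n => publicParams κ m n ++ [unary (t.eval n)])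
      (fun n => t.eval n * n + (b + t * a).eval n)
      (fun n => channelThen n (t.eval n) (a.eval n) (b.eval n) (CG n) (CA n)) := by
  rw [Prog.uniformCircuits_iff] at hG hA ⊢
  obtain ⟨⟨PG, sG, doesG⟩, validG⟩ := hG
  obtain ⟨⟨PA, sA, doesA⟩, validA⟩ := hA
  refine ⟨?_, fun n => by simpa using channelThen_valid (validG n) (validA n)⟩
  obtain ⟨setup, doesSetup⟩ := Prog.exists_polyDoes_applyState (ι := ι) t a b
  let s := fun n => inputStore (publicParams κ m n ++ [unary (t.eval n)])
  have s_nil (n q : ℕ) (hq : 4 ≤ q) : s n q = [] := Prog.inputStore_of_length_le hq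
  have applied := doesG.applyLoop (s := s) validG (.eval t) (.eval a)
    (b := fun n => t.eval n * n + b.eval n - n)
    ((PolyBounded.eval (t * .X + b)).mono fun n => by simp) (fun _ => rfl) s_nil
  have renamed := doesA.rename Prog.outerStack_injective
    fun n => Prog.applyState (s n) n (t.eval n) (a.eval n) (t.eval n * n + b.eval n - n) (t.eval n)
  have start (n : ℕ) := Prog.extend_outerStack (s_nil n)
    (t := Prog.applyState (s n) n (t.eval n) (a.eval n) (t.eval n * n + b.eval n - n) (t.eval n))
    (fun q hq => Prog.applyState_of_notMem _ (by grind))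
    fun q hq _ => (Prog.applyState_of_notMem _ (by grind)).trans (s_nil n q (by omega))
  rw [funext start] at renamed
  exact ⟨_, _, ((doesSetup s (fun _ => rfl) (fun _ => rfl) s_nil).seq_nil
    (applied.seq renamed)).congr (fun _ => rfl) fun n => (channelThen_eq_flatMap _ _ _ _ _ _).symm⟩

/-- The circuit that runs `CP` and then `CG` on the same qubits, with `a` ancillas for `CG`. -/
def prepareThen (n a : ℕ) (CP CG : List (Gate ι ℕ)) : List (Gate ι ℕ) :=
  CP.map (Gate.map (shiftAncillas n a)) ++ CG

theorem prepareThen_valid {n a b : ℕ} {CP CG : List (Gate ι ℕ)}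
    (hP : ∀ g ∈ CP, g.Valid (n + b)) (hG : ∀ g ∈ CG, g.Valid (n + a)) :
    ∀ g ∈ prepareThen n a CP CG, g.Valid (n + (a + b)) := by
  simp only [prepareThen, List.mem_append, List.mem_map]
  rintro _ (⟨g, hg, rfl⟩ | hg)
  · exact (hP g hg).map (renames_shiftAncillas _ _ _)
  · exact (hG _ hg).mono (by omega)

theorem uniformCircuits_prepareThen {CG : ℕ → List (Gate ι ℕ)}
    {CP : (Σ n : ℕ, Fin (κ n) → Bool) → List (Gate ι ℕ)}
    (hP : UniformCircuits (fun x => x.1) (fun x => publicParams κ m x.1 ++ [List.ofFn x.2])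
      (fun x => x.1 + b.eval x.1) CP)
    (hG : UniformCircuits (fun n => n) (fun n => [unary n]) (fun n => n + a.eval n) CG) :
    UniformCircuits (fun x => x.1) (fun x => publicParams κ m x.1 ++ [List.ofFn x.2])
      (fun x => x.1 + (a + b).eval x.1)
      (fun x => prepareThen x.1 (a.eval x.1) (CP x) (CG x.1)) := by
  rw [Prog.uniformCircuits_iff] at hP hG ⊢
  obtain ⟨⟨PP, sP, doesP⟩, validP⟩ := hP
  obtain ⟨⟨PG, sG, doesG⟩, validG⟩ := hG
  refine ⟨?_, fun x => by simpa using prepareThen_valid (validP x) (validG x.1)⟩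
  obtain ⟨setup, doesSetup⟩ := Prog.exists_polyDoes_prepareState (ι := ι) a
  let X := Σ n : ℕ, Fin (κ n) → Bool
  let e : X → ℕ := Sigma.fst
  let s (x : X) := inputStore (publicParams κ m x.1 ++ [List.ofFn x.2])
  let ready (x : X) := Prog.prepareState (s x) x.1 (a.eval x.1)
  have s_nil (x : X) (q : ℕ) (hq : 4 ≤ q) : s x q = [] := Prog.inputStore_of_length_le hq
  have prepared := doesP.relabel Prog.outerStack_injective Prog.outerStack_notMem_Ico (N := e)
    (t := ready) validP .refl (.add .refl (.eval b)) (.const 0) (.eval a)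
    (fun x => Prog.relabelReady_prepareState (s_nil x))
    (by simp [ready, Prog.prepareState, s_nil]) (by simp [ready, Prog.prepareState, s_nil])
  have applied := (doesG.comp e).rename Prog.innerStack_injective
    fun x => Function.extend Prog.outerStack (sP x) (ready x)
  have outer_start (x : X) : Function.extend Prog.outerStack (s x) (ready x) = ready x :=
    Prog.extend_outerStack (s_nil x)
      (fun q hq => by simp only [ready, Prog.prepareState, Function.update_apply]; grind)
      fun q hq _ => by simp only [ready, Prog.prepareState, Function.update_apply]; grind
  have inner_start (x : X) : Function.extend Prog.innerStack (inputStore [unary (e x)])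
      (Function.extend Prog.outerStack (sP x) (ready x)) =
        Function.extend Prog.outerStack (sP x) (ready x) := by
    refine Prog.extend_eq Prog.innerStack_injective (fun r => ?_) fun _ _ => rfl
    rw [Function.extend_apply' _ _ _ fun ⟨q, hq⟩ => Prog.outerStack_ne_innerStack q r hq]
    exact (Prog.prepareState_innerStack (s_nil x) r).symm
  rw [funext outer_start] at prepared
  simp only [Function.comp_def, inner_start] at applied
  exact ⟨_, _, (doesSetup s (fun _ => rfl) s_nil).seq_nil (prepared.seq applied)⟩

end Compose

/-! ## Negligible functions -/

theorem Negligible.mono_of_lt {f g : ℕ → ℝ} (hg : Negligible g) (N : ℕ)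
    (h : ∀ n > N, f n ≤ g n) : Negligible f := by
  intro c
  obtain ⟨n₀, hn₀⟩ := hg c
  exact ⟨max n₀ N, fun n hn => (h n (lt_of_le_of_lt (le_max_right _ _) hn)).trans_lt
    (hn₀ n (lt_of_le_of_lt (le_max_left _ _) hn))⟩

theorem Negligible.add {f g : ℕ → ℝ} (hf : Negligible f) (hg : Negligible g) :
    Negligible fun n => f n + g n := by
  intro c
  obtain ⟨n₀, hn₀⟩ := hf (c + 1)
  obtain ⟨n₁, hn₁⟩ := hg (c + 1)
  refine ⟨max (max n₀ n₁) 1, fun n hn => ?_⟩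
  simp only [gt_iff_lt, max_lt_iff] at hn
  have two_le : (2 : ℝ) ≤ n := by exact_mod_cast hn.2
  have inv_le_half : ((n : ℝ) ^ (c + 1))⁻¹ ≤ ((n : ℝ) ^ c)⁻¹ / 2 := by
    rw [pow_succ, mul_inv, div_eq_mul_inv]
    gcongr
  linarith [hn₀ n hn.1.1, hn₁ n hn.1.2]

theorem exists_eval_le_pow (p : Polynomial ℕ) : ∃ d : ℕ, ∀ n ≥ 2, p.eval n ≤ n ^ d := by
  induction p using Polynomial.recOnHorner with
  | M0 => exact ⟨0, fun n _ => by simp⟩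
  | MC p a _ _ ih =>
    obtain ⟨d, hd⟩ := ih
    refine ⟨d + a + 1, fun n hn => ?_⟩
    rw [Polynomial.eval_add, Polynomial.eval_C]
    calc p.eval n + a ≤ n ^ (d + a) + n ^ (d + a) := by
          refine add_le_add ((hd n hn).trans (Nat.pow_le_pow_right (by omega) (by omega))) ?_
          exact (Nat.lt_pow_self (by omega)).le.trans
            (Nat.pow_le_pow_right (by omega) (Nat.le_add_left a d))
      _ = n ^ (d + a) * 2 := (mul_two _).symm
      _ ≤ n ^ (d + a + 1) := by rw [pow_succ]; exact Nat.mul_le_mul_left _ hn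
  | MX p _ ih =>
    obtain ⟨d, hd⟩ := ih
    refine ⟨d + 1, fun n hn => ?_⟩
    simp only [Polynomial.eval_mul, Polynomial.eval_X, pow_succ]
    exact Nat.mul_le_mul_right _ (hd n hn)

theorem negligible_div_two_pow {m : ℕ → ℕ}
    (h : (fun n : ℕ => Real.log n) =o[Filter.atTop] (fun n : ℕ => (m n : ℝ))) (p : Polynomial ℕ) :
    Negligible fun n => ((p.eval n : ℕ) : ℝ) / 2 ^ m n := by
  obtain ⟨d, hd⟩ := exists_eval_le_pow p
  intro c
  set K := d + c + 1 with hK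
  have : (0 : ℝ) < Real.log 2 := Real.log_pos one_lt_two
  obtain ⟨n₀, hn₀⟩ := Filter.eventually_atTop.1
    (h.bound (c := Real.log 2 / K) (by positivity))
  refine ⟨max n₀ 1, fun n hn => ?_⟩
  simp only [gt_iff_lt, max_lt_iff] at hn
  have two_le : (2 : ℝ) ≤ n := by exact_mod_cast hn.2
  have log_bound := hn₀ n hn.1.le
  rw [Real.norm_of_nonneg (Real.log_nonneg (by linarith)), Real.norm_of_nonneg (by positivity),
    div_mul_eq_mul_div, le_div_iff₀ (by positivity)] at log_bound
  rw [div_lt_iff₀ (by positivity), inv_mul_eq_div, lt_div_iff₀ (by positivity)]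
  calc ((p.eval n : ℕ) : ℝ) * n ^ c ≤ n ^ d * n ^ c := by
        gcongr
        exact_mod_cast hd n (by omega)
    _ < n ^ K := by
        rw [hK, ← pow_add]
        exact pow_lt_pow_right₀ (by linarith) (by omega)
    _ ≤ 2 ^ m n := by
        rw [← Real.log_le_log_iff (by positivity) (by positivity), Real.log_pow, Real.log_pow]
        linarith

theorem isLittleO_log_of_negligible {m : ℕ → ℕ} {r : ℝ} (hr : 0 < r)
    (h : Negligible fun n => r / 2 ^ m n) :
    (fun n : ℕ => Real.log n) =o[Filter.atTop] (fun n : ℕ => (m n : ℝ)) := by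
  refine Asymptotics.IsLittleO.of_bound fun ε hε => ?_
  have : (0 : ℝ) < Real.log 2 := Real.log_pos one_lt_two
  obtain ⟨c, hc⟩ := exists_nat_gt (Real.log 2 / ε)
  have c_pos : (0 : ℝ) < c := lt_trans (by positivity) hc
  obtain ⟨n₀, hn₀⟩ := h (c + 1)
  obtain ⟨n₁, hn₁⟩ := exists_nat_gt (r⁻¹)
  filter_upwards [Filter.eventually_gt_atTop (max (max n₀ n₁) 1)] with n hn
  simp only [max_lt_iff] at hn
  have one_lt : (1 : ℝ) < n := by exact_mod_cast hn.2
  have one_le_mul : 1 ≤ r * n := by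
    rw [← mul_inv_cancel₀ hr.ne']
    gcongr
    exact hn₁.le.trans (by exact_mod_cast hn.1.2.le)
  have small := hn₀ n hn.1.1
  rw [div_lt_iff₀ (by positivity), inv_mul_eq_div, lt_div_iff₀ (by positivity)] at small
  have pow_le : (n : ℝ) ^ c ≤ 2 ^ m n :=
    calc (n : ℝ) ^ c ≤ n ^ c * (r * n) := le_mul_of_one_le_right (by positivity) one_le_mul
      _ = r * n ^ (c + 1) := by ring
      _ ≤ 2 ^ m n := small.le
  rw [← Real.log_le_log_iff (by positivity) (by positivity), Real.log_pow, Real.log_pow] at pow_le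
  rw [Real.norm_of_nonneg (Real.log_nonneg one_lt.le), Real.norm_of_nonneg (by positivity)]
  rw [div_lt_iff₀ hε] at hc
  refine le_of_mul_le_mul_left (?_ : c * Real.log n ≤ c * (ε * m n)) c_pos
  calc c * Real.log n ≤ m n * Real.log 2 := pow_le
    _ ≤ m n * (ε * c) := by gcongr; linarith
    _ = c * (ε * m n) := by ring

/-! ## Unital noise on all copies -/

theorem copies_zero (n : ℕ) (σ σ' : QOp n) : copies n 0 σ = copies n 0 σ' := by
  ext x y
  simp [copies]

section Noise

variable {ι : Type} (𝒢 : ι → Matrix.unitaryGroup Bool ℂ)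

theorem acceptProb_channelThen {n t a b : ℕ} {CG CA : List (Gate ι ℕ)}
    (hG : ∀ g ∈ CG, g.Valid (n + a)) (hA : ∀ g ∈ CA, g.Valid (t * n + b)) (h : 0 < t * n + b)
    (σ : QOp n) :
    acceptProb 𝒢 (t * n) (b + t * a) (channelThen n t a b CG CA) (copies n t σ) =
      acceptProb 𝒢 (t * n) b CA (copies n t (circuitChannel 𝒢 n a CG σ)) := by
  rw [channelThen, acceptProb_comp 𝒢 (parallelCircuit_valid hG) hA _ h,
    circuitChannel_parallelCircuit 𝒢 hG]

theorem negligible_advantage_channel {κ m : ℕ → ℕ} {ρ : KeyedFamily κ}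
    (hρ : ComputationallyIndistinguishable 𝒢 κ m ρ) {Γ : (n : ℕ) → QOp n → QOp n}
    (hΓ : EfficientlyImplementable 𝒢 Γ) {t b : Polynomial ℕ} {CA : ℕ → List (Gate ι ℕ)}
    (hA : UniformCircuits (fun n => n) (fun n => publicParams κ m n ++ [unary (t.eval n)])
      (fun n => t.eval n * n + b.eval n) CA) :
    Negligible fun n =>
      |(∑ k, acceptProb 𝒢 (t.eval n * n) (b.eval n) (CA n) (copies n (t.eval n) (Γ n (ρ n k)))) /
          2 ^ κ n -
        ∫ σ, acceptProb 𝒢 (t.eval n * n) (b.eval n) (CA n) (copies n (t.eval n) (Γ n σ))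
          ∂(ghse n (m n))| := by
  obtain ⟨a, CG, hG, hΓ⟩ := hΓ
  refine (hρ t (b + t * a) _ (uniformCircuits_channelThen hG hA)).mono_of_lt 0 fun n hn => ?_
  simp only [hΓ]
  rcases Nat.eq_zero_or_pos (t.eval n) with ht | ht
  · rw [ht]
    simp only [fun σ => copies_zero n (circuitChannel 𝒢 n (a.eval n) (CG n) σ) 0, integral_const,
      Finset.sum_const]
    simp [advantage]
  · have width_pos : 0 < t.eval n * n + b.eval n := Nat.add_pos_left (Nat.mul_pos ht hn) _
    simp only [← acceptProb_channelThen 𝒢 ((Prog.uniformCircuits_iff.1 hG).2 n)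
      ((Prog.uniformCircuits_iff.1 hA).2 n) width_pos]
    simp only [Polynomial.eval_add, Polynomial.eval_mul, advantage, le_refl]

/- A unital channel fixes the maximally mixed state, and the ensemble is close to that state both
for the adversary and for the adversary that applies the channel first. -/
theorem abs_integral_channel_sub_le {n t a b m : ℕ} {CG CA : List (Gate ι ℕ)}
    (hG : ∀ g ∈ CG, g.Valid (n + a)) (hA : ∀ g ∈ CA, g.Valid (t * n + b)) (hn : 0 < n)
    (unital : circuitChannel 𝒢 n a CG 1 = 1) :
    |∫ σ, acceptProb 𝒢 (t * n) b CA (copies n t (circuitChannel 𝒢 n a CG σ)) ∂(ghse n m) -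
      ∫ σ, acceptProb 𝒢 (t * n) b CA (copies n t σ) ∂(ghse n m)| ≤ 4 * (t : ℝ) ^ 2 / 2 ^ m := by
  rcases Nat.eq_zero_or_pos t with rfl | ht
  · simp only [fun σ => copies_zero n σ 0]
    simp
  · have maxMixed_fixed : circuitChannel 𝒢 n a CG (maxMixed n) = maxMixed n := by
      rw [maxMixed, circuitChannel_smul, unital]
    have noiseless := abs_integral_acceptProb_sub_le (n := n) (m := m) (t := t) 𝒢 b CA
    have noisy := abs_integral_acceptProb_sub_le (n := n) (m := m) (t := t) 𝒢 (b + t * a)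
      (channelThen n t a b CG CA)
    simp only [acceptProb_channelThen 𝒢 hG hA (Nat.add_pos_left (Nat.mul_pos ht hn) _),
      maxMixed_fixed] at noisy
    rw [abs_sub_comm] at noiseless
    refine ((abs_sub_le _ _ _).trans (add_le_add noisy noiseless)).trans_eq ?_
    ring

theorem IsPRDM.noiseRobust {κ m : ℕ → ℕ} {ρ : KeyedFamily κ}
    (hm : (fun n : ℕ => Real.log n) =o[Filter.atTop] (fun n : ℕ => (m n : ℝ)))
    {Γ : (n : ℕ) → QOp n → QOp n} (unital : ∀ n, IsUnital n (Γ n))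
    (hΓ : EfficientlyImplementable 𝒢 Γ) : NoiseRobust 𝒢 κ m ρ Γ := by
  intro hρ
  refine ⟨hρ.poly_key, ?_, fun t b CA hA => ?_⟩
  · obtain ⟨a, CG, hG, hΓ⟩ := hΓ
    obtain ⟨b, CP, hP, hρ⟩ := hρ.preparable
    refine ⟨a + b, _, uniformCircuits_prepareThen hP hG, fun n k => ?_⟩
    rw [Polynomial.eval_add, prepareThen, circuitChannel_comp 𝒢
      ((Prog.uniformCircuits_iff.1 hP).2 ⟨n, k⟩) ((Prog.uniformCircuits_iff.1 hG).2 n), ← hρ, ← hΓ]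
  · refine ((negligible_advantage_channel 𝒢 hρ.indistinguishable hΓ hA).add
      (negligible_div_two_pow hm (4 * t ^ 2))).mono_of_lt 0 fun n hn => ?_
    obtain ⟨a, CG, hG, hΓ⟩ := hΓ
    have ensemble_close := abs_integral_channel_sub_le (m := m n) 𝒢
      ((Prog.uniformCircuits_iff.1 hG).2 n) ((Prog.uniformCircuits_iff.1 hA).2 n) hn
      ((hΓ n 1).symm.trans (unital n))
    simp only [← hΓ] at ensemble_close
    simp only [Polynomial.eval_mul, Polynomial.eval_pow, Polynomial.eval_ofNat, Nat.cast_mul,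
      Nat.cast_pow, Nat.cast_ofNat]
    exact (abs_sub_le _ _ _).trans (add_le_add_right ensemble_close _)

end Noise

/-! ## The controlled swap as an elementary circuit -/

section ControlledSwap

open Matrix

variable {ι : Type} (𝒢 : ι → Matrix.unitaryGroup Bool ℂ) {N : ℕ}

/-- The eighth root of unity `e^{iπ/4}`, which is the nontrivial entry of the `T` gate. -/
def omega8 : ℂ := Complex.exp (Complex.I * (Real.pi / 4 : ℝ))

theorem omega8_pow_four : omega8 ^ 4 = -1 := by
  rw [omega8, ← Complex.exp_nat_mul, ← Complex.exp_pi_mul_I]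
  congr 1
  push_cast
  ring

theorem tgate_mulVec (q : Fin N) (v : (Fin N → Bool) → ℂ) :
    (Gate.tgate (q : ℕ)).toMatrix 𝒢 N *ᵥ v = fun x => (if x q then omega8 else 1) * v x := by
  funext x
  rw [Gate.toMatrix, onQubit_mulVec]
  have update_self : Function.update x q (x q) = x := Function.update_eq_self q x
  cases hq : x q <;> rw [hq] at update_self <;>
    simp [tMatrix, diagonal, omega8, update_self]

theorem tgates_mulVec (q : Fin N) (k : ℕ) (C : List (Gate ι ℕ)) (v : (Fin N → Bool) → ℂ) :
    circuitMatrix 𝒢 N (List.replicate k (Gate.tgate (q : ℕ)) ++ C) *ᵥ v =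
      circuitMatrix 𝒢 N C *ᵥ fun x => (if x q then omega8 ^ k else 1) * v x := by
  induction k generalizing v with
  | zero => simp
  | succ k ih =>
    rw [List.replicate_succ, List.cons_append, circuitMatrix_cons_mulVec, ih, tgate_mulVec]
    congr 1
    funext x
    cases h : x q <;> simp [h, pow_succ, mul_assoc]

theorem cnot_mulVec {c t : Fin N} (h : c ≠ t) (v : (Fin N → Bool) → ℂ) :
    (Gate.cnot (c : ℕ) t).toMatrix 𝒢 N *ᵥ v = fun x => v (Function.update x t (x t ^^ x c)) :=
  funext (cnotMatrix_mulVec h v)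

theorem hadamard_mulVec (q : Fin N) (v : (Fin N → Bool) → ℂ) :
    (Gate.hadamard (q : ℕ)).toMatrix 𝒢 N *ᵥ v = fun x => (v (Function.update x q false) +
      (if x q then -1 else 1) * v (Function.update x q true)) / (Real.sqrt 2 : ℂ) := by
  funext x
  rw [Gate.toMatrix, onQubit_mulVec]
  cases x q <;> simp [hadamardMatrix] <;> ring

/-- The doubly controlled `Z` gate. Its phase `(-1)^{abc} = ω^{4abc}`, where `ω` has order eight,
comes from `4abc = a + b + c - (a ⊕ b) - (a ⊕ c) - (b ⊕ c) + (a ⊕ b ⊕ c)`, and `T⁷ = T⁻¹`. -/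
def ccz {Q : Type} (c a b : Q) : List (Gate ι Q) :=
  List.replicate 1 (.tgate a) ++ (List.replicate 1 (.tgate b) ++ (List.replicate 1 (.tgate c) ++
  (.cnot a b :: (List.replicate 7 (.tgate b) ++ (.cnot c b :: (List.replicate 1 (.tgate b) ++
  (.cnot a b :: (List.replicate 7 (.tgate b) ++ (.cnot c b :: .cnot a c ::
  (List.replicate 7 (.tgate c) ++ [.cnot a c]))))))))))

theorem ccz_mulVec {c a b : Fin N} (hca : c ≠ a) (hcb : c ≠ b) (hab : a ≠ b)
    (v : (Fin N → Bool) → ℂ) :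
    circuitMatrix 𝒢 N (ccz (c : ℕ) (a : ℕ) (b : ℕ)) *ᵥ v =
      fun x => (if x c && x a && x b then -1 else 1) * v x := by
  simp only [ccz, tgates_mulVec, circuitMatrix_cons_mulVec, cnot_mulVec 𝒢 hcb, cnot_mulVec 𝒢 hab,
    cnot_mulVec 𝒢 hca.symm, circuitMatrix_nil_mulVec]
  funext x
  simp only [Function.update_self, Function.update_of_ne hcb, Function.update_of_ne hab,
    Function.update_of_ne hca.symm, Function.update_of_ne hcb.symm]
  simp only [← mul_assoc]
  refine congrArg₂ _ ?_ (congrArg v (funext fun q => ?_))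
  · cases x a <;> cases x b <;> cases x c <;> simp <;> grind [omega8_pow_four]
  · simp only [Function.update_apply]
    split_ifs with hb hc
    · rw [hb]
      cases x a <;> cases x b <;> cases x c <;> rfl
    · rw [hc]
      cases x a <;> cases x c <;> rfl
    · rfl

/-- The Toffoli gate, a doubly controlled `Z` in a Hadamard-conjugated basis of the target `b`. -/
def toffoli {Q : Type} (c a b : Q) : List (Gate ι Q) :=
  .hadamard b :: (ccz c a b ++ [.hadamard b])

theorem toffoli_mulVec {c a b : Fin N} (hca : c ≠ a) (hcb : c ≠ b) (hab : a ≠ b)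
    (v : (Fin N → Bool) → ℂ) :
    circuitMatrix 𝒢 N (toffoli (c : ℕ) (a : ℕ) (b : ℕ)) *ᵥ v =
      fun x => v (Function.update x b (x b ^^ (x c && x a))) := by
  simp only [toffoli, circuitMatrix_cons_mulVec, circuitMatrix_append_mulVec,
    ccz_mulVec 𝒢 hca hcb hab, hadamard_mulVec, circuitMatrix_nil_mulVec]
  funext x
  simp only [Function.update_self, Function.update_of_ne hcb,
    Function.update_of_ne hab, Function.update_idem, Bool.and_false, Bool.and_true]
  have sqrt_two_mul_self : ((Real.sqrt 2 : ℝ) : ℂ) * (Real.sqrt 2 : ℝ) = 2 := by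
    rw [← Complex.ofReal_mul, Real.mul_self_sqrt (by norm_num), Complex.ofReal_ofNat]
  have sqrt_two_ne_zero : ((Real.sqrt 2 : ℝ) : ℂ) ≠ 0 := fun h => by simp [h] at sqrt_two_mul_self
  cases x a <;> cases x b <;> cases x c <;> simp <;> field_simp <;>
    rw [pow_two, sqrt_two_mul_self] <;> ring

/-- The swap of the qubits `a` and `b`, controlled by `c`. -/
def cswap {Q : Type} (c a b : Q) : List (Gate ι Q) :=
  .cnot b a :: (toffoli c a b ++ [.cnot b a])

theorem cswap_mulVec {c a b : Fin N} (hca : c ≠ a) (hcb : c ≠ b) (hab : a ≠ b)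
    (v : (Fin N → Bool) → ℂ) :
    circuitMatrix 𝒢 N (cswap (c : ℕ) (a : ℕ) (b : ℕ)) *ᵥ v =
      fun x => v (if x c then x ∘ Equiv.swap a b else x) := by
  rw [cswap, circuitMatrix_cons_mulVec, circuitMatrix_append_mulVec, toffoli_mulVec 𝒢 hca hcb hab,
    circuitMatrix_cons_mulVec, circuitMatrix_nil_mulVec, cnot_mulVec 𝒢 hab.symm,
    cnot_mulVec 𝒢 hab.symm]
  funext x
  refine congrArg v (funext fun q => ?_)
  simp only [Function.update_apply]
  split_ifs <;> simp_all [Equiv.swap_apply_def]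
  cases x a <;> cases x b <;> rfl

end ControlledSwap

/-! ## Circuits with one block for each input qubit -/

/-- The qubits that the block number `i` of a circuit with `n` blocks can use: the input qubits `i`
and `n + i`, the qubit `2 * n` shared by all blocks, and the output qubit `0`. -/
def blockQubit (n i : ℕ) : Fin 4 → ℕ := ![i, n + i, 2 * n, 0]

section Blocks

variable {ι : Type}

/-- The circuit `pre`, followed by a block for each `i < n` and by `post`. It is empty for `n = 0`,
where `pre` and `post` could address qubits that do not exist. -/
def blockCircuit (pre body post : List (Gate ι (Fin 4))) (n : ℕ) : List (Gate ι ℕ) :=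
  if n = 0 then [] else pre.map (Gate.map (blockQubit n 0)) ++
    ((List.range n).flatMap (fun i => body.map (Gate.map (blockQubit n i))) ++
      post.map (Gate.map (blockQubit n n)))

namespace Prog

/-- Write a list of gates. -/
def emits : List (Gate ι ℕ) → Prog ι
  | [] => .skip
  | g :: C => .seq (.emit g) (.emits C)

theorem does_emits (C : List (Gate ι ℕ)) (s : Store) :
    (emits C).Does s s (C.map fun g => g.map fun r => (s r).length) (C.length + 1) := by
  induction C with
  | nil => exact Does.skip
  | cons g C ih => exact ((Does.emit g).seq ih).mono (by simp; omega)

theorem PolyDoes.branch_skip {X : Type} {size n : X → ℕ} {P : Prog ι} {s s' : X → Store}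
    {C : X → List (Gate ι ℕ)} (h : PolyDoes size P s s' C) {r : ℕ}
    (hr : ∀ x, s x r = unary (n x)) :
    PolyDoes size (.branch r P .skip) s (fun x => if n x = 0 then s x else s' x)
      fun x => if n x = 0 then [] else C x := by
  obtain ⟨p, hp⟩ := h
  refine .of_does ((PolyBounded.eval p).add (.const 2)) fun x => ?_
  split_ifs with hx
  · exact (Does.branch_false (by simp [hr, hx]) .skip).mono (by omega)
  · exact (Does.branch_true (by simp [hr]; omega) (hp x)).mono (by omega)

/-- The stacks whose heights are the qubits `blockQubit n i`. -/
def blockStack : Fin 4 → ℕ := ![4, 5, 7, 8]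

/-- The stacks before block `i`; stack `6` counts the remaining blocks. -/
def blockState (s : Store) (n i : ℕ) : Store :=
  Function.update (Function.update (Function.update (Function.update s 7 (unary (2 * n))) 6
    (unary (n - i))) 5 (unary (n + i))) 4 (unary i)

theorem does_emits_block {s : Store} (s8 : s 8 = []) (n i : ℕ) (C : List (Gate ι (Fin 4))) :
    (emits (C.map (Gate.map blockStack))).Does (blockState s n i) (blockState s n i)
      (C.map (Gate.map (blockQubit n i))) (C.length + 1) := by
  refine (does_emits _ _).congr rfl ?_ (by simp)
  rw [List.map_map]
  refine List.map_congr_left fun g _ => ?_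
  rw [Function.comp_apply, Gate.map_map]
  congr 1
  funext q
  fin_cases q <;> simp [blockStack, blockQubit, blockState, s8]

/-- Write all blocks of a block circuit. -/
def blocks (body : List (Gate ι (Fin 4))) : Prog ι :=
  .loop 6 (.seq (.emits (body.map (Gate.map blockStack)))
    (.seq (.push 4 true) (.seq (.push 5 true) (.pop 6))))

theorem does_blocks {s : Store} (s8 : s 8 = []) (n : ℕ) (body : List (Gate ι (Fin 4))) :
    (blocks body).Does (blockState s n 0) (blockState s n n)
      ((List.range n).flatMap fun i => body.map (Gate.map (blockQubit n i)))
      (n * (body.length + 5) + 1) := by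
  refine Does.loop (blockState s n) _ (by simp [blockState]) fun i _ => ?_
  refine ((does_emits_block s8 n i body).seq
    ((Does.push rfl).seq_nil ((Does.push rfl).seq_nil (.pop ?_)))).congr rfl (by simp) (by omega)
  funext q
  simp only [blockState, Function.update_apply]
  grind [cons_unary, tail_unary]

/-- Prepare the stacks for the first block. -/
def blockSetup : Prog ι :=
  .seq (.add 0 5 11) (.seq (.add 0 6 11) (.seq (.add 0 7 11) (.add 0 7 11)))

theorem polyDoes_blockSetup {s : ℕ → Store} (s0 : ∀ n, s n 0 = unary n)
    (hs : ∀ n q, 4 ≤ q → s n q = []) :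
    PolyDoes (fun n => n) (blockSetup : Prog ι) s (fun n => blockState (s n) n 0) fun _ => [] := by
  have added {s : ℕ → Store} (r : ℕ) (r0 : 0 ≠ r) (r11 : r ≠ 11) (s0 : ∀ n, s n 0 = unary n)
      (s11 : ∀ n, s n 11 = []) := polyDoes_add (ι := ι) r0 (by decide) r11 .refl s0 s11
  refine ((added 5 (by decide) (by decide) s0 (by simp [hs])).seq_nil
    ((added 6 (by decide) (by decide) (by simp [s0]) (by simp [hs])).seq_nil
    ((added 7 (by decide) (by decide) (by simp [s0]) (by simp [hs])).seq_nil
    (added 7 (by decide) (by decide) (by simp [s0]) (by simp [hs]))))).congr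
    (fun n => funext fun q => ?_) fun _ => rfl
  have := hs n q
  simp only [blockState, Function.update_apply]
  grind [unary_zero, unary_append_unary]

end Prog

theorem uniformCircuits_block {pre body post : List (Gate ι (Fin 4))}
    {input : ℕ → List (List Bool)} {width : ℕ → ℕ} (length_le : ∀ n, (input n).length ≤ 4)
    (input_zero : ∀ n, (input n).getD 0 [] = unary n)
    (valid : ∀ n, ∀ g ∈ blockCircuit pre body post n, g.Valid (width n)) :
    UniformCircuits (fun n => n) input width (blockCircuit pre body post) := by
  have s_nil (n q : ℕ) (hq : 4 ≤ q) : inputStore (input n) q = [] :=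
    Prog.inputStore_of_length_le ((length_le n).trans hq)
  have emitted (C : List (Gate ι (Fin 4))) (i : ℕ → ℕ) := Prog.PolyDoes.of_does
    (size := fun n => n) (.const _)
    fun n => Prog.does_emits_block (s_nil n 8 (by norm_num)) n (i n) C
  have looped := Prog.PolyDoes.of_does (size := fun n => n)
    ((PolyBounded.refl.mul (.const _)).add (.const _))
    fun n => Prog.does_blocks (s_nil n 8 (by norm_num)) n body
  exact Prog.uniformCircuits_iff.2 ⟨⟨_, _, ((Prog.polyDoes_blockSetup input_zero s_nil).seq_nil
    ((emitted pre fun _ => 0).seq (looped.seq (emitted post id)))).branch_skip input_zero⟩, valid⟩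

end Blocks

/-! ## The dephasing channel -/

section Dephasing

open Matrix

variable {ι : Type} (𝒢 : ι → Matrix.unitaryGroup Bool ℂ)

/-- The circuit that copies all `n` qubits to ancillas. Discarding the copies dephases the state. -/
def dephasingCircuit (ι : Type) (n : ℕ) : List (Gate ι ℕ) := blockCircuit [] [.cnot 0 1] [] n

theorem dephasingCircuit_eq (n : ℕ) :
    dephasingCircuit ι n = (List.range n).flatMap fun i => [.cnot i (n + i)] := by
  rw [dephasingCircuit, blockCircuit]
  split_ifs with hn
  · rw [hn, List.range_zero, List.flatMap_nil]
  · simp [Gate.map, blockQubit]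

theorem dephasingCircuit_valid (n : ℕ) : ∀ g ∈ dephasingCircuit ι n, g.Valid (n + n) := by
  simp only [dephasingCircuit_eq, List.mem_flatMap, List.mem_range, List.mem_singleton]
  rintro _ ⟨i, hi, rfl⟩
  refine ⟨?_, ?_, ?_⟩ <;> omega

theorem castAdd_ne_natAdd {n a : ℕ} (i : Fin n) (j : Fin a) :
    Fin.castAdd a i ≠ Fin.natAdd n j :=
  Fin.ne_of_val_ne (i.is_lt.trans_le (Nat.le_add_right n j)).ne

theorem update_append_natAdd {α : Type*} {n a : ℕ} (x : Fin n → α) (z : Fin a → α) (j : Fin a)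
    (b : α) : Function.update (Fin.append x z) (Fin.natAdd n j) b =
      Fin.append x (Function.update z j b) := by
  refine funext <| Fin.addCases (fun i => ?_) fun i => ?_
  · rw [Function.update_of_ne (castAdd_ne_natAdd i j), Fin.append_left, Fin.append_left]
  · rw [Fin.append_right, Function.update_apply, Function.update_apply, Fin.append_right]
    simp only [Fin.natAdd_inj]

theorem update_append_castAdd {α : Type*} {n a : ℕ} (x : Fin n → α) (z : Fin a → α) (i : Fin n)
    (b : α) : Function.update (Fin.append x z) (Fin.castAdd a i) b =
      Fin.append (Function.update x i b) z := by
  refine funext <| Fin.addCases (fun j => ?_) fun j => ?_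
  · rw [Fin.append_left, Function.update_apply, Function.update_apply, Fin.append_left]
    simp only [Fin.castAdd_inj]
  · rw [Function.update_of_ne (castAdd_ne_natAdd i j).symm, Fin.append_right, Fin.append_right]

theorem dephasing_mulVec {n k : ℕ} (hk : k ≤ n) (v : (Fin (n + n) → Bool) → ℂ)
    (x z : Fin n → Bool) :
    (circuitMatrix 𝒢 (n + n) ((List.range k).flatMap fun i => [.cnot i (n + i)]) *ᵥ v)
        (Fin.append x z) =
      v (Fin.append x fun i => if (i : ℕ) < k then z i ^^ x i else z i) := by
  induction k generalizing z with
  | zero => simp [circuitMatrix_nil_mulVec]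
  | succ k ih =>
    let i : Fin n := ⟨k, hk⟩
    rw [List.range_succ, List.flatMap_append, circuitMatrix_append_mulVec,
      List.flatMap_singleton, circuitMatrix_cons_mulVec, circuitMatrix_nil_mulVec]
    refine (congrFun (cnot_mulVec 𝒢 (castAdd_ne_natAdd i i) _) _).trans ?_
    simp only [Fin.append_left, Fin.append_right, update_append_natAdd]
    rw [ih (Nat.le_of_succ_le hk)]
    congr 2
    funext j
    by_cases hj : j = i
    · simp [hj, i]
    · have : (j : ℕ) ≠ k := fun h => hj (Fin.ext h)
      rw [Function.update_of_ne hj]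
      exact if_congr (by omega) rfl rfl

theorem krausOp_dephasingCircuit (n : ℕ) (z : Fin n → Bool) :
    krausOp 𝒢 n n (dephasingCircuit ι n) z = Matrix.single z z 1 := by
  refine Matrix.ext_of_mulVec_single fun y => funext fun x => ?_
  have copies_eq : (∀ j, (z j ^^ x j) = false) ↔ z = x := by simp [funext_iff]
  rw [krausOp_mulVec, dephasingCircuit_eq, dephasing_mulVec 𝒢 le_rfl, withAncillas_append]
  simp only [Fin.is_lt, if_true, copies_eq, mulVec_single_one, col_apply, single_apply,
    Pi.single_apply]
  grind

theorem circuitChannel_dephasingCircuit (n : ℕ) (σ : QOp n) :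
    circuitChannel 𝒢 n n (dephasingCircuit ι n) σ = Matrix.diagonal σ.diag := by
  simp only [circuitChannel_eq_sum, krausOp_dephasingCircuit, conjTranspose_single,
    single_mul_mul_single, star_one, one_mul, mul_one]
  exact sum_single_eq_diagonal σ.diag

theorem efficientlyImplementable_dephasing :
    EfficientlyImplementable 𝒢 fun _ σ => Matrix.diagonal σ.diag := by
  refine ⟨.X, dephasingCircuit ι, uniformCircuits_block (by simp) (by simp) fun n => ?_,
    fun n σ => ?_⟩
  · rw [Polynomial.eval_X]
    exact dephasingCircuit_valid n
  · rw [Polynomial.eval_X, circuitChannel_dephasingCircuit]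

theorem isQuantumChannel_dephasing (n : ℕ) :
    IsQuantumChannel n fun σ => Matrix.diagonal σ.diag := by
  have isChannel := isQuantumChannel_circuitChannel Empty.elim n n (dephasingCircuit Empty n)
  rwa [funext (circuitChannel_dephasingCircuit _ n)] at isChannel

theorem isUnital_dephasing (n : ℕ) : IsUnital n fun σ => Matrix.diagonal σ.diag := by
  simp [IsUnital]

end Dephasing

/-! ## The swap test -/

section SwapTest

open Matrix

variable {ι : Type} (𝒢 : ι → Matrix.unitaryGroup Bool ℂ) {n : ℕ}

/-- The swap test on two registers of `n` qubits, with qubit `2 * n` as control. The last two CNOT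
gates move the outcome to qubit `0`, where it is read. -/
def swapTest (ι : Type) (n : ℕ) : List (Gate ι ℕ) :=
  blockCircuit [.hadamard 2] (cswap 2 0 1) [.hadamard 2, .cnot 3 2, .cnot 2 3] n

theorem map_cswap {Q Q' : Type} (f : Q → Q') (c a b : Q) :
    (cswap c a b : List (Gate ι Q)).map (Gate.map f) = cswap (f c) (f a) (f b) := by
  simp [cswap, toffoli, ccz, Gate.map]

theorem cswap_valid {N c a b : ℕ} (hc : c < N) (ha : a < N) (hb : b < N) (hca : c ≠ a)
    (hcb : c ≠ b) (hab : a ≠ b) : ∀ g ∈ (cswap c a b : List (Gate ι ℕ)), g.Valid N := by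
  simp [cswap, toffoli, ccz, Gate.Valid, hc, ha, hb, hcb, hab, hca.symm, hab.symm]

theorem swapTest_valid (n : ℕ) : ∀ g ∈ swapTest ι n, g.Valid (2 * n + 1) := by
  rw [swapTest, blockCircuit]
  split_ifs with hn
  · simp
  · simp only [List.mem_append, List.mem_flatMap, map_cswap, List.mem_range, List.map_cons,
      List.map_nil, List.mem_cons, List.not_mem_nil, or_false]
    rintro g (rfl | ⟨i, hi, hg⟩ | rfl | rfl | rfl)
    · simp [Gate.map, Gate.Valid, blockQubit]
    · refine cswap_valid ?_ ?_ ?_ ?_ ?_ ?_ g hg <;> simp [blockQubit] <;> omega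
    all_goals simp [Gate.map, Gate.Valid, blockQubit] <;> omega

/-- Exchange the first `k` qubits of two registers of `n` qubits. -/
def blockSwap (n k : ℕ) (q : Fin (2 * n + 1)) : Fin (2 * n + 1) :=
  ⟨if q < min k n then n + q else if n ≤ q ∧ q < n + min k n then q - n else q, by
    split_ifs <;> omega⟩

theorem val_blockSwap (n k : ℕ) (q : Fin (2 * n + 1)) : (blockSwap n k q : ℕ) =
    if q < min k n then n + q else if n ≤ q ∧ q < n + min k n then q - n else q := rfl

theorem blockSwap_zero (q : Fin (2 * n + 1)) : blockSwap n 0 q = q := by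
  rw [Fin.ext_iff, val_blockSwap]
  split_ifs <;> omega

theorem swap_blockSwap {k : ℕ} (hk : k < n) (q : Fin (2 * n + 1)) :
    Equiv.swap (⟨k, by omega⟩ : Fin (2 * n + 1)) ⟨n + k, by omega⟩ (blockSwap n k q) =
      blockSwap n (k + 1) q := by
  rw [Fin.ext_iff, Equiv.swap_apply_def, apply_ite Fin.val, apply_ite Fin.val]
  simp only [Fin.ext_iff, val_blockSwap]
  split_ifs <;> omega

theorem cswapBlocks_mulVec {k : ℕ} (hk : k ≤ n) (v : (Fin (2 * n + 1) → Bool) → ℂ) :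
    circuitMatrix 𝒢 (2 * n + 1) ((List.range k).flatMap fun i =>
      (cswap 2 0 1 : List (Gate ι (Fin 4))).map (Gate.map (blockQubit n i))) *ᵥ v =
      fun x => v (if x (Fin.natAdd (2 * n) 0) then x ∘ blockSwap n k else x) := by
  induction k with
  | zero =>
    have swap_none : blockSwap n 0 = id := funext blockSwap_zero
    simp [circuitMatrix_nil_mulVec, swap_none]
  | succ k ih =>
    let first : Fin (2 * n + 1) := ⟨k, by omega⟩
    let second : Fin (2 * n + 1) := ⟨n + k, by omega⟩
    have control_ne_first : Fin.natAdd (2 * n) 0 ≠ first :=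
      Fin.ne_of_val_ne (by simp [first]; omega)
    have control_ne_second : Fin.natAdd (2 * n) 0 ≠ second :=
      Fin.ne_of_val_ne (by simp [second]; omega)
    have first_ne_second : first ≠ second := Fin.ne_of_val_ne (by simp [first, second]; omega)
    rw [List.range_succ, List.flatMap_append, circuitMatrix_append_mulVec, ih (by omega),
      List.flatMap_singleton, map_cswap]
    refine (cswap_mulVec 𝒢 control_ne_first control_ne_second first_ne_second _).trans ?_
    funext x
    congr 1
    cases hx : x (Fin.natAdd (2 * n) 0)
    · simp [hx]
    · simp only [if_true, Function.comp_apply, hx,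
        Equiv.swap_apply_of_ne_of_ne control_ne_first control_ne_second]
      exact funext fun q => congrArg x (swap_blockSwap hk q)

/-- Exchange the two registers of `n` qubits. -/
def registerSwap (n : ℕ) : Equiv.Perm (Fin (2 * n)) :=
  finProdFinEquiv.permCongr ((Equiv.swap (0 : Fin 2) 1).prodCongr (Equiv.refl (Fin n)))

theorem registerSwap_apply (j : Fin 2) (i : Fin n) :
    registerSwap n (finProdFinEquiv (j, i)) = finProdFinEquiv (Equiv.swap 0 1 j, i) := by
  simp [registerSwap, Equiv.permCongr_apply]

theorem registerSwap_involutive (n : ℕ) : Function.Involutive (registerSwap n) := fun q => by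
  obtain ⟨⟨j, i⟩, rfl⟩ := finProdFinEquiv.surjective q
  rw [registerSwap_apply, registerSwap_apply, Equiv.swap_apply_self]

theorem blockSwap_castAdd (q : Fin (2 * n)) :
    blockSwap n n (Fin.castAdd 1 q) = Fin.castAdd 1 (registerSwap n q) := by
  obtain ⟨⟨j, i⟩, rfl⟩ := finProdFinEquiv.surjective q
  rw [registerSwap_apply]
  apply Fin.ext
  have := i.2
  fin_cases j <;> simp [val_blockSwap, finProdFinEquiv]
  omega

theorem append_comp_blockSwap (x : Fin (2 * n) → Bool) (z : Fin 1 → Bool) :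
    Fin.append x z ∘ blockSwap n n = Fin.append (x ∘ registerSwap n) z := by
  refine funext <| Fin.addCases (fun q => ?_) fun j => ?_
  · rw [Function.comp_apply, blockSwap_castAdd, Fin.append_left, Fin.append_left,
      Function.comp_apply]
  · have control_fixed : blockSwap n n (Fin.natAdd (2 * n) j) = Fin.natAdd (2 * n) j := by
      rw [Fin.ext_iff, val_blockSwap, Fin.val_natAdd]
      split_ifs <;> omega
    rw [Function.comp_apply, control_fixed, Fin.append_right, Fin.append_right]

/-- The permutation of the basis states that exchanges the two registers. -/
def swapStates (n : ℕ) : Equiv.Perm (Fin (2 * n) → Bool) :=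
  (registerSwap n).symm.arrowCongr (Equiv.refl Bool)

theorem swapStates_apply (x : Fin (2 * n) → Bool) : swapStates n x = x ∘ registerSwap n := rfl

theorem swapStates_mul_self (n : ℕ) : swapStates n * swapStates n = 1 :=
  Equiv.ext fun x => funext fun q => congrArg x (registerSwap_involutive n q)

/-- The projection to the states that change sign when the two registers are exchanged. -/
def antisymmetrizer (n : ℕ) : QOp (2 * n) := (1 / 2 : ℂ) • (1 - (swapStates n).permMatrix ℂ)

theorem antisymmetrizer_mulVec (v : (Fin (2 * n) → Bool) → ℂ) (x : Fin (2 * n) → Bool) :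
    (antisymmetrizer n *ᵥ v) x = (v x - v (x ∘ registerSwap n)) / 2 := by
  rw [antisymmetrizer, smul_mulVec, sub_mulVec, one_mulVec, permMatrix_mulVec, Pi.smul_apply,
    Pi.sub_apply, Function.comp_apply, swapStates_apply, smul_eq_mul]
  ring

theorem conjTranspose_antisymmetrizer_mul_self (n : ℕ) :
    (antisymmetrizer n)ᴴ * antisymmetrizer n = antisymmetrizer n := by
  have inv_eq : (swapStates n)⁻¹ = swapStates n := inv_eq_of_mul_eq_one_left (swapStates_mul_self n)
  have swap_sq : (swapStates n).permMatrix ℂ * (swapStates n).permMatrix ℂ = 1 := by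
    rw [← permMatrix_mul, swapStates_mul_self, permMatrix_one]
  rw [antisymmetrizer, conjTranspose_smul, conjTranspose_sub, conjTranspose_one,
    conjTranspose_permMatrix, inv_eq, smul_mul_smul_comm, sub_mul, mul_sub, mul_sub, one_mul,
    one_mul, mul_one, swap_sq]
  simp only [star_div₀, star_one, star_ofNat]
  module

theorem swapTest_mulVec {q₀ : Fin (2 * n)} (hq : (q₀ : ℕ) = 0) {x : Fin (2 * n) → Bool}
    (hx : x q₀ = true) (z : Fin 1 → Bool) (v : (Fin (2 * n) → Bool) → ℂ) :
    (krausOp 𝒢 (2 * n) 1 (swapTest ι n) z *ᵥ v) x =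
      (antisymmetrizer n *ᵥ v) (Function.update x q₀ !z 0) := by
  have n_ne_zero : n ≠ 0 := by have := q₀.is_lt; omega
  let control : Fin (2 * n + 1) := Fin.natAdd (2 * n) 0
  let output : Fin (2 * n + 1) := Fin.castAdd 1 q₀
  have output_ne_control : output ≠ control := castAdd_ne_natAdd _ _
  have pre_eq : ([.hadamard 2] : List (Gate ι (Fin 4))).map (Gate.map (blockQubit n 0)) =
    [.hadamard (control : ℕ)] := rfl
  have post_eq : ([.hadamard 2, .cnot 3 2, .cnot 2 3] : List (Gate ι (Fin 4))).map
      (Gate.map (blockQubit n n)) =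
        [.hadamard (control : ℕ), .cnot output control, .cnot control output] := by
    simp [Gate.map, blockQubit, control, output, hq]
  have sqrt_two_sq : (Real.sqrt 2 : ℂ) * Real.sqrt 2 = 2 := by
    rw [← Complex.ofReal_mul, Real.mul_self_sqrt zero_le_two, Complex.ofReal_ofNat]
  rw [krausOp_mulVec, swapTest, blockCircuit, if_neg n_ne_zero, circuitMatrix_append_mulVec,
    circuitMatrix_append_mulVec, pre_eq, post_eq]
  simp only [circuitMatrix_cons_mulVec, circuitMatrix_nil_mulVec, cswapBlocks_mulVec 𝒢 le_rfl,
    hadamard_mulVec, cnot_mulVec 𝒢 output_ne_control, cnot_mulVec 𝒢 output_ne_control.symm]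
  simp only [Function.update_self, Function.update_of_ne output_ne_control.symm, control, output,
    Fin.append_left, Fin.append_right, hx, update_append_natAdd, update_append_castAdd,
    append_comp_blockSwap, withAncillas_append, Bool.false_eq_true, if_false, if_true,
    antisymmetrizer_mulVec]
  rw [← sqrt_two_sq]
  cases z 0 <;> simp <;> ring

theorem outputBit_iff {n a : ℕ} {q₀ : Fin n} (hq : (q₀ : ℕ) = 0) (x : Fin n → Bool)
    (z : Fin a → Bool) : outputBit x z ↔ x q₀ = true := by
  constructor
  · rintro ⟨i, hi, hxi⟩
    rwa [show i = Fin.castAdd a q₀ from Fin.ext (hi.trans hq.symm), Fin.append_left] at hxi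
  · exact fun hx => ⟨Fin.castAdd a q₀, hq, by rwa [Fin.append_left]⟩

theorem sum_ite_update {Q : Type*} [Fintype Q] [DecidableEq Q] {M : Type*} [AddCommMonoid M]
    (q : Q) (F : (Q → Bool) → M) :
    (∑ x : Q → Bool, ∑ z : Fin 1 → Bool, if x q = true then F (Function.update x q !z 0) else 0) =
      ∑ x, F x := by
  rw [← Fintype.sum_prod_type', ← Finset.sum_filter]
  refine Finset.sum_nbij' (fun x => Function.update x.1 q !x.2 0)
    (fun y => (Function.update y q true, fun _ => !y q)) ?_ ?_ ?_ ?_ ?_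
  · simp
  · simp
  · rintro ⟨x, z⟩ hx
    replace hx : x q = true := by simpa using hx
    have : Function.update x q true = x := by rw [← hx, Function.update_eq_self]
    simp [Prod.ext_iff, funext_iff, this]
  · simp
  · simp

theorem acceptProb_swapTest (hn : 0 < n) (ρ : QOp (2 * n)) :
    acceptProb 𝒢 (2 * n) 1 (swapTest ι n) ρ = (antisymmetrizer n * ρ).trace.re := by
  let q₀ : Fin (2 * n) := ⟨0, by omega⟩
  let A := antisymmetrizer n
  have row_eq {x : Fin (2 * n) → Bool} (hx : x q₀ = true) (z : Fin 1 → Bool) :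
      krausOp 𝒢 (2 * n) 1 (swapTest ι n) z x = A (Function.update x q₀ !z 0) := by
    funext y
    simpa only [mulVec_single_one, col_apply] using swapTest_mulVec 𝒢 rfl hx z (Pi.single y 1)
  have entry_eq {x : Fin (2 * n) → Bool} (hx : x q₀ = true) (z : Fin 1 → Bool) :
      (krausOp 𝒢 (2 * n) 1 (swapTest ι n) z * ρ *
        (krausOp 𝒢 (2 * n) 1 (swapTest ι n) z)ᴴ) x x =
      (A * ρ * Aᴴ) (Function.update x q₀ !z 0) (Function.update x q₀ !z 0) := by
    simp only [Matrix.mul_apply, conjTranspose_apply, row_eq hx]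
  classical
  calc acceptProb 𝒢 (2 * n) 1 (swapTest ι n) ρ
      = ∑ x : Fin (2 * n) → Bool, ∑ z : Fin 1 → Bool, if x q₀ = true then
          ((A * ρ * Aᴴ) (Function.update x q₀ !z 0) (Function.update x q₀ !z 0)).re else 0 := by
        rw [acceptProb_eq_sum]
        refine Finset.sum_congr rfl fun x _ => Finset.sum_congr rfl fun z _ => ?_
        simp only [outputBit_iff (q₀ := q₀) rfl]
        split_ifs with hx
        · rw [entry_eq hx]
        · rfl
    _ = ∑ y, ((A * ρ * Aᴴ) y y).re := sum_ite_update q₀ fun y => ((A * ρ * Aᴴ) y y).re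
    _ = (A * ρ * Aᴴ).trace.re := (Complex.re_sum _ _).symm
    _ = (A * ρ).trace.re := by
        rw [trace_mul_cycle, conjTranspose_antisymmetrizer_mul_self]

theorem trace_swapStates_mul_copies (σ : QOp n) :
    ((swapStates n).permMatrix ℂ * copies n 2 σ).trace = (σ * σ).trace := by
  rw [Equiv.Perm.permMatrix, PEquiv.toMatrix_toPEquiv_mul]
  simp only [Matrix.trace, Matrix.diag_apply, Matrix.mul_apply, submatrix_apply, id,
    swapStates_apply]
  rw [← Fintype.sum_prod_type']
  refine Fintype.sum_equiv ((finProdFinEquiv.symm.arrowCongr (Equiv.refl Bool)).trans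
    ((Equiv.curry _ _ _).trans (finTwoArrowEquiv _))) _ _ fun y => ?_
  simp only [copies, Matrix.of_apply, Fin.prod_univ_two, Function.comp_apply, registerSwap_apply,
    Equiv.swap_apply_left, Equiv.swap_apply_right]
  exact mul_comm _ _

theorem acceptProb_swapTest_copies (hn : 0 < n) (σ : QOp n) :
    acceptProb 𝒢 (2 * n) 1 (swapTest ι n) (copies n 2 σ) =
      (σ.trace ^ 2 - (σ * σ).trace).re / 2 := by
  rw [acceptProb_swapTest 𝒢 hn, antisymmetrizer, smul_mul, sub_mul, one_mul, trace_smul, trace_sub,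
    trace_copies, trace_swapStates_mul_copies]
  simp only [smul_eq_mul, one_div, inv_mul_eq_div, Complex.div_ofNat_re]

end SwapTest

/-! ## The purity lost by dephasing -/

section Purity

variable {n m : ℕ}

theorem integral_cross_term {x y : Fin n → Bool} (hxy : x ≠ y) {z w : Fin m → Bool} (hzw : z ≠ w) :
    ∫ ψ, (ψ.1 (x, z) * star (ψ.1 (y, z)) * (ψ.1 (y, w) * star (ψ.1 (x, w)))).re
      ∂haarState n m = 0 := by
  have phase_invariance := integral_uniformSphere_comp
    (phaseIsometry (Function.update 1 (x, z) (-1)))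
    fun ψ : PureSpace n m => (ψ (x, z) * star (ψ (y, z)) * (ψ (y, w) * star (ψ (x, w)))).re
  have yz_ne : (y, z) ≠ (x, z) := fun h => hxy (Prod.ext_iff.1 h).1.symm
  have yw_ne : (y, w) ≠ (x, z) := fun h => hxy (Prod.ext_iff.1 h).1.symm
  have xw_ne : (x, w) ≠ (x, z) := fun h => hzw (Prod.ext_iff.1 h).2.symm
  simp only [phaseIsometry_apply, Function.update_self, Function.update_of_ne yz_ne,
    Function.update_of_ne yw_ne, Function.update_of_ne xw_ne, Pi.one_apply, Circle.coe_one,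
    one_mul, Circle.coe_neg, neg_mul, Complex.neg_re, integral_neg] at phase_invariance
  rw [haarState_eq_uniformSphere]
  linarith

theorem integral_re_reducedState_mul_symm {x y : Fin n → Bool} (hxy : x ≠ y) :
    ∫ ψ, (reducedState n m ψ.1 x y * reducedState n m ψ.1 y x).re ∂haarState n m =
      2 ^ m / (2 ^ n * 2 ^ m * (2 ^ n * 2 ^ m + 1)) := by
  have expand (ψ : PureSpace n m) : (reducedState n m ψ x y * reducedState n m ψ y x).re =
      ∑ z, ∑ w, (ψ (x, z) * star (ψ (y, z)) * (ψ (y, w) * star (ψ (x, w)))).re := by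
    simp only [reducedState, Matrix.of_apply, Finset.sum_mul_sum, Complex.re_sum]
  have diagonal_term (ψ : PureSpace n m) (z : Fin m → Bool) :
      (ψ (x, z) * star (ψ (y, z)) * (ψ (y, z) * star (ψ (x, z)))).re =
        ‖ψ (x, z)‖ ^ 2 * ‖ψ (y, z)‖ ^ 2 := by
    rw [show ψ (x, z) * star (ψ (y, z)) * (ψ (y, z) * star (ψ (x, z))) =
      ψ (x, z) * starRingEnd ℂ (ψ (x, z)) * (ψ (y, z) * starRingEnd ℂ (ψ (y, z))) by
        simp only [← starRingEnd_apply]; ring, Complex.mul_conj', Complex.mul_conj']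
    rw [← Complex.ofReal_pow, ← Complex.ofReal_pow, ← Complex.ofReal_mul, Complex.ofReal_re]
  have integral_row (z : Fin m → Bool) :
      ∫ ψ, ∑ w, (ψ.1 (x, z) * star (ψ.1 (y, z)) * (ψ.1 (y, w) * star (ψ.1 (x, w)))).re
        ∂haarState n m = 1 / (2 ^ n * 2 ^ m * (2 ^ n * 2 ^ m + 1)) := by
    rw [integral_finsetSum _ fun w _ => integrable_haarState (f := fun ψ : PureSpace n m =>
      (ψ (x, z) * star (ψ (y, z)) * (ψ (y, w) * star (ψ (x, w)))).re) (by fun_prop),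
      Finset.sum_eq_single z (fun w _ hw => integral_cross_term hxy hw.symm) (by simp)]
    simp only [diagonal_term]
    rw [haarState_eq_uniformSphere,
      integral_norm_sq_mul_norm_sq fun h : (x, z) = (y, z) => hxy (Prod.ext_iff.1 h).1,
      card_pureSpace_basis]
  simp only [expand]
  rw [integral_finsetSum _ fun z _ => integrable_haarState (f := fun ψ : PureSpace n m =>
    ∑ w, (ψ (x, z) * star (ψ (y, z)) * (ψ (y, w) * star (ψ (x, w)))).re) (by fun_prop)]
  simp only [integral_row, Finset.sum_const, Finset.card_univ, Fintype.card_fun, Fintype.card_bool,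
    Fintype.card_fin, nsmul_eq_mul, Nat.cast_pow, Nat.cast_ofNat, mul_one_div]

theorem trace_mul_self_sub_diagonal {d : Type*} [Fintype d] [DecidableEq d] {R : Type*} [CommRing R]
    (σ : Matrix d d R) :
    (σ * σ).trace - (Matrix.diagonal σ.diag * Matrix.diagonal σ.diag).trace =
      ∑ x, ∑ y ∈ Finset.univ.erase x, σ x y * σ y x := by
  rw [Matrix.diagonal_mul_diagonal, Matrix.trace_diagonal, Matrix.trace, ← Finset.sum_sub_distrib]
  refine Finset.sum_congr rfl fun x _ => ?_
  rw [Matrix.diag_apply, Matrix.diag_apply, Matrix.mul_apply,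
    ← Finset.add_sum_erase _ _ (Finset.mem_univ x), add_sub_cancel_left]

theorem integral_purity_sub_dephased (n m : ℕ) :
    ∫ ψ, ((reducedState n m ψ.1 * reducedState n m ψ.1).trace -
        (Matrix.diagonal (reducedState n m ψ.1).diag *
          Matrix.diagonal (reducedState n m ψ.1).diag).trace).re ∂haarState n m =
      (2 ^ n - 1) / (2 ^ n * 2 ^ m + 1) := by
  have (x y : Fin n → Bool) : Continuous fun ψ : PureSpace n m => reducedState n m ψ x y :=
    continuous_reducedState.matrix_elem x y
  simp only [trace_mul_self_sub_diagonal, Complex.re_sum]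
  rw [integral_finsetSum _ fun x _ => integrable_haarState (f := fun ψ : PureSpace n m =>
    ∑ y ∈ Finset.univ.erase x, (reducedState n m ψ x y * reducedState n m ψ y x).re) (by fun_prop)]
  have integral_row (x : Fin n → Bool) : ∫ ψ, ∑ y ∈ Finset.univ.erase x,
      (reducedState n m ψ.1 x y * reducedState n m ψ.1 y x).re ∂haarState n m =
        (2 ^ n - 1) * (2 ^ m / (2 ^ n * 2 ^ m * (2 ^ n * 2 ^ m + 1))) := by
    rw [integral_finsetSum _ fun y _ => integrable_haarState (f := fun ψ : PureSpace n m =>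
      (reducedState n m ψ x y * reducedState n m ψ y x).re) (by fun_prop),
      Finset.sum_congr rfl fun y hy =>
        integral_re_reducedState_mul_symm (Finset.ne_of_mem_erase hy).symm]
    simp [Finset.card_erase_of_mem]
  simp only [integral_row, Finset.sum_const, Finset.card_univ, Fintype.card_fun, Fintype.card_bool,
    Fintype.card_fin, nsmul_eq_mul, Nat.cast_pow, Nat.cast_ofNat]
  field_simp

theorem le_integral_swapTest_sub {ι : Type} (𝒢 : ι → Matrix.unitaryGroup Bool ℂ) (hn : 0 < n) :
    1 / 8 / 2 ^ m ≤
      ∫ σ, acceptProb 𝒢 (2 * n) 1 (swapTest ι n) (copies n 2 (Matrix.diagonal σ.diag))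
        ∂ghse n m -
      ∫ σ, acceptProb 𝒢 (2 * n) 1 (swapTest ι n) (copies n 2 σ) ∂ghse n m := by
  have continuous_test := continuous_acceptProb_copies (n := n) (t := 2) 𝒢 1 (swapTest ι n)
  have continuous_dephased_test : Continuous fun σ : QOp n =>
      acceptProb 𝒢 (2 * n) 1 (swapTest ι n) (copies n 2 (Matrix.diagonal σ.diag)) :=
    continuous_test.comp continuous_id.matrix_diag.matrix_diagonal
  have integrable_test : Integrable (fun ψ => acceptProb 𝒢 (2 * n) 1 (swapTest ι n)
      (copies n 2 (reducedState n m ψ.1))) (haarState n m) :=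
    integrable_haarState (continuous_test.comp continuous_reducedState)
  have integrable_dephased_test : Integrable (fun ψ => acceptProb 𝒢 (2 * n) 1 (swapTest ι n)
      (copies n 2 (Matrix.diagonal (reducedState n m ψ.1).diag))) (haarState n m) :=
    integrable_haarState (continuous_dephased_test.comp continuous_reducedState)
  have difference (σ : QOp n) :
      acceptProb 𝒢 (2 * n) 1 (swapTest ι n) (copies n 2 (Matrix.diagonal σ.diag)) -
        acceptProb 𝒢 (2 * n) 1 (swapTest ι n) (copies n 2 σ) =
      ((σ * σ).trace - (Matrix.diagonal σ.diag * Matrix.diagonal σ.diag).trace).re / 2 := by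
    have trace_eq : (Matrix.diagonal σ.diag).trace = σ.trace := Matrix.trace_diagonal _
    rw [acceptProb_swapTest_copies 𝒢 hn, acceptProb_swapTest_copies 𝒢 hn, trace_eq]
    simp only [Complex.sub_re]
    ring
  have two_le : (2 : ℝ) ≤ 2 ^ n := le_self_pow₀ one_le_two hn.ne'
  have one_le : (1 : ℝ) ≤ 2 ^ m := one_le_pow₀ one_le_two
  calc 1 / 8 / 2 ^ m ≤ (2 ^ n - 1 : ℝ) / (2 ^ n * 2 ^ m + 1) / 2 := by
        rw [div_div, div_div, div_le_div_iff₀ (by positivity) (by positivity)]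
        nlinarith
    _ = ∫ ψ, (acceptProb 𝒢 (2 * n) 1 (swapTest ι n)
            (copies n 2 (Matrix.diagonal (reducedState n m ψ.1).diag)) -
          acceptProb 𝒢 (2 * n) 1 (swapTest ι n) (copies n 2 (reducedState n m ψ.1)))
          ∂haarState n m := by
        simp only [difference, integral_div, integral_purity_sub_dephased]
    _ = _ := by
        rw [integral_ghse continuous_test, integral_ghse continuous_dephased_test,
          integral_sub integrable_dephased_test integrable_test]

end Purity

theorem isLittleO_log_of_noiseRobust {ι : Type} (𝒢 : ι → Matrix.unitaryGroup Bool ℂ)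
    {κ m : ℕ → ℕ} {ρ : KeyedFamily κ} (hρ : IsPRDM 𝒢 κ m ρ)
    (robust : NoiseRobust 𝒢 κ m ρ fun _ σ => Matrix.diagonal σ.diag) :
    (fun n : ℕ => Real.log n) =o[Filter.atTop] (fun n : ℕ => (m n : ℝ)) := by
  have eval_two (n : ℕ) : (Polynomial.C 2 : Polynomial ℕ).eval n = 2 := Polynomial.eval_C
  have eval_one (n : ℕ) : (Polynomial.C 1 : Polynomial ℕ).eval n = 1 := Polynomial.eval_C
  have uniform : UniformCircuits (fun n => n)
      (fun n => publicParams κ m n ++ [unary ((Polynomial.C 2 : Polynomial ℕ).eval n)])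
      (fun n => (Polynomial.C 2 : Polynomial ℕ).eval n * n + (Polynomial.C 1 : Polynomial ℕ).eval n)
      (swapTest ι) := by
    refine uniformCircuits_block (fun n => le_rfl) (fun n => rfl) fun n => ?_
    rw [eval_two, eval_one]
    exact swapTest_valid n
  have dephased_vs_haar := (robust hρ).indistinguishable _ _ _ uniform
  have dephased_vs_dephased_haar := negligible_advantage_channel 𝒢 hρ.indistinguishable
    (efficientlyImplementable_dephasing 𝒢) uniform
  refine isLittleO_log_of_negligible (r := 1 / 8) (by norm_num)
    ((dephased_vs_haar.add dephased_vs_dephased_haar).mono_of_lt 0 fun n hn => ?_)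
  rw [eval_two, eval_one]
  refine (le_integral_swapTest_sub 𝒢 hn).trans ?_
  rw [advantage, add_comm, abs_sub_comm]
  exact (le_abs_self _).trans (abs_sub_le _ _ _)

theorem mainTheorem7_general {ι : Type} (𝒢 : ι → Matrix.unitaryGroup Bool ℂ)
    (κ m : ℕ → ℕ) (ρ : KeyedFamily κ) (hρ : IsPRDM 𝒢 κ m ρ) :
    (∀ Γ : (n : ℕ) → QOp n → QOp n,
        (∀ n, IsQuantumChannel n (Γ n)) → (∀ n, IsUnital n (Γ n)) →
        EfficientlyImplementable 𝒢 Γ → NoiseRobust 𝒢 κ m ρ Γ) ↔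
      (fun n : ℕ => Real.log n) =o[Filter.atTop] (fun n : ℕ => (m n : ℝ)) :=
  ⟨fun robust => isLittleO_log_of_noiseRobust 𝒢 hρ (robust _ isQuantumChannel_dephasing
    isUnital_dephasing (efficientlyImplementable_dephasing 𝒢)),
    fun hm _ _ unital hΓ => IsPRDM.noiseRobust 𝒢 hm unital hΓ⟩

end

theorem mainTheorem7 {ι : Type} [Finite ι] (𝒢 : ι → Matrix.unitaryGroup Bool ℂ)
    (κ m : ℕ → ℕ) (ρ : KeyedFamily κ) (hρ : IsPRDM 𝒢 κ m ρ) :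
    (∀ Γ : (n : ℕ) → QOp n → QOp n,
        (∀ n, IsQuantumChannel n (Γ n)) → (∀ n, IsUnital n (Γ n)) →
        EfficientlyImplementable 𝒢 Γ → NoiseRobust 𝒢 κ m ρ Γ) ↔
      (fun n : ℕ => Real.log n) =o[Filter.atTop] (fun n : ℕ => (m n : ℝ)) :=
  mainTheorem7_general 𝒢 κ m ρ hρ
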